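/- **Setting.** Let $\lambda,r,\theta,P_{\rm tx},\sigma^2>0$, $\alpha>2$, $\xi\in(0,1]$, $p\in(0,1)$, and put $\delta=2/\alpha$, $\rho=P_{\rm tx}/\sigma^2$. Consider the typical link of a Poisson bipolar random access network under the Palm distribution and the mean-field assumption. The typical receiver is at the origin and its transmitter at distance $r$; the interferers $X_1,X_2,\dots$ form a homogeneous Poisson process of intensity $\lambda$ in the plane. Interferer $j$ carries the conditional transmission success probability $\mu_j$ of its own link; the $\mu_j$ are i.i.d. with a law $\nu$ on $[0,1]$ with CDF $F$. In each slot $t$, independently of everything else, interferer $j$ has a non-empty buffer ($\zeta_{j,t}=1$) with probability $a_j$ and is granted channel access ($\nu_{j,t}=1$) with probability $p$. Here $a_j$ is the steady-state probability that a unit-size buffer with arrival probability $\xi$ and departure probability $p\mu_j$ per slot is non-empty. All channel gains $H$ are i.i.d. $\exp(1)$ over nodes and slots, and $$\mathrm{SINR}_{0,t}=\frac{P_{\rm tx}H_{00,t}r^{-\alpha}}{\sum_{j\ge1}P_{\rm tx}H_{j0,t}\zeta_{j,t}\nu_{j,t}\|X_j\|^{-\alpha}+\sigma^2}.$$ The typical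 transmitter has a new packet in each slot with probability $\xi$, which replaces the one in its unit-size buffer. If the buffer is non-empty, it transmits with probability $p$, and the packet is delivered by the end of the slot iff $\mathrm{SINR}_{0,t}>\theta$. The age of information $\Delta_0(t)$ becomes the time elapsed since the generation of the delivered packet, and otherwise grows by one per slot. Let $\Phi$ denote the locations $X_j$ together with the $\mu_j$, let $\mu_0^\Phi=\mathbb P(\mathrm{SINR}_{0,t}>\theta\mid\Phi)$, and let $\bar\Delta=\mathbb E^0\big[\limsup_{T\to\infty}\frac1T\sum_{t=1}^T\Delta_0(t)\big]\in[0,\infty]$ be the network average AoI. The network is self-consistent if $\mu_0^\Phi$ has law $\nu$. Put $$\eta^{(k)}(\nu)=\int_0^\infty\frac{(-1)^{k+1}dv}{(1+v^{\alpha/2})^k}\int_0^1\frac{(p\xi)^k\,\nu(dt)}{[\xi+(1-\xi)pt]^k},\qquad c^{(m)}(\eta)=\exp\Big(-\frac{m\theta r^\alpha}{\rho}-\lambda\pi r^2\theta^\delta\sum_{k=1}^m\binom mk\eta^{(k)}\Big).$$ **Theorem.** 1. For every $\nu$: $\bar\Delta=\frac1\xi-1+\mathbb E\big[\frac1{p\mu_0^\Phi}\big]$,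 and $\mathbb E[(\mu_0^\Phi)^m]=c^{(m)}(\eta(\nu))$ for all $m\in\mathbb N$. 2. The network is self-consistent if and only if $F$ solves the fixed-point equation $$F(u)=\frac12-\int_0^\infty\mathrm{Im}\Big\{u^{-j\omega}\exp\Big(-\frac{j\omega\theta r^\alpha}{\rho}-\lambda\pi r^2\theta^\delta\sum_{k=1}^\infty\binom{j\omega}k\eta^{(k)}(\nu)\Big)\Big\}\frac{d\omega}{\pi\omega},\qquad 0<u\le1,\quad j=\sqrt{-1},$$ with convergent series and absolutely convergent integral. In that case the network average AoI is $$\bar\Delta=\frac1\xi+\int_0^1\frac{F(dt)}{pt}-1 .$$ 3. The approximation $\bar\Delta\approx\frac1\xi+\int_0^1\frac{f(t)\,dt}{pt}-1$ replaces $F(dt)$ by $f(t)\,dt$, where $f=\lim_n f_n$ pointwise on $(0,1)$ and, for $n\ge1$, $$f_n(u)=\frac{u^{\frac{\kappa_n(\beta_n+1)-1}{1-\kappa_n}}(1-u)^{\beta_n-1}}{B(\kappa_n\beta_n/(1-\kappa_n),\beta_n)},\quad \kappa_n=c_n^{(1)},\quad \beta_n=\frac{(1-\kappa_n)(\kappa_n-c_n^{(2)})}{c_n^{(2)}-\kappa_n^2},\quad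 c_n^{(m)}=c^{(m)}(\eta_{n-1}),$$ with $\eta_n^{(k)}=\eta^{(k)}(f_n(t)\,dt)$ for $n\ge1$ and $\eta_0^{(k)}=\binom{\delta-1}{k-1}\frac{2\pi^2\theta^\delta\xi^kp^k}{\alpha\sin(\pi\delta)}$. It has the following exact meaning. - For every $n\ge1$: $0<\kappa_n<1$, $\beta_n>0$, and $f_n$ is a probability density on $(0,1)$ with first two moments $c_n^{(1)}$ and $c_n^{(2)}$. - Whenever the limit $f$ exists, $\kappa_n\to\kappa\in(0,1)$, $\beta_n\to\beta>0$, and $f$ is the probability density of the same Beta form with parameters $\kappa,\beta$. It is self-consistent up to the second moment: $\int_0^1t^mf(t)\,dt=c^{(m)}(\eta(f(t)\,dt))$ for $m=1,2$ (by part 1, the $m$-th moment of $\mu_0^\Phi$ when the $\mu_j$ have density $f$), whereas the exact law satisfies this for all $m$. - In that case, in $[0,\infty]$, $\frac1\xi-1+\int_0^1\frac{f_n(t)\,dt}{pt}\to\frac1\xi-1+\int_0^1\frac{f(t)\,dt}{pt}$. -/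

import Mathlib

open MeasureTheory ProbabilityTheory Filter Topology Set
open scoped ENNReal

noncomputable section

/-- The Euclidean plane. -/
abbrev Plane : Type := EuclideanSpace ℝ (Fin 2)

/-- Parameters of the bipolar random access network. -/
structure NetworkParams where
  /-- spatial density of the transmitters -/
  lam : ℝ
  /-- distance between a transmitter and its dedicated receiver -/
  r : ℝ
  /-- SINR decoding threshold -/
  theta : ℝ
  /-- path loss exponent -/
  alpha : ℝ
  /-- transmit power -/
  Ptx : ℝ
  /-- variance of the thermal noise -/
  sigmaSq : ℝ
  /-- packet update frequency -/
  xi : ℝ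
  /-- slotted ALOHA channel access probability -/
  p : ℝ
  lam_pos : 0 < lam
  r_pos : 0 < r
  theta_pos : 0 < theta
  two_lt_alpha : 2 < alpha
  Ptx_pos : 0 < Ptx
  sigmaSq_pos : 0 < sigmaSq
  xi_pos : 0 < xi
  xi_le_one : xi ≤ 1
  p_pos : 0 < p
  p_lt_one : p < 1

namespace NetworkParams

/-- The signal-to-noise ratio `ρ`. -/
def rho (P : NetworkParams) : ℝ := P.Ptx / P.sigmaSq

/-- The exponent `δ = 2 / α`. -/
def delta (P : NetworkParams) : ℝ := 2 / P.alpha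

end NetworkParams

/-- The number of points of the sequence `X` that lie in `B`. -/
def pointCount {Ω : Type*} (X : ℕ → Ω → Plane) (B : Set Plane) (ω : Ω) : ℕ∞ :=
  {j | X j ω ∈ B}.encard

/-- The points `X 0, X 1, …` form a homogeneous Poisson point process of intensity `lam` on the
plane: the number of points in a set of finite area is Poisson distributed with mean `lam` times
the area, and the numbers of points in disjoint sets are independent. -/
structure IsPoissonProcess {Ω : Type*} [MeasurableSpace Ω] (lam : ℝ) (X : ℕ → Ω → Plane)
    (Pr : Measure Ω) : Prop where
  poisson : ∀ B : Set Plane, MeasurableSet B → volume B < ∞ → ∀ k : ℕ,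
    Pr {ω | pointCount X B ω = k} =
      ENNReal.ofReal (Real.exp (-(lam * (volume B).toReal)) *
        (lam * (volume B).toReal) ^ k / k.factorial)
  indep : ∀ (n : ℕ) (B : Fin n → Set Plane), (∀ i, MeasurableSet (B i)) →
    Pairwise (fun i i' => Disjoint (B i) (B i')) →
    iIndepFun (fun i => pointCount X (B i)) Pr

/-- Probability that the unit-size buffer of a node is non-empty when it transmits in slot `t`
(that is, just after the arrivals of slot `t`), for a buffer that starts empty, has an arrival in
each slot with probability `xi`, and whose packet is delivered in a slot with probability `s`.
It is non-empty in slot `t + 1` iff there is an arrival in that slot, or it was non-empty in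
slot `t` and its packet was not delivered. -/
def bufferOccupancy (xi s : ℝ) : ℕ → ℝ
  | 0 => xi
  | t + 1 => xi + (1 - xi) * ((1 - s) * bufferOccupancy xi s t)

/-- Steady-state probability that the buffer is non-empty. -/
def bufferActivity (xi s : ℝ) : ℝ := limUnder atTop (bufferOccupancy xi s)

/-- Indices of the independent scalar random variables that drive the network. Node `j : ℕ` is the
`j`-th interferer; time slots are indexed by `t : ℕ`. -/
inductive Noise : Type
  /-- conditional transmission success probability of the link of interferer `j` -/
  | mark (j : ℕ)
  /-- coin for the packet arrival at the typical transmitter in slot `t` -/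
  | arrival (t : ℕ)
  /-- coin for the channel access of the typical transmitter in slot `t` -/
  | access (t : ℕ)
  /-- fading from the typical transmitter to the typical receiver in slot `t` -/
  | fading (t : ℕ)
  /-- coin for the buffer state of interferer `j` in slot `t` -/
  | bufferI (j t : ℕ)
  /-- coin for the channel access of interferer `j` in slot `t` -/
  | accessI (j t : ℕ)
  /-- fading from interferer `j` to the typical receiver in slot `t` -/
  | fadingI (j t : ℕ)

/-- Laws of the driving variables: marks have law `ν`, coins are uniform on `[0, 1]`, and the
fading is Rayleigh, that is, the channel gains are exponential with unit mean. -/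
def noiseLaw (ν : Measure ℝ) : Noise → Measure ℝ
  | .mark _ => ν
  | .arrival _ => volume.restrict (Icc 0 1)
  | .access _ => volume.restrict (Icc 0 1)
  | .fading _ => expMeasure 1
  | .bufferI _ _ => volume.restrict (Icc 0 1)
  | .accessI _ _ => volume.restrict (Icc 0 1)
  | .fadingI _ _ => expMeasure 1

/-- The network seen from the typical link under the Palm distribution `Pr`, in the mean-field
regime. The typical receiver is at the origin and its transmitter at distance `r`; the other
transmitters `X j` form a Poisson process. Interferer `j` carries the conditional transmission
success probability of its own link, and these are i.i.d. with law `ν`; its buffer is non-empty,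
independently in each slot, with the steady-state probability belonging to that success
probability. -/
structure MeanFieldNetwork (P : NetworkParams) (ν : Measure ℝ) {Ω : Type*} [MeasurableSpace Ω]
    (Pr : Measure Ω) where
  /-- locations of the interferers -/
  X : ℕ → Ω → Plane
  /-- driving variables -/
  Z : Noise → Ω → ℝ
  /-- age of information at the typical receiver at time `0` -/
  initialAge : ℕ
  measurable_X : ∀ j, Measurable (X j)
  isPoisson : IsPoissonProcess P.lam X Pr
  measurable_Z : ∀ i, Measurable (Z i)
  law_Z : ∀ i, Pr.map (Z i) = noiseLaw ν i
  indep_Z : iIndepFun Z Pr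
  indep_X_Z : IndepFun (fun ω j => X j ω) (fun ω i => Z i ω) Pr

/-- State of the typical link: age of information at the receiver, and generation time of the
packet in the transmitter's buffer, if there is one. -/
structure LinkState where
  age : ℕ
  buffer : Option ℕ

namespace MeanFieldNetwork

variable {P : NetworkParams} {ν : Measure ℝ} {Ω : Type*} [MeasurableSpace Ω] {Pr : Measure Ω}

/-- A packet arrives at the typical transmitter in slot `t` (probability `ξ`). -/
def Arrives (N : MeanFieldNetwork P ν Pr) (t : ℕ) (ω : Ω) : Prop := N.Z (.arrival t) ω ≤ P.xi

/-- The typical transmitter is granted channel access in slot `t` (probability `p`). -/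
def Accesses (N : MeanFieldNetwork P ν Pr) (t : ℕ) (ω : Ω) : Prop := N.Z (.access t) ω ≤ P.p

/-- Interferer `j` has a non-empty buffer in slot `t`. Its departure rate is `p` times the
success probability of its link. -/
def InterfererNonempty (N : MeanFieldNetwork P ν Pr) (j t : ℕ) (ω : Ω) : Prop :=
  N.Z (.bufferI j t) ω ≤ bufferActivity P.xi (P.p * N.Z (.mark j) ω)

/-- Interferer `j` is granted channel access in slot `t` (probability `p`). -/
def InterfererAccesses (N : MeanFieldNetwork P ν Pr) (j t : ℕ) (ω : Ω) : Prop :=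
  N.Z (.accessI j t) ω ≤ P.p

open Classical in
/-- Interference power at the typical receiver in slot `t`. -/
def interference (N : MeanFieldNetwork P ν Pr) (t : ℕ) (ω : Ω) : ℝ≥0∞ :=
  ∑' j : ℕ, if N.InterfererNonempty j t ω ∧ N.InterfererAccesses j t ω then
    ENNReal.ofReal (P.Ptx * N.Z (.fadingI j t) ω) * ‖N.X j ω‖ₑ ^ (-P.alpha) else 0

/-- SINR at the typical receiver in slot `t` if its transmitter sends out a packet. -/
def sinr (N : MeanFieldNetwork P ν Pr) (t : ℕ) (ω : Ω) : ℝ≥0∞ :=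
  ENNReal.ofReal (P.Ptx * N.Z (.fading t) ω * P.r ^ (-P.alpha)) /
    (N.interference t ω + ENNReal.ofReal P.sigmaSq)

/-- The SINR in slot `t` exceeds the decoding threshold. -/
def Decodes (N : MeanFieldNetwork P ν Pr) (t : ℕ) (ω : Ω) : Prop :=
  ENNReal.ofReal P.theta < N.sinr t ω

/-- The information `Φ` on the static network: the locations of the interferers and the success
probabilities of their links. -/
@[reducible] def topology (N : MeanFieldNetwork P ν Pr) : MeasurableSpace Ω :=
  MeasurableSpace.comap (fun ω (j : ℕ) => (N.X j ω, N.Z (.mark j) ω)) inferInstance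

/-- Conditional transmission success probability `Pr(SINR > θ | Φ)` of the typical link in
slot `t`. -/
def successProb (N : MeanFieldNetwork P ν Pr) (t : ℕ) : Ω → ℝ :=
  Pr[{ω | N.Decodes t ω}.indicator (fun _ => (1 : ℝ)) | N.topology]

/-- The network is self-consistent: the conditional success probability of the typical link has
the law of those of all the other links. -/
def SelfConsistent (N : MeanFieldNetwork P ν Pr) : Prop :=
  ∀ t, Pr.map (N.successProb t) = ν

open Classical in
/-- Evolution of the typical link. In slot `t` a newly arriving packet replaces the buffered one;
a buffered packet is then sent upon channel access, and delivered by the end of the slot if the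
SINR exceeds the threshold. The age becomes the time elapsed since the generation of the delivered
packet, and otherwise grows by one. -/
def linkState (N : MeanFieldNetwork P ν Pr) (ω : Ω) : ℕ → LinkState
  | 0 => ⟨N.initialAge, none⟩
  | t + 1 =>
    let s := N.linkState ω t
    let b : Option ℕ := if N.Arrives t ω then some t else s.buffer
    match b with
    | none => ⟨s.age + 1, none⟩
    | some g =>
      if N.Accesses t ω ∧ N.Decodes t ω then ⟨t - g + 1, none⟩ else ⟨s.age + 1, some g⟩

/-- The age of information at the typical receiver at time `t`. -/
def aoi (N : MeanFieldNetwork P ν Pr) (t : ℕ) (ω : Ω) : ℕ := (N.linkState ω t).age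

/-- The network average AoI: Palm expectation of the long-term time average of the AoI over the
typical link. -/
def averageAoI (N : MeanFieldNetwork P ν Pr) : ℝ≥0∞ :=
  ∫⁻ ω, limsup (fun T : ℕ => (∑ t ∈ Finset.Icc 1 T, (N.aoi t ω : ℝ≥0∞)) / (T : ℝ≥0∞)) atTop ∂Pr

end MeanFieldNetwork

namespace NetworkParams

/-- `η⁽ᵏ⁾(ν) = ∫₀^∞ (-1)^{k+1} dv / (1 + v^{α/2})^k · ∫₀¹ (p ξ)^k ν(dt) / [ξ + (1 - ξ) p t]^k`. -/
def eta (P : NetworkParams) (ν : Measure ℝ) (k : ℕ) : ℝ :=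
  (∫ v in Ioi (0 : ℝ), (-1) ^ (k + 1) / (1 + v ^ (P.alpha / 2)) ^ k) *
    ∫ t in Icc (0 : ℝ) 1, (P.p * P.xi) ^ k / (P.xi + (1 - P.xi) * P.p * t) ^ k ∂ν

/-- `λ π r² θ^δ`. -/
def spatialConst (P : NetworkParams) : ℝ :=
  P.lam * Real.pi * P.r ^ 2 * P.theta ^ P.delta

/-- The series over `k ≥ 1` of `binom(jω, k) η⁽ᵏ⁾(ν)`; here its terms, with index `k - 1`. -/
def metaTerm (P : NetworkParams) (ν : Measure ℝ) (w : ℝ) (k : ℕ) : ℂ :=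
  Ring.choose (Complex.I * (w : ℂ)) (k + 1) * (P.eta ν (k + 1) : ℂ)

/-- The integrand of the fixed-point equation for the CDF of the success probability. -/
def metaIntegrand (P : NetworkParams) (ν : Measure ℝ) (u w : ℝ) : ℝ :=
  ((u : ℂ) ^ (-(Complex.I * (w : ℂ))) *
    Complex.exp (-(Complex.I * (w : ℂ) * ((P.theta * P.r ^ P.alpha / P.rho : ℝ) : ℂ))
      - (P.spatialConst : ℂ) * ∑' k : ℕ, P.metaTerm ν w k)).im / (Real.pi * w)

/-- The CDF `F` of `ν` solves the fixed-point equation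
`F(u) = 1/2 - ∫₀^∞ Im{u^{-jω} exp(-jωθr^α/ρ - λπr²θ^δ ∑_{k≥1} binom(jω,k) η⁽ᵏ⁾(F))} dω/(πω)`,
where the series and the integral converge. -/
def SolvesFixedPoint (P : NetworkParams) (ν : Measure ℝ) : Prop :=
  (∀ w : ℝ, 0 < w → Summable (P.metaTerm ν w)) ∧
  ∀ u : ℝ, 0 < u → u ≤ 1 →
    IntegrableOn (P.metaIntegrand ν u) (Ioi 0) ∧
    cdf ν u = 1 / 2 - ∫ w in Ioi (0 : ℝ), P.metaIntegrand ν u w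

/-- The moments `c⁽ᵐ⁾ = exp(-mθr^α/ρ - λπr²θ^δ ∑_{k=1}^m binom(m,k) η⁽ᵏ⁾)`. -/
def moment (P : NetworkParams) (η : ℕ → ℝ) (m : ℕ) : ℝ :=
  Real.exp (-(m * P.theta * P.r ^ P.alpha / P.rho)
    - P.spatialConst * ∑ k ∈ Finset.Icc 1 m, (m.choose k : ℝ) * η k)

/-- `κ = c⁽¹⁾`. -/
def kappa (P : NetworkParams) (η : ℕ → ℝ) : ℝ := P.moment η 1

/-- `β = (1 - κ) (κ - c⁽²⁾) / (c⁽²⁾ - κ²)`. -/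
def betaParam (P : NetworkParams) (η : ℕ → ℝ) : ℝ :=
  (1 - P.kappa η) * (P.kappa η - P.moment η 2) / (P.moment η 2 - P.kappa η ^ 2)

end NetworkParams

/-- The Beta-type density
`u^{(κ(β+1)-1)/(1-κ)} (1-u)^{β-1} / B(κβ/(1-κ), β)`, with mean `κ`. -/
def betaTypeDensity (κ β u : ℝ) : ℝ :=
  u ^ ((κ * (β + 1) - 1) / (1 - κ)) * (1 - u) ^ (β - 1) / beta (κ * β / (1 - κ)) β

/-- The measure `f(t) dt` on `(0, 1)`. -/
def densityMeasure (f : ℝ → ℝ) : Measure ℝ :=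
  (volume.restrict (Ioo 0 1)).withDensity (fun t => ENNReal.ofReal (f t))

namespace NetworkParams

/-- The iterates `η_n`: `η_0` is explicit, and `η_n` for `n ≥ 1` is computed from the Beta-type
density `f_n`, whose parameters come from `η_{n-1}`. -/
def etaIter (P : NetworkParams) : ℕ → ℕ → ℝ
  | 0 => fun k => Ring.choose (P.delta - 1) (k - 1) *
      (2 * Real.pi ^ 2 * P.theta ^ P.delta * P.xi ^ k * P.p ^ k) /
        (P.alpha * Real.sin (Real.pi * P.delta))
  | n + 1 => P.eta (densityMeasure
      (betaTypeDensity (P.kappa (P.etaIter n)) (P.betaParam (P.etaIter n))))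

/-- `c_n⁽ᵐ⁾` for `n ≥ 1`. -/
def momentIter (P : NetworkParams) (n m : ℕ) : ℝ := P.moment (P.etaIter (n - 1)) m

/-- `κ_n` for `n ≥ 1`. -/
def kappaIter (P : NetworkParams) (n : ℕ) : ℝ := P.kappa (P.etaIter (n - 1))

/-- `β_n` for `n ≥ 1`. -/
def betaIter (P : NetworkParams) (n : ℕ) : ℝ := P.betaParam (P.etaIter (n - 1))

/-- `f_n` for `n ≥ 1`. -/
def densityIter (P : NetworkParams) (n : ℕ) : ℝ → ℝ :=
  betaTypeDensity (P.kappaIter n) (P.betaIter n)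

end NetworkParams

end

/-! # Age of information in a Poisson random access network

Given the topology `Φ`, the typical link is decoded when its exponential fading exceeds a level set
by noise and interference. Averaging over the independent coins and fading of the interferers shows
that the conditional success probability is `exp (-θ r^α / ρ)` times a product over the marked
Poisson process of interferers (`MeanFieldNetwork.measure_decodes`). An interferer at normalised
area `v` whose link has success probability `t` contributes the factor `1 - loss (v, t)`, where
`0 < loss ≤ p < 1`. The Laplace functional of the marked process
(`MeanFieldNetwork.lintegral_expNeg_tsum_config`) then gives the Mellin transform
`E[μ^s] = exp (-s θ r^α / ρ - λ π r² θ^δ ∫ (1 - (1 - loss)^s))` for real `s ≥ 0`. For `s = m` a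
natural number, the binomial theorem turns the integral into the finite sum in `c⁽ᵐ⁾`.

Both sides of this formula are analytic in the right half-plane and continuous up to the imaginary
axis, so it holds at `s = j ω`, where the binomial series, convergent because `loss ≤ p < 1`, yields
the series over `η⁽ᵏ⁾` (`NetworkParams.hasSum_choose_mul_eta`). Hence the integrand of the
fixed-point equation is that of the Gil-Pelaez inversion formula for `log μ`. The interferers in a
strip of normalised areas of order `ω^δ` force the characteristic function to decay like
`exp (-c ω^δ)` (`NetworkParams.decayRate_mul_le`), and `log μ` is integrable because the mean total
loss is finite; so the inversion integral converges absolutely and the law of `μ` has no atoms in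
`(0, 1]`. The right-hand side of the fixed-point equation is therefore always the distribution
function of the success probability, whatever `ν` is, and the equation says that this law is `ν`
(`MeanFieldNetwork.selfConsistent_iff`).

For the age of information, the topology may be fixed, since it is independent of the coins and the
fading. The arrivals and the services are then sequences of independent trials, and a service
resets the age to the time `W` since the freshest arrival, whether or not the buffer holds a packet.
Summing the recursions of `W` and of the age writes the total age up to time `T` as
`T (1/ξ + 1/(p μ) - 1)` plus boundary terms and sums of centred trials times predictable factors
(`IsTrialSequence.sum_linkAge`). A drift argument bounds second moments uniformly in time, the
centred sums have orthogonal increments, and so the remainder divided by `T` vanishes almost surely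
along the squares; monotonicity of the total age fills the gaps
(`IsTrialSequence.tendsto_average_linkAge`).

The density `f_n` is that of the Beta distribution with first two moments `c_n⁽¹⁾` and `c_n⁽²⁾`,
which are admissible because `η⁽²⁾ < 0 ≤ η⁽¹⁾ + η⁽²⁾`. From `n = 2` on, `(κ_n, β_n)` lies in a
compact set on which the density determines the parameters, so that pointwise convergence of `f_n`
forces convergence of the parameters (`NetworkParams.tendsto_params`). Moments and `η` then pass to
the limit by dominated convergence, and so does the inverse moment, by Fatou's lemma when its limit
is infinite. -/

noncomputable section

/-! ### The Laplace functional of a Poisson process -/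

/-- The function `x ↦ exp (-x)` on `[0, ∞]`, with `exp (-∞) = 0`. With values in `ℝ≥0∞` it turns
arbitrary sums into products, without any question of convergence. -/
def expNeg (x : ℝ≥0∞) : ℝ≥0∞ := EReal.exp (-(x : EReal))

@[simp] lemma expNeg_zero : expNeg 0 = 1 := by simp [expNeg]

@[simp] lemma expNeg_top : expNeg ⊤ = 0 := by simp [expNeg]

lemma expNeg_ofReal {r : ℝ} (hr : 0 ≤ r) :
    expNeg (ENNReal.ofReal r) = ENNReal.ofReal (Real.exp (-r)) := by
  rw [expNeg, EReal.coe_ennreal_ofReal, max_eq_left hr, ← EReal.coe_neg, EReal.exp_coe]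

lemma expNeg_add (x y : ℝ≥0∞) : expNeg (x + y) = expNeg x * expNeg y := by
  have : -((x + y : ℝ≥0∞) : EReal) = -(x : EReal) + -(y : EReal) := by
    rw [EReal.coe_ennreal_add, EReal.neg_add, sub_eq_add_neg]
    · exact Or.inl (EReal.coe_ennreal_ne_bot x)
    · exact Or.inr (EReal.coe_ennreal_ne_bot y)
  rw [expNeg, this, EReal.exp_add, expNeg, expNeg]

lemma expNeg_le_one (x : ℝ≥0∞) : expNeg x ≤ 1 := by
  rw [expNeg, EReal.exp_le_one_iff, EReal.neg_le, neg_zero]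
  exact EReal.coe_ennreal_nonneg x

lemma expNeg_ne_top (x : ℝ≥0∞) : expNeg x ≠ ⊤ :=
  ((expNeg_le_one x).trans_lt ENNReal.one_lt_top).ne

lemma antitone_expNeg : Antitone expNeg := fun x y h => by
  rw [expNeg, expNeg, EReal.exp_le_exp_iff, EReal.neg_le_neg_iff]
  exact_mod_cast h

lemma continuous_expNeg : Continuous expNeg :=
  ENNReal.continuous_exp.comp (continuous_neg.comp continuous_coe_ennreal_ereal)

lemma measurable_expNeg : Measurable expNeg := continuous_expNeg.measurable

lemma expNeg_sum {ι : Type*} (s : Finset ι) (f : ι → ℝ≥0∞) :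
    expNeg (∑ i ∈ s, f i) = ∏ i ∈ s, expNeg (f i) := by
  classical
  induction s using Finset.induction_on with
  | empty => simp
  | insert a s ha ih => rw [Finset.sum_insert ha, Finset.prod_insert ha, expNeg_add, ih]

lemma tendsto_prod_expNeg (f : ℕ → ℝ≥0∞) :
    Tendsto (fun n => ∏ j ∈ Finset.range n, expNeg (f j)) atTop (𝓝 (expNeg (∑' j, f j))) := by
  simp_rw [← expNeg_sum]
  exact (continuous_expNeg.tendsto _).comp ENNReal.summable.hasSum.tendsto_sum_nat

/-- The inverse of `expNeg` on `[0, 1]`, with `-log 0 = ∞`. -/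
def negLog (y : ℝ≥0∞) : ℝ≥0∞ := if y = 0 then ⊤ else ENNReal.ofReal (-Real.log y.toReal)

lemma measurable_negLog : Measurable negLog :=
  Measurable.ite (measurableSet_singleton 0) measurable_const (by fun_prop)

lemma expNeg_negLog {y : ℝ≥0∞} (hy : y ≤ 1) : expNeg (negLog y) = y := by
  rcases eq_or_ne y 0 with rfl | h0
  · simp [negLog]
  · have hyt : y ≠ ⊤ := (hy.trans_lt ENNReal.one_lt_top).ne
    have hpos := ENNReal.toReal_pos h0 hyt
    have h1 : y.toReal ≤ 1 := by simpa using ENNReal.toReal_mono ENNReal.one_ne_top hy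
    rw [negLog, if_neg h0, expNeg_ofReal (by linarith [Real.log_nonpos hpos.le h1]), neg_neg,
      Real.exp_log hpos, ENNReal.ofReal_toReal hyt]

lemma tendsto_lintegral_of_le_one {Ω : Type*} [MeasurableSpace Ω] {μ : Measure Ω}
    [IsProbabilityMeasure μ] {f : ℕ → Ω → ℝ≥0∞} {g : Ω → ℝ≥0∞} (hf : ∀ n, Measurable (f n))
    (h1 : ∀ n ω, f n ω ≤ 1) (h : ∀ ω, Tendsto (fun n => f n ω) atTop (𝓝 (g ω))) :
    Tendsto (fun n => ∫⁻ ω, f n ω ∂μ) atTop (𝓝 (∫⁻ ω, g ω ∂μ)) :=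
  tendsto_lintegral_of_dominated_convergence (fun _ => 1) hf
    (fun n => ae_of_all _ (h1 n)) (by simp) (ae_of_all _ h)

section Poisson
variable {Ω : Type*} {lam : ℝ} {X : ℕ → Ω → Plane}

/-- The counting measure of the points of the process. -/
def pointMeasure (X : ℕ → Ω → Plane) (ω : Ω) : Measure Plane :=
  Measure.sum fun j => Measure.dirac (X j ω)

lemma lintegral_pointMeasure (X : ℕ → Ω → Plane) (ω : Ω) {F : Plane → ℝ≥0∞} (hF : Measurable F) :
    ∫⁻ x, F x ∂pointMeasure X ω = ∑' j, F (X j ω) := by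
  simp [pointMeasure, lintegral_sum_measure, lintegral_dirac' _ hF]

lemma pointMeasure_apply (X : ℕ → Ω → Plane) (ω : Ω) {B : Set Plane} (hB : MeasurableSet B) :
    pointMeasure X ω B = (pointCount X B ω : ℝ≥0∞) := by
  rw [pointMeasure, Measure.sum_apply _ hB, pointCount, ← Measure.count_apply (by trivial),
    ← lintegral_indicator_one (by trivial), lintegral_count]
  refine tsum_congr fun j => ?_
  rw [Measure.dirac_apply' _ hB]
  rfl

variable [MeasurableSpace Ω] {Pr : Measure Ω}

lemma measurable_pointCount (hX : ∀ j, Measurable (X j)) {B : Set Plane} (hB : MeasurableSet B) :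
    Measurable (pointCount X B) := by
  have h : Measurable fun ω => (pointCount X B ω : ℝ≥0∞) := by
    have : (fun ω => (pointCount X B ω : ℝ≥0∞)) = fun ω => ∑' j, B.indicator 1 (X j ω) := by
      ext ω
      rw [← pointMeasure_apply X ω hB, ← lintegral_indicator_one hB, lintegral_pointMeasure]
      exact measurable_one.indicator hB
    rw [this]
    exact Measurable.tsum fun j => (measurable_one.indicator hB).comp (hX j)
  refine measurable_to_countable' fun k => ?_
  have : pointCount X B ⁻¹' {k} = (fun ω => (pointCount X B ω : ℝ≥0∞)) ⁻¹' {(k : ℝ≥0∞)} := by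
    ext ω; simp
  rw [this]
  exact h (measurableSet_singleton _)

/-- The Laplace transform `exp (-c (1 - exp (-a)))` of the Poisson distribution with mean `c`. -/
lemma tsum_poisson_laplace {c : ℝ} (hc : 0 ≤ c) (a : ℝ) :
    ∑' k : ℕ, ENNReal.ofReal (Real.exp (-a)) ^ k * ENNReal.ofReal (Real.exp (-c) * c ^ k / k.factorial)
      = ENNReal.ofReal (Real.exp (-(c * (1 - Real.exp (-a))))) := by
  have h : HasSum (fun k : ℕ => Real.exp (-a) ^ k * (Real.exp (-c) * c ^ k / k.factorial))
      (Real.exp (-(c * (1 - Real.exp (-a))))) := by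
    have := (NormedSpace.expSeries_div_hasSum_exp (c * Real.exp (-a))).mul_left (Real.exp (-c))
    rw [← Real.exp_eq_exp_ℝ, ← Real.exp_add] at this
    have h2 : (fun k : ℕ => Real.exp (-a) ^ k * (Real.exp (-c) * c ^ k / k.factorial)) =
        fun k : ℕ => Real.exp (-c) * ((c * Real.exp (-a)) ^ k / k.factorial) := by
      ext k; rw [mul_pow]; ring
    rw [h2, show -(c * (1 - Real.exp (-a))) = -c + c * Real.exp (-a) by ring]
    exact this
  rw [← h.tsum_eq, ENNReal.ofReal_tsum_of_nonneg (fun k => by positivity) h.summable]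
  refine tsum_congr fun k => ?_
  rw [ENNReal.ofReal_mul (by positivity), ENNReal.ofReal_pow (by positivity)]

/-- Laplace transform of the Poisson distributed number of points in a set. -/
lemma IsPoissonProcess.lintegral_expNeg_mul_pointCount [IsProbabilityMeasure Pr]
    (h : IsPoissonProcess lam X Pr) (hlam : 0 < lam) (hX : ∀ j, Measurable (X j)) {B : Set Plane}
    (hB : MeasurableSet B) (hBf : volume B ≠ ⊤) {a : ℝ≥0∞} (ha : a ≠ ⊤) :
    ∫⁻ ω, expNeg (a * pointCount X B ω) ∂Pr
      = expNeg (ENNReal.ofReal lam * ((1 - expNeg a) * volume B)) := by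
  have hc : 0 ≤ lam * (volume B).toReal := by positivity
  have hm : ∀ k : ℕ, MeasurableSet {ω | pointCount X B ω = k} := fun k =>
    measurable_pointCount hX hB (measurableSet_singleton _)
  have hd : Pairwise (Function.onFun Disjoint fun k : ℕ => {ω | pointCount X B ω = k}) := by
    intro i j hij
    refine Set.disjoint_left.2 fun ω hi hj => hij ?_
    simp only [Set.mem_ofPred_eq] at hi hj
    exact_mod_cast hi.symm.trans hj
  have hU : Pr (⋃ k : ℕ, {ω | pointCount X B ω = k}) = 1 := by
    rw [measure_iUnion hd hm]
    simp_rw [h.poisson B hB hBf.lt_top]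
    simpa using tsum_poisson_laplace hc 0
  have hae : ∀ᵐ ω ∂Pr, ω ∈ ⋃ k : ℕ, {ω | pointCount X B ω = k} :=
    (prob_compl_eq_zero_iff (MeasurableSet.iUnion hm)).2 hU
  obtain ⟨r, hr, rfl⟩ : ∃ r : ℝ, 0 ≤ r ∧ ENNReal.ofReal r = a :=
    ⟨a.toReal, ENNReal.toReal_nonneg, ENNReal.ofReal_toReal ha⟩
  rw [← setLIntegral_univ, ← setLIntegral_congr (s := ⋃ k : ℕ, {ω | pointCount X B ω = k}) (eventuallyEq_univ.2 hae),
    lintegral_iUnion hm hd]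
  have : ∀ k : ℕ, ∫⁻ ω in {ω | pointCount X B ω = k}, expNeg (ENNReal.ofReal r * pointCount X B ω) ∂Pr
      = ENNReal.ofReal (Real.exp (-r)) ^ k *
        ENNReal.ofReal (Real.exp (-(lam * (volume B).toReal)) * (lam * (volume B).toReal) ^ k
          / k.factorial) := by
    intro k
    rw [setLIntegral_congr_fun (g := fun _ => ENNReal.ofReal (Real.exp (-r)) ^ k) (hm k),
      setLIntegral_const, h.poisson B hB hBf.lt_top]
    intro ω hω
    simp only [Set.mem_ofPred_eq] at hω
    simp only [hω]
    have hk : ENNReal.ofReal r * ((k : ℕ∞) : ℝ≥0∞) = ∑ _i ∈ Finset.range k, ENNReal.ofReal r := by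
      simp [mul_comm]
    rw [hk, expNeg_sum, Finset.prod_const, Finset.card_range, expNeg_ofReal hr]
  simp_rw [this]
  have h1 : 0 ≤ 1 - Real.exp (-r) := by
    have := Real.exp_le_one_iff.2 (neg_nonpos.2 hr); linarith
  rw [tsum_poisson_laplace hc r, ← expNeg_ofReal (by positivity), expNeg_ofReal hr,
    ENNReal.ofReal_mul hc, ENNReal.ofReal_mul hlam.le, ENNReal.ofReal_toReal hBf,
    ENNReal.ofReal_sub _ (Real.exp_nonneg _), ENNReal.ofReal_one, mul_assoc, mul_comm (volume B)]

/-- The Laplace functional for simple functions: the numbers of points in the level sets are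
independent and Poisson distributed. -/
lemma IsPoissonProcess.lintegral_expNeg_simpleFunc [IsProbabilityMeasure Pr]
    (h : IsPoissonProcess lam X Pr) (hlam : 0 < lam) (hX : ∀ j, Measurable (X j))
    (φ : SimpleFunc Plane ℝ≥0∞) (hφ : ∀ x, φ x ≠ ⊤) (hfin : ∀ a ≠ 0, volume (φ ⁻¹' {a}) ≠ ⊤) :
    ∫⁻ ω, expNeg (∑' j, φ (X j ω)) ∂Pr
      = expNeg (ENNReal.ofReal lam * ∫⁻ x, (1 - expNeg (φ x))) := by
  classical
  have hsum : ∀ μ : Measure Plane, ∀ g : ℝ≥0∞ → ℝ≥0∞, g 0 = 0 →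
      ∫⁻ x, g (φ x) ∂μ = ∑ a ∈ φ.range.erase 0, g a * μ (φ ⁻¹' {a}) := by
    intro μ g hg
    have := (SimpleFunc.lintegral_eq_lintegral (φ.map g) μ)
    rw [SimpleFunc.map_lintegral] at this
    simp only [SimpleFunc.map_apply] at this
    rw [this]
    refine (Finset.sum_erase _ ?_).symm
    simp [hg]
  have h1 : ∀ ω, expNeg (∑' j, φ (X j ω)) =
      ∏ a ∈ φ.range.erase 0, expNeg (a * pointCount X (φ ⁻¹' {a}) ω) := by
    intro ω
    rw [← lintegral_pointMeasure X ω φ.measurable, hsum _ (fun a => a) rfl, expNeg_sum]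
    simp_rw [pointMeasure_apply X ω (φ.measurableSet_fiber _)]
  set s := φ.range.erase 0 with hs
  let e := s.equivFin
  have hprod : ∀ f : ℝ≥0∞ → ℝ≥0∞, ∏ a ∈ s, f a = ∏ i : Fin s.card, f (e.symm i) := by
    intro f
    rw [← Finset.prod_coe_sort, ← e.symm.prod_comp]
  have hind := h.indep s.card (fun i => φ ⁻¹' {(e.symm i : ℝ≥0∞)})
    (fun i => φ.measurableSet_fiber _) (by
      intro i i' hii'
      refine Set.disjoint_left.2 fun x hx hx' => hii' ?_
      simp only [Set.mem_preimage, Set.mem_singleton_iff] at hx hx'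
      exact e.symm.injective (Subtype.ext (hx.symm.trans hx')))
  have hind' := hind.comp (fun i n => expNeg ((e.symm i : ℝ≥0∞) * (n : ℝ≥0∞)))
    (fun i => measurable_from_top)
  simp_rw [h1, hprod]
  have := lintegral_prod_eq_prod_lintegral_of_indepFun Finset.univ _ hind' (fun i =>
    measurable_from_top.comp (measurable_pointCount hX (φ.measurableSet_fiber _)))
  simp only [Function.comp_apply] at this
  rw [this]
  have hne : ∀ i : Fin s.card, (e.symm i : ℝ≥0∞) ≠ 0 ∧ (e.symm i : ℝ≥0∞) ≠ ⊤ := by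
    intro i
    have := (e.symm i).2
    obtain ⟨h0, hm⟩ := Finset.mem_erase.1 this
    obtain ⟨x, hx⟩ := SimpleFunc.mem_range.1 hm
    exact ⟨h0, hx ▸ hφ x⟩
  rw [Finset.prod_congr rfl fun i _ => h.lintegral_expNeg_mul_pointCount hlam hX
    (φ.measurableSet_fiber _) (hfin _ (hne i).1) (hne i).2,
    hsum volume (fun a => 1 - expNeg a) (by simp), Finset.mul_sum, expNeg_sum, hprod]

/-- The Laplace functional of a homogeneous Poisson process. -/
theorem IsPoissonProcess.lintegral_expNeg_tsum [IsProbabilityMeasure Pr]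
    (h : IsPoissonProcess lam X Pr) (hlam : 0 < lam) (hX : ∀ j, Measurable (X j))
    {F : Plane → ℝ≥0∞} (hF : Measurable F) :
    ∫⁻ ω, expNeg (∑' j, F (X j ω)) ∂Pr
      = expNeg (ENNReal.ofReal lam * ∫⁻ x, (1 - expNeg (F x))) := by
  -- simple functions increasing to `F`, cut off so that their level sets have finite area
  let φ : ℕ → SimpleFunc Plane ℝ≥0∞ := fun n =>
    (SimpleFunc.eapprox F n).restrict (Metric.closedBall 0 n)
  have hφ : ∀ n x, φ n x = (Metric.closedBall (0 : Plane) n).indicator (SimpleFunc.eapprox F n) x :=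
    fun n x => by
      rw [SimpleFunc.restrict_apply _ Metric.isClosed_closedBall.measurableSet]
  have hmono : ∀ x, Monotone fun n => φ n x := by
    intro x n m hnm
    simp only [hφ]
    refine (Set.indicator_le_indicator (SimpleFunc.monotone_eapprox F hnm x)).trans
      (Set.indicator_le_indicator_of_subset (Metric.closedBall_subset_closedBall (by
        exact_mod_cast hnm)) (fun _ => zero_le) x)
  have hlim : ∀ x, Tendsto (fun n => φ n x) atTop (𝓝 (F x)) := by
    intro x
    refine (SimpleFunc.tendsto_eapprox hF x).congr' ?_
    obtain ⟨N, hN⟩ := exists_nat_ge ‖x‖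
    filter_upwards [eventually_ge_atTop N] with n hn
    rw [hφ, Set.indicator_of_mem]
    simp only [Metric.mem_closedBall, dist_zero_right]
    exact hN.trans (by exact_mod_cast hn)
  have hsimple : ∀ n, ∫⁻ ω, expNeg (∑' j, φ n (X j ω)) ∂Pr
      = expNeg (ENNReal.ofReal lam * ∫⁻ x, (1 - expNeg (φ n x))) := by
    intro n
    refine h.lintegral_expNeg_simpleFunc hlam hX (φ n) (fun x => ?_) (fun a ha => ?_)
    · rw [hφ]
      exact ((Set.indicator_le_self _ _ _).trans_lt (SimpleFunc.eapprox_lt_top F n x)).ne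
    · refine (lt_of_le_of_lt (measure_mono ?_)
        (measure_closedBall_lt_top (x := (0 : Plane)) (r := n))).ne
      intro x hx
      by_contra hxb
      rw [Set.mem_preimage, hφ, Set.indicator_of_notMem hxb] at hx
      exact ha hx.symm
  have hL : Tendsto (fun n => ∫⁻ ω, expNeg (∑' j, φ n (X j ω)) ∂Pr) atTop
      (𝓝 (∫⁻ ω, expNeg (∑' j, F (X j ω)) ∂Pr)) := by
    refine tendsto_lintegral_of_le_one (fun n => measurable_expNeg.comp
      (Measurable.tsum fun j => (φ n).measurable.comp (hX j)))
      (fun n ω => expNeg_le_one _) (fun ω => (continuous_expNeg.tendsto _).comp ?_)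
    simp_rw [← lintegral_pointMeasure X ω (φ _).measurable, ← lintegral_pointMeasure X ω hF]
    exact lintegral_tendsto_of_tendsto_of_monotone (fun n => (φ n).measurable.aemeasurable)
      (ae_of_all _ hmono) (ae_of_all _ hlim)
  have hR : Tendsto (fun n => expNeg (ENNReal.ofReal lam * ∫⁻ x, (1 - expNeg (φ n x)))) atTop
      (𝓝 (expNeg (ENNReal.ofReal lam * ∫⁻ x, (1 - expNeg (F x))))) := by
    refine (continuous_expNeg.tendsto _).comp
      (ENNReal.Tendsto.const_mul ?_ (Or.inr ENNReal.ofReal_ne_top))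
    refine lintegral_tendsto_of_tendsto_of_monotone
      (fun n => (measurable_const.sub (measurable_expNeg.comp (φ n).measurable)).aemeasurable)
      (ae_of_all _ fun x n m hnm => tsub_le_tsub_left (antitone_expNeg (hmono x hnm)) _)
      (ae_of_all _ fun x => ?_)
    exact ENNReal.Tendsto.sub tendsto_const_nhds ((continuous_expNeg.tendsto _).comp (hlim x))
      (Or.inl ENNReal.one_ne_top)
  simp_rw [hsimple] at hL
  exact tendsto_nhds_unique hL hR

end Poisson

/-! ### Conditioning on the topology -/

section Independence
variable {Ω ι α β κ E : Type*} [MeasurableSpace Ω] [MeasurableSpace E] {μ : Measure Ω}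
  {f : ι → Ω → E}

/-- Subfamilies of an independent family with disjoint index sets are independent. -/
lemma indepFun_pi_of_disjoint (hf : iIndepFun f μ) (hm : ∀ i, Measurable (f i)) (a : α → ι)
    (b : β → ι) (hab : ∀ i j, a i ≠ b j) :
    IndepFun (fun ω i => f (a i) ω) (fun ω j => f (b j) ω) μ := by
  rw [IndepFun_iff_Indep, MeasurableSpace.comap_process_pi (fun i ω => f (a i) ω),
    MeasurableSpace.comap_process_pi (fun j ω => f (b j) ω)]
  have hd : Disjoint (range a) (range b) := by
    refine Set.disjoint_left.2 ?_
    rintro _ ⟨i, rfl⟩ ⟨j, hj⟩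
    exact hab i j hj.symm
  have := indep_iSup_of_disjoint (fun i => (hm i).comap_le) hf.iIndep hd
  refine indep_of_indep_of_le_left (indep_of_indep_of_le_right this ?_) ?_
  · exact iSup_le fun j => le_iSup₂_of_le (b j) (mem_range_self j) le_rfl
  · exact iSup_le fun j => le_iSup₂_of_le (a j) (mem_range_self j) le_rfl

/-- Disjoint blocks of an independent family form an independent family. -/
lemma iIndepFun_blocks [IsProbabilityMeasure μ] (hf : iIndepFun f μ) (hm : ∀ i, Measurable (f i))
    (g : α → κ → ι) (hg : Function.Injective (Function.uncurry g)) :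
    iIndepFun (fun i ω k => f (g i k) ω) μ := by
  have h1 : iIndepFun (fun (q : α × κ) => f (g q.1 q.2)) μ := hf.precomp hg
  rw [iIndepFun_iff_map_fun_eq_infinitePi_map
    (fun i => measurable_pi_lambda _ fun k => hm _)]
  have h2 := h1.map_fun_eq_infinitePi_map fun q => hm _
  have hp : ∀ i k, IsProbabilityMeasure (μ.map (f (g i k))) :=
    fun i k => Measure.isProbabilityMeasure_map (hm _).aemeasurable
  have h3 := Measure.infinitePi_map_curry (fun i k => μ.map (f (g i k)))
  rw [← h2, Measure.map_map (MeasurableEquiv.measurable _)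
    (measurable_pi_lambda _ fun q => hm _)] at h3
  have h4 : ∀ i, μ.map (fun ω k => f (g i k) ω) = Measure.infinitePi fun k => μ.map (f (g i k)) := by
    intro i
    refine (hf.precomp (g := g i) fun k k' h => ?_).map_fun_eq_infinitePi_map fun k => hm _
    have := @hg (i, k) (i, k') h
    simpa using this
  simp_rw [h4]
  exact h3

/-- If `A` is independent of `(B, C)` and `B` of `C`, then `(A, B)` is independent of `C`. -/
lemma indepFun_prod_left_of_indepFun {E₁ E₂ E₃ : Type*} [MeasurableSpace E₁] [MeasurableSpace E₂]
    [MeasurableSpace E₃] [IsProbabilityMeasure μ] {A : Ω → E₁} {B : Ω → E₂} {C : Ω → E₃}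
    (hA : Measurable A) (hB : Measurable B) (hC : Measurable C)
    (h : IndepFun A (fun ω => (B ω, C ω)) μ) (hBC : IndepFun B C μ) :
    IndepFun (fun ω => (A ω, B ω)) C μ := by
  have hAB : IndepFun A B μ := h.comp measurable_id measurable_fst
  rw [indepFun_iff_map_prod_eq_prod_map_map hA.aemeasurable (hB.prodMk hC).aemeasurable,
    (indepFun_iff_map_prod_eq_prod_map_map hB.aemeasurable hC.aemeasurable).1 hBC] at h
  rw [indepFun_iff_map_prod_eq_prod_map_map (hA.prodMk hB).aemeasurable hC.aemeasurable,
    (indepFun_iff_map_prod_eq_prod_map_map hA.aemeasurable hB.aemeasurable).1 hAB]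
  have hpA := Measure.isProbabilityMeasure_map (μ := μ) hA.aemeasurable
  have hpB := Measure.isProbabilityMeasure_map (μ := μ) hB.aemeasurable
  have hpC := Measure.isProbabilityMeasure_map (μ := μ) hC.aemeasurable
  have := congrArg (Measure.map MeasurableEquiv.prodAssoc.symm) h
  rw [Measure.map_map (MeasurableEquiv.measurable _) (hA.prodMk (hB.prodMk hC)),
    ← Measure.prodAssoc_prod, ← MeasurableEquiv.coe_toEquiv] at this
  rw [Measure.map_map (by exact MeasurableEquiv.measurable _) (MeasurableEquiv.measurable _)] at this
  simp only [MeasurableEquiv.coe_toEquiv, Function.comp_def,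
    MeasurableEquiv.symm_apply_apply, Measure.map_id'] at this
  exact this

/-- Conditional expectation given a variable that is independent of the rest of the randomness. -/
lemma condExp_comp_of_indepFun {E₁ E₂ : Type*} [m₁ : MeasurableSpace E₁] [MeasurableSpace E₂]
    [IsProbabilityMeasure μ] {U : Ω → E₁} {V : Ω → E₂}
    (hU : Measurable U) (hV : Measurable V) (h : IndepFun U V μ) {S : Set (E₁ × E₂)}
    (hS : MeasurableSet S) :
    μ[{ω | (U ω, V ω) ∈ S}.indicator (fun _ => (1 : ℝ)) | MeasurableSpace.comap U m₁]
      =ᵐ[μ] fun ω => μ.real {ω' | (U ω, V ω') ∈ S} := by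
  have hpU := Measure.isProbabilityMeasure_map (μ := μ) hU.aemeasurable
  have hpV := Measure.isProbabilityMeasure_map (μ := μ) hV.aemeasurable
  have hlaw := (indepFun_iff_map_prod_eq_prod_map_map hU.aemeasurable hV.aemeasurable).1 h
  set g : E₁ → ℝ := fun u => (μ.map V).real (Prod.mk u ⁻¹' S) with hg
  have hgm : Measurable g := (measurable_measure_prodMk_left hS).ennreal_toReal
  have hgeq : (fun ω => μ.real {ω' | (U ω, V ω') ∈ S}) = g ∘ U := by
    ext ω
    rw [hg]
    simp only [Function.comp_apply, Measure.real]
    rw [Measure.map_apply hV (measurable_prodMk_left hS)]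
    rfl
  have hgb : ∀ u, ‖g u‖ ≤ 1 := fun u => by
    rw [Real.norm_of_nonneg measureReal_nonneg]; exact measureReal_le_one
  rw [hgeq]
  have hSm : MeasurableSet {ω | (U ω, V ω) ∈ S} := (hU.prodMk hV) hS
  refine (ae_eq_condExp_of_forall_setIntegral_eq hU.comap_le ?_ ?_ ?_ ?_).symm
  · exact (integrable_const 1).indicator hSm
  · intro s _ _
    exact (Integrable.of_bound (hgm.comp hU).aestronglyMeasurable 1
      (ae_of_all _ fun ω => hgb _)).integrableOn
  · rintro _ ⟨T, hT, rfl⟩ _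
    have e1 : ∫ ω in U ⁻¹' T, (g ∘ U) ω ∂μ = ∫ u in T, g u ∂(μ.map U) := by
      rw [setIntegral_map hT hgm.aestronglyMeasurable hU.aemeasurable]; rfl
    rw [e1, setIntegral_indicator hSm, setIntegral_const, smul_eq_mul, mul_one]
    have e2 : (U ⁻¹' T ∩ {ω | (U ω, V ω) ∈ S}) = (fun ω => (U ω, V ω)) ⁻¹' ((T ×ˢ univ) ∩ S) := by
      ext ω; simp
    have hTS : MeasurableSet ((T ×ˢ (univ : Set E₂)) ∩ S) := (hT.prod .univ).inter hS
    rw [e2, ← map_measureReal_apply (hU.prodMk hV) hTS, hlaw, Measure.real,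
      Measure.prod_apply hTS, hg]
    simp only [Measure.real]
    rw [integral_toReal (measurable_measure_prodMk_left hS).aemeasurable
      (ae_of_all _ fun _ => measure_lt_top _ _), ← lintegral_indicator hT]
    congr 1
    refine lintegral_congr fun u => ?_
    by_cases hu : u ∈ T <;> simp [Set.indicator, hu, Set.preimage, Set.inter_def]
  · exact (hgm.comp (comap_measurable U)).aestronglyMeasurable

/-- An almost sure property of two independent variables can be checked with the first one fixed. -/
lemma ae_of_indepFun {E₁ E₂ : Type*} [MeasurableSpace E₁] [MeasurableSpace E₂]
    [IsProbabilityMeasure μ] {U : Ω → E₁} {V : Ω → E₂}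
    (hU : Measurable U) (hV : Measurable V) (h : IndepFun U V μ) {S : Set (E₁ × E₂)}
    (hS : MeasurableSet S) (hS' : ∀ᵐ ω ∂μ, ∀ᵐ ω' ∂μ, (U ω, V ω') ∈ S) :
    ∀ᵐ ω ∂μ, (U ω, V ω) ∈ S := by
  have hpV := Measure.isProbabilityMeasure_map (μ := μ) hV.aemeasurable
  have hlaw := (indepFun_iff_map_prod_eq_prod_map_map hU.aemeasurable hV.aemeasurable).1 h
  have h0 : ∀ᵐ z ∂(μ.map fun ω => (U ω, V ω)), z ∈ S := by
    rw [hlaw, Measure.ae_prod_mem_iff_ae_ae_mem hS,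
      ae_map_iff hU.aemeasurable (p := fun u => ∀ᵐ v ∂(μ.map V), (u, v) ∈ S)]
    · filter_upwards [hS'] with ω hω
      exact (ae_map_iff hV.aemeasurable (measurable_prodMk_left hS)).2 hω
    · have := measurable_measure_prodMk_left (ν := μ.map V) hS.compl
      exact this (measurableSet_singleton 0)
  exact ae_of_ae_map (hU.prodMk hV).aemeasurable h0

end Independence

/-- Driving variables of one slot. The entry `none` holds the arrival coin, the access coin and the
fading of the typical link; the entry `some j` holds the buffer coin, the access coin and the fading
of interferer `j`. -/
abbrev SlotNoise : Type := Option ℕ → Fin 3 → ℝ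

/-- Position of the variables of slot `t` among all driving variables. -/
def noiseIdx (t : ℕ) : Option ℕ → Fin 3 → Noise
  | none => ![.arrival t, .access t, .fading t]
  | some j => ![.bufferI j t, .accessI j t, .fadingI j t]

lemma noiseIdx_injective {t t' : ℕ} {o o' : Option ℕ} {k k' : Fin 3}
    (h : noiseIdx t o k = noiseIdx t' o' k') : t = t' ∧ o = o' ∧ k = k' := by
  cases o <;> cases o' <;> fin_cases k <;> fin_cases k' <;> simp_all [noiseIdx]

lemma mark_ne_noiseIdx (j t : ℕ) (o : Option ℕ) (k : Fin 3) : Noise.mark j ≠ noiseIdx t o k := by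
  cases o <;> fin_cases k <;> simp [noiseIdx]

namespace NetworkParams
variable (P : NetworkParams)

open Classical in
/-- Interference in a slot, as a function of the locations and success probabilities of the
interferers and of the driving variables of the slot. -/
def slotInterference (φ : ℕ → Plane × ℝ) (w : SlotNoise) : ℝ≥0∞ :=
  ∑' j : ℕ, if w (some j) 0 ≤ bufferActivity P.xi (P.p * (φ j).2) ∧ w (some j) 1 ≤ P.p then
    ENNReal.ofReal (P.Ptx * w (some j) 2) * ‖(φ j).1‖ₑ ^ (-P.alpha) else 0

/-- The pairs of a network topology and of driving variables of a slot for which the SINR of the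
typical link exceeds the threshold. -/
def decodeSet : Set ((ℕ → Plane × ℝ) × SlotNoise) :=
  {z | ENNReal.ofReal P.theta < ENNReal.ofReal (P.Ptx * z.2 none 2 * P.r ^ (-P.alpha)) /
    (P.slotInterference z.1 z.2 + ENNReal.ofReal P.sigmaSq)}

lemma measurable_bufferActivity (ξ : ℝ) : Measurable (bufferActivity ξ) := by
  have h : ∀ t, Measurable fun s => bufferOccupancy ξ s t := by
    intro t
    induction t with
    | zero => exact measurable_const
    | succ t ih => simp only [bufferOccupancy]; fun_prop
  exact (StronglyMeasurable.limUnder fun t => (h t).stronglyMeasurable).measurable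

lemma measurable_slotInterference :
    Measurable fun z : (ℕ → Plane × ℝ) × SlotNoise => P.slotInterference z.1 z.2 := by
  refine Measurable.tsum fun j => Measurable.ite ?_ ?_ measurable_const
  · have h1 : Measurable fun z : (ℕ → Plane × ℝ) × SlotNoise =>
        bufferActivity P.xi (P.p * (z.1 j).2) :=
      (measurable_bufferActivity P.xi).comp (by fun_prop)
    have h2 : Measurable fun z : (ℕ → Plane × ℝ) × SlotNoise => z.2 (some j) 0 := by fun_prop
    have h3 : Measurable fun z : (ℕ → Plane × ℝ) × SlotNoise => z.2 (some j) 1 := by fun_prop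
    exact (measurableSet_le h2 h1).inter (measurableSet_le h3 measurable_const)
  · fun_prop

lemma measurableSet_decodeSet : MeasurableSet P.decodeSet :=
  measurableSet_lt measurable_const
    (Measurable.div (by fun_prop) (P.measurable_slotInterference.add_const _))

end NetworkParams

namespace MeanFieldNetwork
variable {P : NetworkParams} {ν : Measure ℝ} {Ω : Type*} [MeasurableSpace Ω] {Pr : Measure Ω}

/-- Locations and success probabilities of the interferers. -/
def config (N : MeanFieldNetwork P ν Pr) (ω : Ω) (j : ℕ) : Plane × ℝ := (N.X j ω, N.Z (.mark j) ω)

/-- Driving variables of slot `t`. -/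
def slot (N : MeanFieldNetwork P ν Pr) (t : ℕ) (ω : Ω) : SlotNoise :=
  fun o k => N.Z (noiseIdx t o k) ω

lemma measurable_config (N : MeanFieldNetwork P ν Pr) : Measurable N.config :=
  measurable_pi_lambda _ fun j => (N.measurable_X j).prodMk (N.measurable_Z _)

lemma measurable_slot (N : MeanFieldNetwork P ν Pr) (t : ℕ) : Measurable (N.slot t) :=
  measurable_pi_lambda _ fun _ => measurable_pi_lambda _ fun _ => N.measurable_Z _

variable [IsProbabilityMeasure Pr]

lemma iIndepFun_slot_entries (N : MeanFieldNetwork P ν Pr) (t : ℕ) :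
    iIndepFun (fun o ω => N.slot t ω o) Pr :=
  iIndepFun_blocks N.indep_Z N.measurable_Z (fun o k => noiseIdx t o k) (by
    rintro ⟨o, k⟩ ⟨o', k'⟩ h
    obtain ⟨_, rfl, rfl⟩ := noiseIdx_injective h
    rfl)

lemma indepFun_config_slots (N : MeanFieldNetwork P ν Pr) :
    IndepFun N.config (fun ω t => N.slot t ω) Pr := by
  set M : Ω → ℕ → ℝ := fun ω j => N.Z (.mark j) ω
  set S : Ω → ℕ × Option ℕ × Fin 3 → ℝ := fun ω q => N.Z (noiseIdx q.1 q.2.1 q.2.2) ω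
  have hMS : IndepFun M S Pr := indepFun_pi_of_disjoint N.indep_Z N.measurable_Z Noise.mark
    (fun q : ℕ × Option ℕ × Fin 3 => noiseIdx q.1 q.2.1 q.2.2) fun j q => mark_ne_noiseIdx _ _ _ _
  have hX : IndepFun (fun ω j => N.X j ω) (fun ω => (M ω, S ω)) Pr :=
    N.indep_X_Z.comp (φ := id) (ψ := fun z : Noise → ℝ => ((fun j => z (.mark j)),
      fun q : ℕ × Option ℕ × Fin 3 => z (noiseIdx q.1 q.2.1 q.2.2))) measurable_id (by fun_prop)
  have := indepFun_prod_left_of_indepFun (measurable_pi_lambda _ N.measurable_X)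
    (measurable_pi_lambda _ fun j => N.measurable_Z _)
    (measurable_pi_lambda _ fun q => N.measurable_Z _) hX hMS
  exact this.comp (φ := fun z (j : ℕ) => (z.1 j, z.2 j))
    (ψ := fun (w : ℕ × Option ℕ × Fin 3 → ℝ) (t : ℕ) (o : Option ℕ) (k : Fin 3) => w (t, o, k))
    (by fun_prop) (by fun_prop)

lemma indepFun_config_slot (N : MeanFieldNetwork P ν Pr) (t : ℕ) :
    IndepFun N.config (N.slot t) Pr :=
  N.indepFun_config_slots.comp (φ := id) (ψ := fun w : ℕ → SlotNoise => w t) measurable_id (measurable_pi_apply t)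

lemma successProb_ae_eq (N : MeanFieldNetwork P ν Pr) (t : ℕ) :
    N.successProb t =ᵐ[Pr]
      fun ω => Pr.real {ω' | (N.config ω, N.slot t ω') ∈ P.decodeSet} :=
  condExp_comp_of_indepFun N.measurable_config (N.measurable_slot t) (N.indepFun_config_slot t)
    P.measurableSet_decodeSet

end MeanFieldNetwork

/-! ### The success probability for a fixed topology -/

/-- The occupancy probabilities satisfy an affine recursion with contraction factor
`(1 - ξ) * (1 - s)`. -/
lemma tendsto_bufferOccupancy {ξ s : ℝ} (hξ : 0 < ξ) (hξ1 : ξ ≤ 1) (hs : s ∈ Icc (0 : ℝ) 1) :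
    Tendsto (bufferOccupancy ξ s) atTop (𝓝 (ξ / (ξ + (1 - ξ) * s))) := by
  have hpos : 0 < ξ + (1 - ξ) * s := by nlinarith [hs.1]
  set L := ξ / (ξ + (1 - ξ) * s) with hL
  have hfix : L = ξ + (1 - ξ) * ((1 - s) * L) := by
    rw [hL]; field_simp; ring
  have hform : ∀ t, bufferOccupancy ξ s t = L + ((1 - ξ) * (1 - s)) ^ t * (ξ - L) := by
    intro t
    induction t with
    | zero => simp [bufferOccupancy]
    | succ t ih => rw [bufferOccupancy, ih, pow_succ]; linear_combination -hfix
  have h0 : 0 ≤ (1 - ξ) * (1 - s) := mul_nonneg (by linarith) (by linarith [hs.2])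
  have h1 : (1 - ξ) * (1 - s) < 1 := by nlinarith [hs.1, hs.2]
  have := ((tendsto_pow_atTop_nhds_zero_of_lt_one h0 h1).mul_const (ξ - L)).const_add L
  simp only [zero_mul, add_zero] at this
  exact this.congr fun t => (hform t).symm

lemma bufferActivity_eq {ξ s : ℝ} (hξ : 0 < ξ) (hξ1 : ξ ≤ 1) (hs : s ∈ Icc (0 : ℝ) 1) :
    bufferActivity ξ s = ξ / (ξ + (1 - ξ) * s) :=
  (tendsto_bufferOccupancy hξ hξ1 hs).limUnder_eq

lemma expMeasure_lt_ofReal (y : ℝ≥0∞) :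
    expMeasure 1 {h | y < ENNReal.ofReal h} = expNeg y := by
  have := isProbabilityMeasure_expMeasure (r := 1) one_pos
  rcases eq_or_ne y ⊤ with rfl | hy
  · simp
  have hr : 0 ≤ y.toReal := ENNReal.toReal_nonneg
  have h1 : {h | y < ENNReal.ofReal h} = Ioi y.toReal := by
    ext h
    simp [ENNReal.lt_ofReal_iff_toReal_lt hy]
  rw [h1, ← compl_Iic, prob_compl_eq_one_sub measurableSet_Iic, ← ofReal_cdf,
    cdf_expMeasure_eq one_pos, if_pos hr, one_mul]
  conv_rhs => rw [← ENNReal.ofReal_toReal hy, expNeg_ofReal hr]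
  rw [← ENNReal.ofReal_one, ← ENNReal.ofReal_sub _ (by
    have := Real.exp_le_one_iff.2 (neg_nonpos.2 hr); linarith)]
  congr 1; ring

lemma ae_pos_expMeasure : ∀ᵐ h ∂expMeasure 1, 0 < h := by
  have := isProbabilityMeasure_expMeasure (r := 1) one_pos
  have h0 := expMeasure_lt_ofReal 0
  simp only [ENNReal.ofReal_pos, expNeg_zero] at h0
  exact (prob_compl_eq_zero_iff measurableSet_Ioi).2 h0

/-- Laplace transform of the exponential distribution. -/
lemma lintegral_expNeg_mul_expMeasure (κ : ℝ≥0∞) :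
    ∫⁻ h, expNeg (ENNReal.ofReal h * κ) ∂expMeasure 1 = (1 + κ)⁻¹ := by
  rcases eq_or_ne κ ⊤ with rfl | hκ
  · rw [lintegral_congr_ae (g := fun _ => 0)]
    · simp
    · filter_upwards [ae_pos_expMeasure] with h hh
      rw [ENNReal.mul_top (by simpa using hh), expNeg_top]
  obtain ⟨k, hk, rfl⟩ : ∃ r : ℝ, 0 ≤ r ∧ ENNReal.ofReal r = κ :=
    ⟨κ.toReal, ENNReal.toReal_nonneg, ENNReal.ofReal_toReal hκ⟩
  have hk1 : 0 < 1 + k := by linarith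
  have hdef : expMeasure 1 = volume.withDensity (exponentialPDF 1) := rfl
  rw [hdef, lintegral_withDensity_eq_lintegral_mul _
    (show Measurable (exponentialPDF 1) from (measurable_exponentialPDFReal 1).ennreal_ofReal)
    (show Measurable fun h : ℝ => expNeg (ENNReal.ofReal h * ENNReal.ofReal k) from
      measurable_expNeg.comp (by fun_prop))]
  have : ∀ h, (exponentialPDF 1 * fun h => expNeg (ENNReal.ofReal h * ENNReal.ofReal k)) h =
      ENNReal.ofReal (1 + k)⁻¹ * exponentialPDF (1 + k) h := by
    intro h
    rw [Pi.mul_apply]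
    rcases lt_or_ge h 0 with hh | hh
    · rw [exponentialPDF_of_neg hh, exponentialPDF_of_neg hh, zero_mul, mul_zero]
    · rw [exponentialPDF_of_nonneg hh, exponentialPDF_of_nonneg hh, ← ENNReal.ofReal_mul hh,
        expNeg_ofReal (by positivity), ← ENNReal.ofReal_mul (by positivity),
        ← ENNReal.ofReal_mul (by positivity), one_mul, one_mul, ← Real.exp_add, ← mul_assoc,
        inv_mul_cancel₀ hk1.ne', one_mul]
      congr 2; ring
  rw [lintegral_congr this, lintegral_const_mul _
    (show Measurable (exponentialPDF (1 + k)) from (measurable_exponentialPDFReal _).ennreal_ofReal),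
    lintegral_exponentialPDF_eq_one hk1, mul_one, ENNReal.ofReal_inv_of_pos hk1,
    ENNReal.ofReal_add zero_le_one hk, ENNReal.ofReal_one]

lemma volume_restrict_Icc_Iic {a : ℝ} (ha : a ∈ Icc (0 : ℝ) 1) :
    (volume.restrict (Icc (0 : ℝ) 1)) (Iic a) = ENNReal.ofReal a := by
  rw [Measure.restrict_apply measurableSet_Iic]
  have : Iic a ∩ Icc 0 1 = Icc 0 a := by
    ext x; simp only [mem_inter_iff, mem_Iic, mem_Icc]
    exact ⟨fun h => ⟨h.2.1, h.1⟩, fun h => ⟨h.2, h.1, h.2.trans ha.2⟩⟩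
  rw [this, Real.volume_Icc, sub_zero]

namespace NetworkParams
variable (P : NetworkParams)

lemma alpha_pos : 0 < P.alpha := by linarith [P.two_lt_alpha]

lemma rho_pos : 0 < P.rho := div_pos P.Ptx_pos P.sigmaSq_pos

/-- The normalised noise power `θ r^α / ρ`. -/
def noise : ℝ := P.theta * P.r ^ P.alpha / P.rho

lemma noise_pos : 0 < P.noise :=
  div_pos (mul_pos P.theta_pos (Real.rpow_pos_of_pos P.r_pos _)) P.rho_pos

/-- Probability `p ξ / (ξ + (1 - ξ) p t)` that an interferer whose link has success probability `t`
transmits in a given slot. -/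
def txProb (t : ℝ) : ℝ := P.p * P.xi / (P.xi + (1 - P.xi) * P.p * t)

/-- The fading-averaged loss `1 / (1 + v^{α/2})` caused by an interferer at squared distance
`v r² θ^δ`. -/
def lossKernel (v : ℝ) : ℝ := 1 / (1 + v ^ (P.alpha / 2))

/-- The squared norm of `x` in units of `r² θ^δ`. -/
def normArea (x : Plane) : ℝ := ‖x‖ ^ 2 / (P.r ^ 2 * P.theta ^ P.delta)

/-- Negative logarithm of the factor that an interferer at `z.1` with success probability `z.2`
contributes to the conditional success probability of the typical link. -/
def logLoss (z : Plane × ℝ) : ℝ := -Real.log (1 - P.txProb z.2 * P.lossKernel (P.normArea z.1))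

variable {P}

lemma txProb_den_pos {t : ℝ} (ht : t ∈ Icc (0 : ℝ) 1) : 0 < P.xi + (1 - P.xi) * P.p * t := by
  have := mul_nonneg (mul_nonneg (sub_nonneg.2 P.xi_le_one) P.p_pos.le) ht.1
  linarith [P.xi_pos]

lemma txProb_pos {t : ℝ} (ht : t ∈ Icc (0 : ℝ) 1) : 0 < P.txProb t :=
  div_pos (mul_pos P.p_pos P.xi_pos) (txProb_den_pos ht)

lemma txProb_le {t : ℝ} (ht : t ∈ Icc (0 : ℝ) 1) : P.txProb t ≤ P.p := by
  rw [txProb, div_le_iff₀ (txProb_den_pos ht)]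
  have := mul_nonneg (mul_nonneg (sub_nonneg.2 P.xi_le_one) P.p_pos.le) ht.1
  nlinarith [P.p_pos]

lemma le_txProb {t : ℝ} (ht : t ∈ Icc (0 : ℝ) 1) : P.p * P.xi ≤ P.txProb t := by
  rw [txProb, le_div_iff₀ (txProb_den_pos ht)]
  have h1 : P.xi + (1 - P.xi) * P.p * t ≤ 1 := by
    have h2 : P.p * t ≤ 1 := mul_le_one₀ P.p_lt_one.le ht.1 ht.2
    nlinarith [P.xi_le_one, P.xi_pos]
  exact mul_le_of_le_one_right (mul_pos P.p_pos P.xi_pos).le h1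

lemma lossKernel_pos {v : ℝ} (hv : 0 ≤ v) : 0 < P.lossKernel v := by
  have := Real.rpow_nonneg hv (P.alpha / 2)
  exact div_pos one_pos (by linarith)

lemma lossKernel_le_one {v : ℝ} (hv : 0 ≤ v) : P.lossKernel v ≤ 1 := by
  have := Real.rpow_nonneg hv (P.alpha / 2)
  rw [lossKernel, div_le_one (by linarith)]; linarith

lemma normArea_nonneg (x : Plane) : 0 ≤ P.normArea x := by
  have := P.theta_pos
  rw [normArea]; positivity

lemma txProb_mul_lossKernel_mem {t v : ℝ} (ht : t ∈ Icc (0 : ℝ) 1) (hv : 0 ≤ v) :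
    P.txProb t * P.lossKernel v ∈ Ioc (0 : ℝ) P.p :=
  ⟨mul_pos (txProb_pos ht) (lossKernel_pos hv),
    (mul_le_of_le_one_right (txProb_pos ht).le (lossKernel_le_one hv)).trans (txProb_le ht)⟩

lemma logLoss_nonneg {z : Plane × ℝ} (hz : z.2 ∈ Icc (0 : ℝ) 1) : 0 ≤ P.logLoss z := by
  have h := txProb_mul_lossKernel_mem (P := P) hz (normArea_nonneg (P := P) z.1)
  rw [logLoss, neg_nonneg]
  exact Real.log_nonpos (by linarith [h.2, P.p_lt_one]) (by linarith [h.1])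

lemma exp_neg_logLoss {z : Plane × ℝ} (hz : z.2 ∈ Icc (0 : ℝ) 1) :
    Real.exp (-P.logLoss z) = 1 - P.txProb z.2 * P.lossKernel (P.normArea z.1) := by
  have h := txProb_mul_lossKernel_mem (P := P) hz (normArea_nonneg (P := P) z.1)
  rw [logLoss, neg_neg, Real.exp_log (by linarith [h.2, P.p_lt_one])]

/-- Averaging the loss from an active interferer at `x` over its fading gives
`1 - lossKernel (normArea x)`. At `x = 0` the path gain is infinite and both sides vanish. -/
lemma inv_one_add_pathGain (x : Plane) :
    (1 + ENNReal.ofReal (P.theta * P.r ^ P.alpha) * ‖x‖ₑ ^ (-P.alpha))⁻¹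
      = ENNReal.ofReal (1 - P.lossKernel (P.normArea x)) := by
  have hθ := P.theta_pos
  have hr := P.r_pos
  have hα := P.alpha_pos
  have hA : 0 < P.theta * P.r ^ P.alpha := mul_pos hθ (Real.rpow_pos_of_pos hr _)
  rcases eq_or_ne x 0 with rfl | hx
  · have h0 : (0 : ℝ) ^ (P.alpha / 2) = 0 := Real.zero_rpow (by positivity)
    simp [normArea, lossKernel, h0, ENNReal.zero_rpow_of_neg (neg_lt_zero.2 hα),
      ENNReal.mul_top, hA]
  · have hn : 0 < ‖x‖ := norm_pos_iff.2 hx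
    have h1 : ‖x‖ₑ ^ (-P.alpha) = ENNReal.ofReal (‖x‖ ^ (-P.alpha)) := by
      rw [← ofReal_norm, ENNReal.ofReal_rpow_of_pos hn]
    have hv : P.normArea x ^ (P.alpha / 2) = ‖x‖ ^ P.alpha / (P.theta * P.r ^ P.alpha) := by
      rw [normArea, Real.div_rpow (by positivity) (by positivity),
        Real.mul_rpow (by positivity) (by positivity), ← Real.rpow_natCast, ← Real.rpow_natCast,
        ← Real.rpow_mul hn.le, ← Real.rpow_mul hr.le, ← Real.rpow_mul hθ.le, delta]
      have e1 : ((2 : ℕ) : ℝ) * (P.alpha / 2) = P.alpha := by push_cast; ring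
      have e2 : 2 / P.alpha * (P.alpha / 2) = 1 := by field_simp
      rw [e1, e2, Real.rpow_one, mul_comm]
    have hxa : 0 < ‖x‖ ^ P.alpha := Real.rpow_pos_of_pos hn _
    rw [h1, ← ENNReal.ofReal_mul hA.le, ← ENNReal.ofReal_one, ← ENNReal.ofReal_add zero_le_one
      (by positivity), ← ENNReal.ofReal_inv_of_pos (by positivity), lossKernel, hv,
      Real.rpow_neg hn.le]
    congr 1
    field_simp
    ring

end NetworkParams

namespace MeanFieldNetwork
variable {P : NetworkParams} {ν : Measure ℝ} {Ω : Type*} [MeasurableSpace Ω] {Pr : Measure Ω}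

lemma map_slot (N : MeanFieldNetwork P ν Pr) (t : ℕ) (o : Option ℕ) (k : Fin 3) :
    Pr.map (fun ω => N.slot t ω o k) = noiseLaw ν (noiseIdx t o k) := N.law_Z _

lemma measure_coin_le (N : MeanFieldNetwork P ν Pr) {i : Noise}
    (hi : noiseLaw ν i = volume.restrict (Icc 0 1)) {a : ℝ} (ha : a ∈ Icc (0 : ℝ) 1) :
    Pr {ω | N.Z i ω ≤ a} = ENNReal.ofReal a := by
  rw [← volume_restrict_Icc_Iic ha, ← hi, ← N.law_Z i, Measure.map_apply (N.measurable_Z i)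
    measurableSet_Iic]
  rfl

variable [IsProbabilityMeasure Pr]

open Classical in
/-- Averaging the contribution of one interferer over its coins and its fading. -/
lemma lintegral_expNeg_interferer (N : MeanFieldNetwork P ν Pr) (t j : ℕ) {z : Plane × ℝ}
    (hz : z.2 ∈ Icc (0 : ℝ) 1) :
    ∫⁻ ω, expNeg (ENNReal.ofReal (P.theta * P.r ^ P.alpha / P.Ptx) *
      (if N.slot t ω (some j) 0 ≤ bufferActivity P.xi (P.p * z.2) ∧ N.slot t ω (some j) 1 ≤ P.p then
        ENNReal.ofReal (P.Ptx * N.slot t ω (some j) 2) * ‖z.1‖ₑ ^ (-P.alpha) else 0)) ∂Pr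
      = expNeg (ENNReal.ofReal (P.logLoss z)) := by
  set a := bufferActivity P.xi (P.p * z.2) with ha
  set κ := ENNReal.ofReal (P.theta * P.r ^ P.alpha) * ‖z.1‖ₑ ^ (-P.alpha) with hκ
  have hs : P.p * z.2 ∈ Icc (0 : ℝ) 1 :=
    ⟨mul_nonneg P.p_pos.le hz.1, mul_le_one₀ P.p_lt_one.le hz.1 hz.2⟩
  have hae : a = P.xi / (P.xi + (1 - P.xi) * (P.p * z.2)) :=
    bufferActivity_eq P.xi_pos P.xi_le_one hs
  have hden := NetworkParams.txProb_den_pos (P := P) hz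
  have hap : a * P.p = P.txProb z.2 := by rw [hae, NetworkParams.txProb, ← mul_assoc]; ring
  have ha01 : a ∈ Icc (0 : ℝ) 1 := by
    have h2 : 0 ≤ (1 - P.xi) * (P.p * z.2) := mul_nonneg (sub_nonneg.2 P.xi_le_one) hs.1
    rw [hae]
    exact ⟨div_nonneg P.xi_pos.le (by linarith [P.xi_pos]),
      (div_le_one (by linarith [P.xi_pos])).2 (by linarith)⟩
  -- the three driving variables of the interferer, turned into independent factors
  let g : Fin 3 → ℝ → ℝ≥0∞ := ![(Iic a).indicator 1, (Iic P.p).indicator 1,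
    fun h => expNeg (ENNReal.ofReal h * κ)]
  have hg : ∀ k, Measurable (g k) := by
    intro k
    fin_cases k
    · exact measurable_one.indicator measurableSet_Iic
    · exact measurable_one.indicator measurableSet_Iic
    · exact measurable_expNeg.comp (by fun_prop)
  have hind : iIndepFun (fun k ω => N.slot t ω (some j) k) Pr :=
    N.indep_Z.precomp (g := noiseIdx t (some j)) fun k k' h => (noiseIdx_injective h).2.2
  have hZm : ∀ k, Measurable fun ω => N.slot t ω (some j) k := fun k => N.measurable_Z _
  have hprod := lintegral_prod_eq_prod_lintegral_of_indepFun Finset.univ _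
    (hind.comp g hg) (fun k => (hg k).comp (hZm k))
  simp only [Function.comp_apply, Fin.prod_univ_three] at hprod
  have e0 : ∫⁻ ω, g 0 (N.slot t ω (some j) 0) ∂Pr = ENNReal.ofReal a := by
    rw [← N.measure_coin_le (i := .bufferI j t) rfl ha01,
      ← lintegral_indicator_one (measurableSet_le (N.measurable_Z _) measurable_const)]
    rfl
  have e1 : ∫⁻ ω, g 1 (N.slot t ω (some j) 1) ∂Pr = ENNReal.ofReal P.p := by
    rw [← N.measure_coin_le (i := .accessI j t) rfl ⟨P.p_pos.le, P.p_lt_one.le⟩,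
      ← lintegral_indicator_one (measurableSet_le (N.measurable_Z _) measurable_const)]
    rfl
  have e2 : ∫⁻ ω, g 2 (N.slot t ω (some j) 2) ∂Pr = (1 + κ)⁻¹ := by
    rw [← lintegral_expNeg_mul_expMeasure, ← lintegral_map (hg 2) (hZm 2), N.map_slot]
    rfl
  set A : Set Ω := {ω | N.slot t ω (some j) 0 ≤ a ∧ N.slot t ω (some j) 1 ≤ P.p} with hA
  have hAm : MeasurableSet A :=
    (measurableSet_le (hZm 0) measurable_const).inter (measurableSet_le (hZm 1) measurable_const)
  have hI : ∀ ω, g 0 (N.slot t ω (some j) 0) * g 1 (N.slot t ω (some j) 1) = A.indicator 1 ω := by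
    intro ω
    change (Iic a).indicator 1 _ * (Iic P.p).indicator 1 _ = _
    by_cases h0 : N.slot t ω (some j) 0 ≤ a <;> by_cases h1 : N.slot t ω (some j) 1 ≤ P.p <;>
      simp [hA, Set.indicator, h0, h1]
  have hPA : Pr A = ENNReal.ofReal (P.txProb z.2) := by
    have hi := hind.precomp (g := (Fin.castSucc : Fin 2 → Fin 3)) (Fin.castSucc_injective 2)
    have := lintegral_prod_eq_prod_lintegral_of_indepFun Finset.univ _
      (hi.comp (fun k => g k.castSucc) fun k => hg _) (fun k => (hg _).comp (hZm _))
    simp only [Function.comp_apply, Fin.prod_univ_two] at this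
    have h3 : ∫⁻ ω, A.indicator 1 ω ∂Pr = ENNReal.ofReal a * ENNReal.ofReal P.p := by
      rw [← e0, ← e1]
      simp_rw [← hI]
      exact this
    rw [lintegral_indicator_one hAm, ← ENNReal.ofReal_mul ha01.1, hap] at h3
    exact h3
  have hpt : ∀ ω, expNeg (ENNReal.ofReal (P.theta * P.r ^ P.alpha / P.Ptx) *
      (if N.slot t ω (some j) 0 ≤ a ∧ N.slot t ω (some j) 1 ≤ P.p then
        ENNReal.ofReal (P.Ptx * N.slot t ω (some j) 2) * ‖z.1‖ₑ ^ (-P.alpha) else 0)) =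
      g 0 (N.slot t ω (some j) 0) * g 1 (N.slot t ω (some j) 1) * g 2 (N.slot t ω (some j) 2)
        + Aᶜ.indicator 1 ω := by
    intro ω
    rw [hI]
    by_cases h : ω ∈ A
    · have h' : N.slot t ω (some j) 0 ≤ a ∧ N.slot t ω (some j) 1 ≤ P.p := h
      rw [if_pos h', Set.indicator_of_mem h, Set.indicator_of_notMem (by simpa using h), add_zero,
        Pi.one_apply, one_mul, ← mul_assoc, ← ENNReal.ofReal_mul
          (div_nonneg (mul_nonneg P.theta_pos.le (Real.rpow_nonneg P.r_pos.le _)) P.Ptx_pos.le)]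
      change _ = expNeg (ENNReal.ofReal (N.slot t ω (some j) 2) * κ)
      have hA : 0 ≤ P.theta * P.r ^ P.alpha :=
        mul_nonneg P.theta_pos.le (Real.rpow_nonneg P.r_pos.le _)
      rw [hκ, mul_left_comm (ENNReal.ofReal (N.slot t ω (some j) 2)),
        ← mul_assoc (ENNReal.ofReal (P.theta * P.r ^ P.alpha)), ← ENNReal.ofReal_mul hA,
        ← mul_assoc, div_mul_cancel₀ _ P.Ptx_pos.ne']
    · have h' : ¬ (N.slot t ω (some j) 0 ≤ a ∧ N.slot t ω (some j) 1 ≤ P.p) := h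
      rw [if_neg h', Set.indicator_of_notMem h, Set.indicator_of_mem (by simpa using h), mul_zero,
        expNeg_zero, zero_mul, zero_add, Pi.one_apply]
  have hq1 := NetworkParams.lossKernel_le_one (P := P) (NetworkParams.normArea_nonneg (P := P) z.1)
  have hb0 := (NetworkParams.txProb_pos (P := P) hz)
  have hb1 := (NetworkParams.txProb_le (P := P) hz).trans P.p_lt_one.le
  simp_rw [hpt]
  rw [lintegral_add_right _ (measurable_one.indicator hAm.compl), hprod, e0, e1, e2,
    lintegral_indicator_one hAm.compl, prob_compl_eq_one_sub hAm, hPA,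
    ← ENNReal.ofReal_mul ha01.1, hap, NetworkParams.inv_one_add_pathGain,
    expNeg_ofReal (NetworkParams.logLoss_nonneg hz), NetworkParams.exp_neg_logLoss hz,
    ← ENNReal.ofReal_one, ← ENNReal.ofReal_sub _ hb0.le, ← ENNReal.ofReal_mul hb0.le,
    ← ENNReal.ofReal_add (mul_nonneg hb0.le (by linarith)) (by linarith)]
  congr 1; ring

/-- Success probability of the typical link for a fixed network topology. -/
lemma measure_decodes (N : MeanFieldNetwork P ν Pr) (t : ℕ) {φ : ℕ → Plane × ℝ}
    (hφ : ∀ j, (φ j).2 ∈ Icc (0 : ℝ) 1) :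
    Pr {ω | (φ, N.slot t ω) ∈ P.decodeSet} =
      expNeg (ENNReal.ofReal P.noise + ∑' j, ENNReal.ofReal (P.logLoss (φ j))) := by
  classical
  have hA : 0 ≤ P.theta * P.r ^ P.alpha / P.Ptx :=
    div_nonneg (mul_nonneg P.theta_pos.le (Real.rpow_nonneg P.r_pos.le _)) P.Ptx_pos.le
  have hrα : 0 < P.r ^ (-P.alpha) := Real.rpow_pos_of_pos P.r_pos _
  set c := ENNReal.ofReal (P.theta * P.r ^ P.alpha / P.Ptx) with hc
  set I : Ω → ℝ≥0∞ := fun ω => P.slotInterference φ (N.slot t ω) with hI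
  set Y : Ω → ℝ≥0∞ := fun ω => ENNReal.ofReal P.noise + c * I ω with hY
  set H : Ω → ℝ := fun ω => N.slot t ω none 2 with hH
  have hHm : Measurable H := N.measurable_Z _
  have hIm : Measurable I :=
    (P.measurable_slotInterference.comp measurable_prodMk_left).comp (N.measurable_slot t)
  have hYm : Measurable Y := (hIm.const_mul _).const_add _
  have hcσ : c * ENNReal.ofReal P.sigmaSq = ENNReal.ofReal P.noise := by
    rw [hc, ← ENNReal.ofReal_mul hA, NetworkParams.noise, NetworkParams.rho]
    congr 1
    have := P.Ptx_pos.ne'; have := P.sigmaSq_pos.ne'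
    field_simp
  -- decoding means that the fading `H` exceeds a level `Y` set by noise and interference
  have hset : {ω | (φ, N.slot t ω) ∈ P.decodeSet} = {ω | Y ω < ENNReal.ofReal (H ω)} := by
    ext ω
    change ENNReal.ofReal P.theta < ENNReal.ofReal (P.Ptx * H ω * P.r ^ (-P.alpha)) /
      (I ω + ENNReal.ofReal P.sigmaSq) ↔ Y ω < ENNReal.ofReal (H ω)
    have hsp : I ω + ENNReal.ofReal P.sigmaSq ≠ 0 := by
      have := ENNReal.ofReal_pos.2 P.sigmaSq_pos
      simp [this.ne']
    have hd : ENNReal.ofReal (P.Ptx * P.r ^ (-P.alpha)) ≠ 0 := by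
      simpa using mul_pos P.Ptx_pos hrα
    have e1 : ENNReal.ofReal (P.Ptx * H ω * P.r ^ (-P.alpha)) =
        ENNReal.ofReal (P.Ptx * P.r ^ (-P.alpha)) * ENNReal.ofReal (H ω) := by
      rw [← ENNReal.ofReal_mul (mul_pos P.Ptx_pos hrα).le]; congr 1; ring
    have e2 : ENNReal.ofReal P.theta * (I ω + ENNReal.ofReal P.sigmaSq) =
        ENNReal.ofReal (P.Ptx * P.r ^ (-P.alpha)) * Y ω := by
      have : ENNReal.ofReal P.theta = ENNReal.ofReal (P.Ptx * P.r ^ (-P.alpha)) * c := by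
        rw [hc, ← ENNReal.ofReal_mul (mul_pos P.Ptx_pos hrα).le]
        congr 1
        have := P.Ptx_pos.ne'
        have h3 : P.r ^ (-P.alpha) * P.r ^ P.alpha = 1 := by
          rw [← Real.rpow_add P.r_pos]; simp
        field_simp
        linear_combination -P.theta * h3
      rw [this, mul_assoc, mul_add, hcσ, add_comm]
    rcases eq_or_ne (I ω) ⊤ with hIt | hIt
    · have hYt : Y ω = ⊤ := by
        simp only [hY, hIt]
        rw [ENNReal.mul_top, add_top]
        rw [hc]; simp only [ne_eq, ENNReal.ofReal_eq_zero, not_le]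
        exact div_pos (mul_pos P.theta_pos (Real.rpow_pos_of_pos P.r_pos _)) P.Ptx_pos
      simp [hIt, hYt]
    · rw [ENNReal.lt_div_iff_mul_lt (Or.inl hsp) (Or.inl (by simp [hIt])), e1, e2,
        ENNReal.mul_lt_mul_iff_right hd ENNReal.ofReal_ne_top]
  -- `Y` depends only on the driving variables of the interferers
  have hind : IndepFun Y H Pr := by
    have h := indepFun_pi_of_disjoint (N.iIndepFun_slot_entries t)
      (fun o => measurable_pi_lambda _ fun k => N.measurable_Z _) (some : ℕ → Option ℕ)
      (fun _ : Unit => none) (fun i j => by simp)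
    have hψ : Measurable fun w : ℕ → Fin 3 → ℝ => ENNReal.ofReal P.noise +
        c * P.slotInterference φ (fun o => o.elim 0 w) := by
      suffices hext : Measurable fun (w : ℕ → Fin 3 → ℝ) (o : Option ℕ) =>
          o.elim (0 : Fin 3 → ℝ) w by
        have hG : Measurable fun w : SlotNoise => P.slotInterference φ w :=
          P.measurable_slotInterference.comp measurable_prodMk_left
        exact ((hG.comp hext).const_mul _).const_add _
      refine measurable_pi_lambda _ fun o => ?_
      cases o with
      | none => exact measurable_const
      | some j => exact measurable_pi_apply j
    exact h.comp (φ := fun w : ℕ → Fin 3 → ℝ => ENNReal.ofReal P.noise +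
        c * P.slotInterference φ (fun o => o.elim 0 w)) (ψ := fun w : Unit → Fin 3 → ℝ => w () 2)
      hψ (by fun_prop)
  have hlawH : Pr.map H = expMeasure 1 := N.map_slot t none 2
  have hpE := isProbabilityMeasure_expMeasure (r := 1) one_pos
  have hT : MeasurableSet {q : ℝ≥0∞ × ℝ | q.1 < ENNReal.ofReal q.2} :=
    measurableSet_lt measurable_fst (by fun_prop)
  -- the fading is exponential and independent of `Y`
  have h1 : Pr {ω | Y ω < ENNReal.ofReal (H ω)} = ∫⁻ ω, expNeg (Y ω) ∂Pr := by
    change Pr ((fun ω => (Y ω, H ω)) ⁻¹' {q : ℝ≥0∞ × ℝ | q.1 < ENNReal.ofReal q.2}) = _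
    rw [← Measure.map_apply (hYm.prodMk hHm) hT,
      (indepFun_iff_map_prod_eq_prod_map_map hYm.aemeasurable hHm.aemeasurable).1 hind, hlawH,
      Measure.prod_apply hT, ← lintegral_map measurable_expNeg hYm]
    exact lintegral_congr fun y => expMeasure_lt_ofReal y
  -- the contributions of the interferers to `expNeg (c * I)` are independent factors
  let term : ℕ → (Fin 3 → ℝ) → ℝ≥0∞ := fun j w =>
    if w 0 ≤ bufferActivity P.xi (P.p * (φ j).2) ∧ w 1 ≤ P.p then
      ENNReal.ofReal (P.Ptx * w 2) * ‖(φ j).1‖ₑ ^ (-P.alpha) else 0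
  have htm : ∀ j, Measurable fun w => expNeg (c * term j w) := fun j =>
    measurable_expNeg.comp (Measurable.const_mul (Measurable.ite
      ((measurableSet_le (measurable_pi_apply 0) measurable_const).inter
        (measurableSet_le (measurable_pi_apply 1) measurable_const)) (by fun_prop)
      measurable_const) _)
  have hsm : ∀ j, Measurable fun ω => N.slot t ω (some j) := fun j =>
    measurable_pi_lambda _ fun k => N.measurable_Z _
  have hj : ∀ j, ∫⁻ ω, expNeg (c * term j (N.slot t ω (some j))) ∂Pr =
      expNeg (ENNReal.ofReal (P.logLoss (φ j))) := fun j =>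
    N.lintegral_expNeg_interferer t j (hφ j)
  have hfin : ∀ n, ∫⁻ ω, ∏ j ∈ Finset.range n, expNeg (c * term j (N.slot t ω (some j))) ∂Pr =
      ∏ j ∈ Finset.range n, expNeg (ENNReal.ofReal (P.logLoss (φ j))) := by
    intro n
    have hi := ((N.iIndepFun_slot_entries t).precomp (Option.some_injective ℕ)).comp
      (fun j w => expNeg (c * term j w)) htm
    rw [← Finset.prod_congr rfl fun j _ => hj j]
    exact lintegral_prod_eq_prod_lintegral_of_indepFun (Finset.range n) _ hi
      fun j => (htm j).comp (hsm j)
  have hlim1 := tendsto_lintegral_of_le_one (μ := Pr)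
    (f := fun n ω => ∏ j ∈ Finset.range n, expNeg (c * term j (N.slot t ω (some j))))
    (g := fun ω => expNeg (c * I ω))
    (fun n => Finset.measurable_prod _ fun j _ => (htm j).comp (hsm j))
    (fun n ω => Finset.prod_le_one' fun j _ => expNeg_le_one _) (fun ω => by
      have := tendsto_prod_expNeg fun j => c * term j (N.slot t ω (some j))
      rw [ENNReal.tsum_mul_left] at this
      exact this)
  simp_rw [hfin] at hlim1
  rw [hset, h1, expNeg_add, ← tendsto_nhds_unique hlim1 (tendsto_prod_expNeg _)]
  simp_rw [hY, expNeg_add]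
  exact lintegral_const_mul _ (measurable_expNeg.comp (hIm.const_mul _))

end MeanFieldNetwork

/-! ### The Laplace functional of the marked Poisson process -/

namespace NetworkParams
variable {P : NetworkParams}

lemma measurable_normArea : Measurable P.normArea := by
  unfold normArea; fun_prop

lemma measurable_txProb : Measurable P.txProb := by
  unfold txProb; fun_prop

lemma measurable_lossKernel : Measurable P.lossKernel := by
  unfold lossKernel; fun_prop

lemma measurable_logLoss : Measurable P.logLoss :=
  (Real.measurable_log.comp (measurable_const.sub ((measurable_txProb.comp measurable_snd).mul
    (measurable_lossKernel.comp (measurable_normArea.comp measurable_fst))))).neg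

lemma spatialConst_pos : 0 < P.spatialConst := by
  have := P.lam_pos; have := P.r_pos; have := Real.rpow_pos_of_pos P.theta_pos P.delta
  rw [spatialConst]; positivity

/-- The image of the Lebesgue measure of the plane under the normalised squared norm. -/
lemma map_normArea : (volume : Measure Plane).map P.normArea =
    ENNReal.ofReal (Real.pi * (P.r ^ 2 * P.theta ^ P.delta)) • volume.restrict (Ioi 0) := by
  set K := P.r ^ 2 * P.theta ^ P.delta with hK
  have hKpos : 0 < K := mul_pos (pow_pos P.r_pos 2) (Real.rpow_pos_of_pos P.theta_pos _)
  have hIic : ∀ b, (volume : Measure Plane).map P.normArea (Iic b) =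
      ENNReal.ofReal (Real.pi * K) * ENNReal.ofReal b := by
    intro b
    rw [Measure.map_apply measurable_normArea measurableSet_Iic]
    rcases lt_or_ge b 0 with hb | hb
    · rw [ENNReal.ofReal_of_nonpos hb.le, mul_zero]
      convert measure_empty (μ := (volume : Measure Plane))
      ext x
      simp only [mem_preimage, mem_Iic, mem_empty_iff_false, iff_false, not_le]
      exact hb.trans_le (normArea_nonneg x)
    · have : P.normArea ⁻¹' Iic b = Metric.closedBall (0 : Plane) (Real.sqrt (K * b)) := by
        ext x
        rw [mem_preimage, mem_Iic, Metric.mem_closedBall, dist_zero_right, normArea, ← hK,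
          div_le_iff₀ hKpos, Real.le_sqrt (norm_nonneg _) (by positivity), mul_comm b]
      rw [this, EuclideanSpace.volume_closedBall_fin_two, ← ENNReal.ofReal_pow (Real.sqrt_nonneg _),
        Real.sq_sqrt (by positivity), ← ENNReal.ofReal_mul (by positivity)]
      rw [← ENNReal.ofReal_mul (by positivity)]
      congr 1; ring
  have hIic' : ∀ b, (ENNReal.ofReal (Real.pi * K) • volume.restrict (Ioi (0 : ℝ))) (Iic b) =
      ENNReal.ofReal (Real.pi * K) * ENNReal.ofReal b := by
    intro b
    rw [Measure.smul_apply, smul_eq_mul, Measure.restrict_apply measurableSet_Iic, inter_comm,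
      Ioi_inter_Iic, Real.volume_Ioc, sub_zero]
  have hfin : ∀ b, (volume : Measure Plane).map P.normArea (Iic b) ≠ ⊤ := fun b => by
    rw [hIic]; exact ENNReal.mul_ne_top ENNReal.ofReal_ne_top ENNReal.ofReal_ne_top
  have : IsLocallyFiniteMeasure ((volume : Measure Plane).map P.normArea) :=
    ⟨fun x => ⟨Iic (x + 1), Iic_mem_nhds (by linarith), (hfin _).lt_top⟩⟩
  refine Measure.ext_of_Ioc _ _ fun a b hab => ?_
  rw [show Ioc a b = Iic b \ Iic a by ext; simp [and_comm], measure_sdiff (Iic_subset_Iic.2 hab.le) measurableSet_Iic.nullMeasurableSet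
    (hfin a), measure_sdiff (Iic_subset_Iic.2 hab.le) measurableSet_Iic.nullMeasurableSet
    (by rw [hIic', ← hIic]; exact hfin a), hIic, hIic, hIic', hIic']

end NetworkParams

namespace MeanFieldNetwork
variable {P : NetworkParams} {ν : Measure ℝ} {Ω : Type*} [MeasurableSpace Ω] {Pr : Measure Ω}

lemma ae_marks_mem (N : MeanFieldNetwork P ν Pr) [IsProbabilityMeasure ν] (hν : ν (Icc 0 1) = 1) :
    ∀ᵐ ω ∂Pr, ∀ j, (N.config ω j).2 ∈ Icc (0 : ℝ) 1 := by
  refine ae_all_iff.2 fun j => ?_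
  have h : ∀ᵐ x ∂(Pr.map (N.Z (.mark j))), x ∈ Icc (0 : ℝ) 1 := by
    rw [N.law_Z]
    change ∀ᵐ x ∂ν, _
    exact (prob_compl_eq_zero_iff measurableSet_Icc).2 hν
  exact ae_of_ae_map (N.measurable_Z _).aemeasurable h

variable [IsProbabilityMeasure Pr]

/-- Laplace functional of the Poisson process of interferers, marked with the success probabilities
of their links. -/
theorem lintegral_expNeg_tsum_config (N : MeanFieldNetwork P ν Pr) [IsProbabilityMeasure ν]
    {F : Plane × ℝ → ℝ≥0∞} (hF : Measurable F) :
    ∫⁻ ω, expNeg (∑' j, F (N.config ω j)) ∂Pr =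
      expNeg (ENNReal.ofReal P.lam * ∫⁻ x, (1 - ∫⁻ t, expNeg (F (x, t)) ∂ν)) := by
  set Ψ : Plane → ℝ≥0∞ := fun x => ∫⁻ t, expNeg (F (x, t)) ∂ν with hΨ
  have hΨm : Measurable Ψ := (measurable_expNeg.comp hF).lintegral_prod_right'
  have hΨ1 : ∀ x, Ψ x ≤ 1 := fun x => by
    calc Ψ x ≤ ∫⁻ _, 1 ∂ν := lintegral_mono fun t => expNeg_le_one _
      _ = 1 := by simp
  set M : Ω → ℕ → ℝ := fun ω j => N.Z (.mark j) ω
  set X : Ω → ℕ → Plane := fun ω j => N.X j ω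
  have hMm : Measurable M := measurable_pi_lambda _ fun j => N.measurable_Z _
  have hXm : Measurable X := measurable_pi_lambda _ N.measurable_X
  have hXM : IndepFun X M Pr := N.indep_X_Z.comp (φ := id)
    (ψ := fun (z : Noise → ℝ) (j : ℕ) => z (.mark j)) measurable_id (by fun_prop)
  have hMi : iIndepFun (fun j => N.Z (.mark j)) Pr :=
    N.indep_Z.precomp (g := Noise.mark) fun i j h => by simpa using h
  have hKm : Measurable fun q : (ℕ → Plane) × (ℕ → ℝ) => expNeg (∑' j, F (q.1 j, q.2 j)) :=
    measurable_expNeg.comp (Measurable.tsum fun j => hF.comp (by fun_prop))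
  have hpM := Measure.isProbabilityMeasure_map (μ := Pr) hMm.aemeasurable
  -- the locations are independent of the marks: average over the marks first
  have h1 : ∫⁻ ω, expNeg (∑' j, F (N.config ω j)) ∂Pr =
      ∫⁻ ω, ∫⁻ ω', expNeg (∑' j, F (X ω j, M ω' j)) ∂Pr ∂Pr := by
    have e := lintegral_map (μ := Pr) hKm (hXm.prodMk hMm)
    rw [(indepFun_iff_map_prod_eq_prod_map_map hXm.aemeasurable hMm.aemeasurable).1 hXM,
      lintegral_prod _ hKm.aemeasurable, lintegral_map hKm.lintegral_prod_right' hXm] at e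
    rw [show ∫⁻ ω, expNeg (∑' j, F (N.config ω j)) ∂Pr =
      ∫⁻ ω, expNeg (∑' j, F ((X ω, M ω).1 j, (X ω, M ω).2 j)) ∂Pr from rfl, ← e]
    exact lintegral_congr fun ω => lintegral_map (hKm.comp measurable_prodMk_left) hMm
  -- the marks are independent, so the inner average is a product over the points, which `negLog`
  -- turns back into a sum, to which the Laplace functional of the unmarked process applies
  have h2 : ∀ x : ℕ → Plane, ∫⁻ ω', expNeg (∑' j, F (x j, M ω' j)) ∂Pr =
      expNeg (∑' j, negLog (Ψ (x j))) := by
    intro x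
    have hjm : ∀ j, Measurable fun t => expNeg (F (x j, t)) := fun j =>
      measurable_expNeg.comp (hF.comp measurable_prodMk_left)
    have hl := tendsto_lintegral_of_le_one (μ := Pr)
      (f := fun n ω => ∏ j ∈ Finset.range n, expNeg (F (x j, M ω j)))
      (g := fun ω => expNeg (∑' j, F (x j, M ω j)))
      (fun n => Finset.measurable_prod _ fun j _ => (hjm j).comp (N.measurable_Z _))
      (fun n ω => Finset.prod_le_one' fun j _ => expNeg_le_one _)
      (fun ω => tendsto_prod_expNeg _)
    have hfin : ∀ n, ∫⁻ ω, ∏ j ∈ Finset.range n, expNeg (F (x j, M ω j)) ∂Pr =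
        ∏ j ∈ Finset.range n, expNeg (negLog (Ψ (x j))) := by
      intro n
      have := lintegral_prod_eq_prod_lintegral_of_indepFun (Finset.range n) _
        (hMi.comp (fun j t => expNeg (F (x j, t))) hjm) fun j => (hjm j).comp (N.measurable_Z _)
      refine this.trans (Finset.prod_congr rfl fun j _ => ?_)
      rw [expNeg_negLog (hΨ1 _), hΨ]
      have e := lintegral_map (μ := Pr) (hjm j) (N.measurable_Z (.mark j))
      rw [N.law_Z] at e
      exact e.symm
    simp_rw [hfin] at hl
    exact tendsto_nhds_unique hl (tendsto_prod_expNeg _)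
  rw [h1]
  simp_rw [h2]
  have := N.isPoisson.lintegral_expNeg_tsum P.lam_pos N.measurable_X
    (measurable_negLog.comp hΨm)
  simp only [Function.comp_apply, expNeg_negLog (hΨ1 _)] at this
  exact this

end MeanFieldNetwork

/-! ### Moments of the success probability -/

namespace NetworkParams
variable {P : NetworkParams}

/-- Loss that an interferer at normalised area `z.1` with success probability `z.2` causes to the
typical link. -/
def loss (P : NetworkParams) (z : ℝ × ℝ) : ℝ := P.txProb z.2 * P.lossKernel z.1

/-- Intensity, up to the factor `spatialConst`, of the interferers in the coordinates normalised
area and success probability. -/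
def lossMeasure (ν : Measure ℝ) : Measure (ℝ × ℝ) :=
  (volume.restrict (Ioi 0)).prod (ν.restrict (Icc 0 1))

lemma measurable_loss : Measurable P.loss :=
  (measurable_txProb.comp measurable_snd).mul (measurable_lossKernel.comp measurable_fst)

lemma ae_lossMeasure (ν : Measure ℝ) [SFinite ν] :
    ∀ᵐ z ∂lossMeasure ν, 0 < z.1 ∧ z.2 ∈ Icc (0 : ℝ) 1 := by
  have h1 : ∀ᵐ v ∂(volume.restrict (Ioi (0 : ℝ))), 0 < v := ae_restrict_mem measurableSet_Ioi
  have h2 : ∀ᵐ t ∂(ν.restrict (Icc 0 1)), t ∈ Icc (0 : ℝ) 1 := ae_restrict_mem measurableSet_Icc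
  exact (Measure.quasiMeasurePreserving_fst.ae h1).and (Measure.quasiMeasurePreserving_snd.ae h2)

lemma ae_loss_mem (ν : Measure ℝ) [SFinite ν] : ∀ᵐ z ∂lossMeasure ν, P.loss z ∈ Ioc (0 : ℝ) P.p := by
  filter_upwards [ae_lossMeasure ν] with z hz
  exact txProb_mul_lossKernel_mem hz.2 hz.1.le

lemma integrableOn_lossKernel : IntegrableOn P.lossKernel (Ioi 0) := by
  have hα : 1 < P.alpha / 2 := by linarith [P.two_lt_alpha]
  rw [← Ioc_union_Ioi_eq_Ioi (zero_le_one (α := ℝ))]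
  refine IntegrableOn.union ?_ ?_
  · refine Measure.integrableOn_of_bounded (M := 1) (by simp)
      measurable_lossKernel.aestronglyMeasurable ?_
    filter_upwards [ae_restrict_mem measurableSet_Ioc] with v hv
    rw [Real.norm_of_nonneg (lossKernel_pos hv.1.le).le]
    exact lossKernel_le_one hv.1.le
  · refine (integrableOn_Ioi_rpow_of_lt (neg_lt_neg hα) one_pos).mono'
      measurable_lossKernel.aestronglyMeasurable ?_
    filter_upwards [ae_restrict_mem measurableSet_Ioi] with v hv
    have hv0 : 0 < v := one_pos.trans hv
    have := Real.rpow_pos_of_pos hv0 (P.alpha / 2)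
    rw [Real.norm_of_nonneg (lossKernel_pos hv0.le).le, lossKernel, Real.rpow_neg hv0.le, ← one_div]
    exact one_div_le_one_div_of_le this (by linarith)

lemma integrable_loss (ν : Measure ℝ) [IsFiniteMeasure ν] : Integrable P.loss (lossMeasure ν) := by
  have h : Integrable P.txProb (ν.restrict (Icc 0 1)) := by
    refine Integrable.of_bound measurable_txProb.aestronglyMeasurable P.p ?_
    filter_upwards [ae_restrict_mem measurableSet_Icc] with t ht
    rw [Real.norm_of_nonneg (txProb_pos ht).le]
    exact txProb_le ht
  have := integrableOn_lossKernel (P := P) |>.mul_prod h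
  exact this.congr (ae_of_all _ fun z => mul_comm _ _)

lemma integrable_loss_pow (ν : Measure ℝ) [IsFiniteMeasure ν] (k : ℕ) :
    Integrable (fun z => P.loss z ^ (k + 1)) (lossMeasure ν) := by
  refine (integrable_loss (P := P) ν).mono' (measurable_loss.pow_const _).aestronglyMeasurable ?_
  filter_upwards [ae_loss_mem (P := P) ν] with z hz
  rw [Real.norm_of_nonneg (pow_nonneg hz.1.le _), pow_succ]
  exact mul_le_of_le_one_left hz.1.le (pow_le_one₀ hz.1.le (hz.2.trans P.p_lt_one.le))

lemma eta_eq (ν : Measure ℝ) [SFinite ν] (k : ℕ) :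
    P.eta ν k = (-1) ^ (k + 1) * ∫ z, P.loss z ^ k ∂lossMeasure ν := by
  have h : ∀ z : ℝ × ℝ, P.loss z ^ k = P.lossKernel z.1 ^ k * P.txProb z.2 ^ k := fun z => by
    rw [loss, mul_pow, mul_comm]
  simp_rw [h]
  have h1 : ∀ v, (-1 : ℝ) ^ (k + 1) / (1 + v ^ (P.alpha / 2)) ^ k =
      (-1) ^ (k + 1) * P.lossKernel v ^ k := fun v => by
    rw [lossKernel, div_pow, one_pow, mul_one_div]
  have h2 : ∀ t, (P.p * P.xi) ^ k / (P.xi + (1 - P.xi) * P.p * t) ^ k = P.txProb t ^ k := fun t => by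
    rw [txProb, div_pow]
  rw [lossMeasure, integral_prod_mul (fun v => P.lossKernel v ^ k) (fun t => P.txProb t ^ k), eta,
    ← mul_assoc]
  simp_rw [h1, h2]
  rw [integral_const_mul]

lemma neg_log_one_sub_le {x : ℝ} (hx : x ∈ Ioc (0 : ℝ) P.p) :
    -Real.log (1 - x) ≤ x / (1 - P.p) := by
  have hp := P.p_lt_one
  have h1 : 0 < 1 - x := by linarith [hx.2]
  have h2 := Real.one_sub_inv_le_log_of_pos h1
  have h3 : (1 - x)⁻¹ - 1 = x / (1 - x) := by field_simp; ring
  calc -Real.log (1 - x) ≤ x / (1 - x) := by linarith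
    _ ≤ x / (1 - P.p) := div_le_div_of_nonneg_left hx.1.le (by linarith) (by linarith [hx.2])

lemma one_sub_rpow_mem {x s : ℝ} (hx : x ∈ Ioc (0 : ℝ) P.p) (hs : 0 ≤ s) :
    1 - (1 - x) ^ s ∈ Icc 0 (s * (x / (1 - P.p))) := by
  have h1 : 0 < 1 - x := by linarith [hx.2, P.p_lt_one]
  refine ⟨by linarith [Real.rpow_le_one h1.le (by linarith [hx.1]) hs], ?_⟩
  rw [Real.rpow_def_of_pos h1]
  have h2 := Real.add_one_le_exp (Real.log (1 - x) * s)
  have h3 := mul_le_mul_of_nonneg_left (neg_log_one_sub_le hx) hs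
  nlinarith

/-- The exponent in the Mellin transform of the success probability, up to `spatialConst`. -/
def lossExponent (P : NetworkParams) (ν : Measure ℝ) (s : ℝ) : ℝ :=
  ∫ z, (1 - (1 - P.loss z) ^ s) ∂lossMeasure ν

lemma integrable_one_sub_rpow (ν : Measure ℝ) [IsFiniteMeasure ν] {s : ℝ} (hs : 0 ≤ s) :
    Integrable (fun z => 1 - (1 - P.loss z) ^ s) (lossMeasure ν) := by
  refine ((integrable_loss (P := P) ν).div_const (1 - P.p) |>.const_mul s).mono'
    (measurable_const.sub ((measurable_const.sub measurable_loss).pow_const s)).aestronglyMeasurable ?_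
  filter_upwards [ae_loss_mem (P := P) ν] with z hz
  have := one_sub_rpow_mem hz hs
  rw [Real.norm_of_nonneg this.1]
  exact this.2

lemma lossExponent_nonneg (ν : Measure ℝ) [IsFiniteMeasure ν] {s : ℝ} (hs : 0 ≤ s) :
    0 ≤ P.lossExponent ν s := by
  refine integral_nonneg_of_ae ?_
  filter_upwards [ae_loss_mem (P := P) ν] with z hz using (one_sub_rpow_mem hz hs).1

lemma lossExponent_le (ν : Measure ℝ) [IsFiniteMeasure ν] {s : ℝ} (hs : 0 ≤ s) :
    P.lossExponent ν s ≤ s * ∫ z, P.loss z / (1 - P.p) ∂lossMeasure ν := by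
  rw [lossExponent, ← integral_const_mul]
  refine integral_mono_ae (integrable_one_sub_rpow ν hs)
    (((integrable_loss ν).div_const _).const_mul s) ?_
  filter_upwards [ae_loss_mem (P := P) ν] with z hz using (one_sub_rpow_mem hz hs).2

lemma lossExponent_natCast (ν : Measure ℝ) [IsFiniteMeasure ν] (m : ℕ) :
    P.lossExponent ν m = ∑ k ∈ Finset.Icc 1 m, (m.choose k : ℝ) * P.eta ν k := by
  have h : ∀ z, 1 - (1 - P.loss z) ^ (m : ℝ) =
      ∑ k ∈ Finset.Icc 1 m, (m.choose k : ℝ) * ((-1) ^ (k + 1) * P.loss z ^ k) := by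
    intro z
    rw [Real.rpow_natCast, sub_eq_add_neg 1 (P.loss z), add_comm, add_pow, Finset.range_eq_Ico,
      Finset.sum_eq_sum_Ico_succ_bot (by omega)]
    have : Finset.Ico (0 + 1) (m + 1) = Finset.Icc 1 m := by ext; simp [Nat.one_le_iff_ne_zero]
    rw [this]
    simp only [pow_zero, one_pow, mul_one, Nat.choose_zero_right, Nat.cast_one]
    rw [sub_add_cancel_left, ← Finset.sum_neg_distrib]
    refine Finset.sum_congr rfl fun k _ => ?_
    rw [neg_pow, pow_succ]; ring
  rw [lossExponent]
  simp_rw [h]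
  rw [integral_finsetSum]
  · refine Finset.sum_congr rfl fun k _ => ?_
    rw [integral_const_mul, integral_const_mul, eta_eq]
  · intro k hk
    obtain ⟨k, rfl⟩ := Nat.exists_eq_succ_of_ne_zero (n := k) (by have := Finset.mem_Icc.1 hk; omega)
    exact ((integrable_loss_pow ν k).const_mul _).const_mul _

lemma moment_eta (ν : Measure ℝ) [IsFiniteMeasure ν] (m : ℕ) :
    P.moment (P.eta ν) m =
      Real.exp (-(m * P.noise) - P.spatialConst * P.lossExponent ν m) := by
  rw [moment, lossExponent_natCast, noise]
  congr 3; ring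

end NetworkParams

namespace MeanFieldNetwork
variable {P : NetworkParams} {ν : Measure ℝ} {Ω : Type*} [MeasurableSpace Ω] {Pr : Measure Ω}

/-- The negative logarithm of the conditional success probability of the typical link without
noise. It is almost surely finite, see `ae_totalLoss_ne_top`. -/
def totalLoss (N : MeanFieldNetwork P ν Pr) (ω : Ω) : ℝ≥0∞ :=
  ∑' j, ENNReal.ofReal (P.logLoss (N.config ω j))

lemma measurable_totalLoss (N : MeanFieldNetwork P ν Pr) : Measurable N.totalLoss :=
  Measurable.tsum fun j => (NetworkParams.measurable_logLoss.comp
    ((measurable_pi_apply j).comp N.measurable_config)).ennreal_ofReal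

/-- Logarithm of the conditional success probability of the typical link; meaningful where
`totalLoss` is finite. -/
def logSuccess (N : MeanFieldNetwork P ν Pr) (ω : Ω) : ℝ := -(P.noise + (N.totalLoss ω).toReal)

lemma measurable_logSuccess (N : MeanFieldNetwork P ν Pr) : Measurable N.logSuccess :=
  (N.measurable_totalLoss.ennreal_toReal.const_add _).neg

lemma logSuccess_neg (N : MeanFieldNetwork P ν Pr) (ω : Ω) : N.logSuccess ω < 0 := by
  have := P.noise_pos
  have := ENNReal.toReal_nonneg (a := N.totalLoss ω)
  rw [logSuccess]; linarith

variable [IsProbabilityMeasure Pr] [IsProbabilityMeasure ν]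

lemma successProb_ae_eq_expNeg (N : MeanFieldNetwork P ν Pr) (hν : ν (Icc 0 1) = 1) (t : ℕ) :
    N.successProb t =ᵐ[Pr] fun ω => (expNeg (ENNReal.ofReal P.noise + N.totalLoss ω)).toReal := by
  filter_upwards [N.successProb_ae_eq t, N.ae_marks_mem hν] with ω h1 h2
  rw [h1, Measure.real, N.measure_decodes t h2, totalLoss]

/-- The Laplace functional, evaluated at `s * logLoss` and written in the coordinates normalised area
and success probability. -/
lemma lintegral_expNeg_totalLoss (N : MeanFieldNetwork P ν Pr) (hν : ν (Icc 0 1) = 1) {s : ℝ}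
    (hs : 0 ≤ s) :
    ∫⁻ ω, expNeg (ENNReal.ofReal s * N.totalLoss ω) ∂Pr =
      ENNReal.ofReal (Real.exp (-(P.spatialConst * P.lossExponent ν s))) := by
  have hres : ν.restrict (Icc 0 1) = ν :=
    Measure.restrict_eq_self_of_ae_mem ((prob_compl_eq_zero_iff measurableSet_Icc).2 hν)
  have hae : ∀ᵐ t ∂ν, t ∈ Icc (0 : ℝ) 1 := (prob_compl_eq_zero_iff measurableSet_Icc).2 hν
  set F : Plane × ℝ → ℝ≥0∞ := fun z => ENNReal.ofReal s * ENNReal.ofReal (P.logLoss z) with hF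
  have hFm : Measurable F := NetworkParams.measurable_logLoss.ennreal_ofReal.const_mul _
  set h : ℝ → ℝ≥0∞ := fun v => ∫⁻ t, ENNReal.ofReal (1 - (1 - P.loss (v, t)) ^ s) ∂ν with hh
  have hlm : Measurable fun z => ENNReal.ofReal (1 - (1 - P.loss z) ^ s) :=
    (measurable_const.sub ((measurable_const.sub NetworkParams.measurable_loss).pow_const s)).ennreal_ofReal
  have hhm : Measurable h := hlm.lintegral_prod_right'
  have h1 : ∀ x : Plane, 1 - ∫⁻ t, expNeg (F (x, t)) ∂ν = h (P.normArea x) := by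
    intro x
    have hm : Measurable fun t => expNeg (F (x, t)) :=
      measurable_expNeg.comp (hFm.comp measurable_prodMk_left)
    rw [show (1 : ℝ≥0∞) = ∫⁻ _, 1 ∂ν by simp, ← lintegral_sub hm
      (((lintegral_mono fun t => expNeg_le_one (F (x, t))).trans_lt (by simp)).ne)
      (ae_of_all _ fun t => expNeg_le_one _), hh]
    refine lintegral_congr_ae ?_
    filter_upwards [hae] with t ht
    have hl := NetworkParams.txProb_mul_lossKernel_mem (P := P) ht
      (NetworkParams.normArea_nonneg (P := P) x)
    have hpos : 0 < 1 - P.txProb t * P.lossKernel (P.normArea x) := by linarith [hl.2, P.p_lt_one]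
    have hl0 := NetworkParams.logLoss_nonneg (P := P) (z := (x, t)) ht
    rw [hF]
    simp only
    rw [← ENNReal.ofReal_mul hs, expNeg_ofReal (mul_nonneg hs hl0), ← ENNReal.ofReal_one,
      ← ENNReal.ofReal_sub _ (Real.exp_nonneg _), NetworkParams.loss, Real.rpow_def_of_pos hpos,
      NetworkParams.logLoss]
    congr 3; ring
  have h2 : ∫⁻ x : Plane, h (P.normArea x) =
      ENNReal.ofReal (Real.pi * (P.r ^ 2 * P.theta ^ P.delta)) *
        ENNReal.ofReal (P.lossExponent ν s) := by
    rw [← lintegral_map hhm NetworkParams.measurable_normArea, NetworkParams.map_normArea,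
      lintegral_smul_measure, smul_eq_mul, NetworkParams.lossExponent,
      ofReal_integral_eq_lintegral_ofReal (NetworkParams.integrable_one_sub_rpow ν hs) (by
        filter_upwards [NetworkParams.ae_loss_mem (P := P) ν] with z hz
          using (NetworkParams.one_sub_rpow_mem hz hs).1),
      NetworkParams.lossMeasure, hres, lintegral_prod _ hlm.aemeasurable]
  have h3 := N.lintegral_expNeg_tsum_config hFm
  simp_rw [h1, h2, hF, ENNReal.tsum_mul_left] at h3
  have hK : 0 ≤ Real.pi * (P.r ^ 2 * P.theta ^ P.delta) := by
    have := P.r_pos; have := Real.rpow_pos_of_pos P.theta_pos P.delta; positivity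
  refine h3.trans ?_
  rw [← mul_assoc, ← ENNReal.ofReal_mul P.lam_pos.le, ← ENNReal.ofReal_mul
    (mul_nonneg P.lam_pos.le hK), show P.lam * (Real.pi * (P.r ^ 2 * P.theta ^ P.delta)) =
      P.spatialConst by rw [NetworkParams.spatialConst]; ring,
    expNeg_ofReal (mul_nonneg NetworkParams.spatialConst_pos.le
      (NetworkParams.lossExponent_nonneg ν hs))]

lemma tendsto_mul_one_sub_expNeg (x : ℝ≥0∞) :
    Tendsto (fun n : ℕ => (n : ℝ≥0∞) * (1 - expNeg (ENNReal.ofReal (n : ℝ)⁻¹ * x))) atTop (𝓝 x) := by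
  rcases eq_or_ne x ⊤ with rfl | hx
  · refine (ENNReal.tendsto_nat_nhds_top).congr' ?_
    filter_upwards [eventually_gt_atTop 0] with n hn
    rw [ENNReal.mul_top (by simpa using hn.ne'), expNeg_top, tsub_zero, mul_one]
  · obtain ⟨r, hr, rfl⟩ : ∃ r : ℝ, 0 ≤ r ∧ ENNReal.ofReal r = x :=
      ⟨x.toReal, ENNReal.toReal_nonneg, ENNReal.ofReal_toReal hx⟩
    have hd : HasDerivAt (fun s : ℝ => 1 - Real.exp (-(s * r))) r 0 := by
      have := (((hasDerivAt_id (0 : ℝ)).mul_const r).neg.exp).const_sub 1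
      simpa using this
    have h0 := hd.tendsto_slope_zero_right.comp
      (tendsto_inv_atTop_nhdsGT_zero.comp (tendsto_natCast_atTop_atTop (R := ℝ)))
    have h1 := (ENNReal.continuous_ofReal.tendsto r).comp h0
    refine h1.congr' ?_
    filter_upwards [eventually_gt_atTop 0] with n hn
    have hn' : (0 : ℝ) < n := by exact_mod_cast hn
    simp only [Function.comp_apply, zero_add, zero_mul, neg_zero, Real.exp_zero, sub_self, sub_zero,
      smul_eq_mul, inv_inv]
    rw [← ENNReal.ofReal_mul (by positivity), expNeg_ofReal (by positivity), ← ENNReal.ofReal_one,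
      ← ENNReal.ofReal_sub _ (Real.exp_nonneg _), ENNReal.ofReal_mul hn'.le, ENNReal.ofReal_natCast]

/-- The mean of the total loss is the limit of `n * (1 - E (expNeg (totalLoss / n)))`, and
`lossExponent` is at most linear. -/
lemma lintegral_totalLoss_ne_top (N : MeanFieldNetwork P ν Pr) (hν : ν (Icc 0 1) = 1) :
    ∫⁻ ω, N.totalLoss ω ∂Pr ≠ ⊤ := by
  set K := P.spatialConst * ∫ z, P.loss z / (1 - P.p) ∂NetworkParams.lossMeasure ν with hK
  refine ne_top_of_le_ne_top (ENNReal.ofReal_ne_top (r := K)) ?_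
  have hm : ∀ n : ℕ, Measurable fun ω =>
      (n : ℝ≥0∞) * (1 - expNeg (ENNReal.ofReal (n : ℝ)⁻¹ * N.totalLoss ω)) := fun n =>
    (measurable_const.sub (measurable_expNeg.comp (N.measurable_totalLoss.const_mul _))).const_mul _
  have hle : ∀ n : ℕ, ∫⁻ ω, (n : ℝ≥0∞) * (1 - expNeg (ENNReal.ofReal (n : ℝ)⁻¹ * N.totalLoss ω)) ∂Pr
      ≤ ENNReal.ofReal K := by
    intro n
    have hn : 0 ≤ (n : ℝ)⁻¹ := by positivity
    have hmn : Measurable fun ω => expNeg (ENNReal.ofReal (n : ℝ)⁻¹ * N.totalLoss ω) :=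
      measurable_expNeg.comp (N.measurable_totalLoss.const_mul _)
    have hmn' : Measurable fun ω => 1 - expNeg (ENNReal.ofReal (n : ℝ)⁻¹ * N.totalLoss ω) :=
      measurable_const.sub hmn
    rw [lintegral_const_mul _ hmn', lintegral_sub hmn
      (((lintegral_mono fun t => expNeg_le_one _).trans_lt (by simp)).ne)
      (ae_of_all _ fun t => expNeg_le_one _)]
    rw [N.lintegral_expNeg_totalLoss hν hn, lintegral_one, measure_univ, ← ENNReal.ofReal_one,
      ← ENNReal.ofReal_sub _ (Real.exp_nonneg _), ← ENNReal.ofReal_natCast,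
      ← ENNReal.ofReal_mul (by positivity)]
    refine ENNReal.ofReal_le_ofReal ?_
    have h1 := Real.add_one_le_exp (-(P.spatialConst * P.lossExponent ν (n : ℝ)⁻¹))
    have h2 := mul_le_mul_of_nonneg_left (NetworkParams.lossExponent_le (P := P) ν hn)
      (NetworkParams.spatialConst_pos (P := P)).le
    have h4 : 0 ≤ K := mul_nonneg NetworkParams.spatialConst_pos.le (integral_nonneg_of_ae (by
      filter_upwards [NetworkParams.ae_loss_mem (P := P) ν] with z hz
        using div_nonneg hz.1.le (by linarith [P.p_lt_one])))
    calc (n : ℝ) * (1 - Real.exp (-(P.spatialConst * P.lossExponent ν (n : ℝ)⁻¹)))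
        ≤ n * ((n : ℝ)⁻¹ * K) := by
          refine mul_le_mul_of_nonneg_left ?_ (by positivity)
          rw [hK]; linarith
      _ ≤ K := by
          rw [← mul_assoc]
          exact mul_le_of_le_one_left h4 (mul_inv_le_one)
  calc ∫⁻ ω, N.totalLoss ω ∂Pr
      = ∫⁻ ω, liminf (fun n : ℕ =>
        (n : ℝ≥0∞) * (1 - expNeg (ENNReal.ofReal (n : ℝ)⁻¹ * N.totalLoss ω))) atTop ∂Pr :=
        lintegral_congr fun ω => (tendsto_mul_one_sub_expNeg _).liminf_eq.symm
    _ ≤ liminf (fun n : ℕ => ∫⁻ ω,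
        (n : ℝ≥0∞) * (1 - expNeg (ENNReal.ofReal (n : ℝ)⁻¹ * N.totalLoss ω)) ∂Pr) atTop :=
        lintegral_liminf_le hm
    _ ≤ ENNReal.ofReal K := by
        refine liminf_le_of_le (by isBoundedDefault) fun b hb => ?_
        obtain ⟨n, hn⟩ := hb.exists
        exact hn.trans (hle n)

lemma ae_totalLoss_ne_top (N : MeanFieldNetwork P ν Pr) (hν : ν (Icc 0 1) = 1) :
    ∀ᵐ ω ∂Pr, N.totalLoss ω ≠ ⊤ :=
  (ae_lt_top N.measurable_totalLoss (N.lintegral_totalLoss_ne_top hν)).mono fun _ h => h.ne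

lemma integrable_logSuccess (N : MeanFieldNetwork P ν Pr) (hν : ν (Icc 0 1) = 1) :
    Integrable N.logSuccess Pr :=
  ((integrable_const _).add (integrable_toReal_of_lintegral_ne_top
    N.measurable_totalLoss.aemeasurable (N.lintegral_totalLoss_ne_top hν))).neg

lemma successProb_ae_eq_exp (N : MeanFieldNetwork P ν Pr) (hν : ν (Icc 0 1) = 1) (t : ℕ) :
    N.successProb t =ᵐ[Pr] fun ω => Real.exp (N.logSuccess ω) := by
  filter_upwards [N.successProb_ae_eq_expNeg hν t, N.ae_totalLoss_ne_top hν] with ω h1 h2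
  rw [h1, logSuccess, ← ENNReal.ofReal_toReal h2, ← ENNReal.ofReal_add P.noise_pos.le
    ENNReal.toReal_nonneg, expNeg_ofReal (add_nonneg P.noise_pos.le
    ENNReal.toReal_nonneg), ENNReal.toReal_ofReal (Real.exp_nonneg _),
    ENNReal.toReal_ofReal ENNReal.toReal_nonneg]

/-- The Mellin transform of the success probability on the nonnegative reals. -/
lemma mgf_logSuccess (N : MeanFieldNetwork P ν Pr) (hν : ν (Icc 0 1) = 1) {s : ℝ} (hs : 0 ≤ s) :
    mgf N.logSuccess Pr s =
      Real.exp (-(s * P.noise) - P.spatialConst * P.lossExponent ν s) := by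
  have h1 : (fun ω => Real.exp (s * N.logSuccess ω)) =ᵐ[Pr] fun ω =>
      Real.exp (-(s * P.noise)) * (expNeg (ENNReal.ofReal s * N.totalLoss ω)).toReal := by
    filter_upwards [N.ae_totalLoss_ne_top hν] with ω h
    obtain ⟨r, hr, hr'⟩ : ∃ r : ℝ, 0 ≤ r ∧ ENNReal.ofReal r = N.totalLoss ω :=
      ⟨_, ENNReal.toReal_nonneg, ENNReal.ofReal_toReal h⟩
    rw [logSuccess, ← hr', ENNReal.toReal_ofReal hr, ← ENNReal.ofReal_mul hs,
      expNeg_ofReal (mul_nonneg hs hr), ENNReal.toReal_ofReal (Real.exp_nonneg _), ← Real.exp_add]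
    congr 1; ring
  have hm : Measurable fun ω => expNeg (ENNReal.ofReal s * N.totalLoss ω) :=
    measurable_expNeg.comp (N.measurable_totalLoss.const_mul _)
  rw [mgf, integral_congr_ae h1, integral_const_mul, integral_toReal hm.aemeasurable
    (ae_of_all _ fun ω => (expNeg_ne_top _).lt_top), N.lintegral_expNeg_totalLoss hν hs,
    ENNReal.toReal_ofReal (Real.exp_nonneg _), ← Real.exp_add]
  rfl

theorem integral_successProb_pow (N : MeanFieldNetwork P ν Pr) (hν : ν (Icc 0 1) = 1) (t m : ℕ) :
    ∫ ω, N.successProb t ω ^ m ∂Pr = P.moment (P.eta ν) m := by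
  rw [NetworkParams.moment_eta, ← N.mgf_logSuccess hν (Nat.cast_nonneg m), mgf]
  refine integral_congr_ae ?_
  filter_upwards [N.successProb_ae_eq_exp hν t] with ω h
  rw [h, ← Real.exp_nat_mul]

end MeanFieldNetwork

/-! ### Gil-Pelaez inversion -/

section Inversion

lemma integrableOn_exp_neg_mul {ε : ℝ} (hε : 0 < ε) :
    IntegrableOn (fun w : ℝ => Real.exp (-ε * w)) (Ioi 0) := exp_neg_integrableOn_Ioi 0 hε

lemma integral_exp_neg_mul_cos {ε : ℝ} (hε : 0 < ε) (x : ℝ) :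
    ∫ w in Ioi (0 : ℝ), Real.exp (-ε * w) * Real.cos (w * x) = ε / (ε ^ 2 + x ^ 2) := by
  set a : ℂ := ⟨-ε, x⟩ with ha
  have ha0 : a.re < 0 := by simpa [ha] using hε
  have hint : IntegrableOn (fun w : ℝ => Complex.exp (a * w)) (Ioi 0) :=
    integrableOn_exp_mul_complex_Ioi ha0 0
  have h := integral_exp_mul_complex_Ioi ha0 0
  have hre := congrArg Complex.re h
  rw [← RCLike.re_eq_complex_re, ← integral_re hint] at hre
  have h1 : ∀ w : ℝ, RCLike.re (Complex.exp (a * w)) = Real.exp (-ε * w) * Real.cos (w * x) := by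
    intro w
    rw [RCLike.re_eq_complex_re, Complex.exp_re]
    simp [ha, mul_comm]
  simp_rw [h1] at hre
  rw [hre]
  simp [ha, Complex.inv_re, Complex.normSq_apply, neg_div]
  ring

/-- The Laplace transform of the cardinal sine. -/
lemma integral_exp_neg_mul_sin_div {ε : ℝ} (hε : 0 < ε) (x : ℝ) :
    ∫ w in Ioi (0 : ℝ), Real.exp (-ε * w) * (Real.sin (w * x) / w) = Real.arctan (x / ε) := by
  set A : ℝ → ℝ := fun x => ∫ w in Ioi (0 : ℝ), Real.exp (-ε * w) * (Real.sin (w * x) / w) with hA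
  have hm : ∀ y, AEStronglyMeasurable (fun w => Real.exp (-ε * w) * (Real.sin (w * y) / w))
      (volume.restrict (Ioi 0)) := fun y =>
    (Measurable.mul (by fun_prop) (Measurable.div (by fun_prop) measurable_id)).aestronglyMeasurable
  have hd : ∀ y, HasDerivAt A (ε / (ε ^ 2 + y ^ 2)) y := by
    intro y
    rw [← integral_exp_neg_mul_cos hε]
    refine (hasDerivAt_integral_of_dominated_loc_of_deriv_le (s := univ)
      (F := fun y w => Real.exp (-ε * w) * (Real.sin (w * y) / w))
      (F' := fun y w => Real.exp (-ε * w) * Real.cos (w * y)) (bound := fun w =>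
      Real.exp (-ε * w)) univ_mem (Eventually.of_forall hm) ?_ ?_ ?_
      (integrableOn_exp_neg_mul hε) ?_).2
    · refine ((integrableOn_exp_neg_mul hε).mul_const |y|).mono' (hm y) ?_
      filter_upwards [ae_restrict_mem measurableSet_Ioi] with w hw
      have hw : 0 < w := hw
      rw [norm_mul, Real.norm_eq_abs, Real.norm_eq_abs, Real.abs_exp, abs_div, abs_of_pos hw]
      refine mul_le_mul_of_nonneg_left ?_ (Real.exp_nonneg _)
      rw [div_le_iff₀ hw]
      calc |Real.sin (w * y)| ≤ |w * y| := Real.abs_sin_le_abs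
        _ = |y| * w := by rw [abs_mul, abs_of_pos hw, mul_comm]
    · exact (Measurable.aestronglyMeasurable (by fun_prop))
    · refine ae_of_all _ fun w z _ => ?_
      rw [norm_mul, Real.norm_eq_abs, Real.norm_eq_abs, Real.abs_exp]
      exact mul_le_of_le_one_right (Real.exp_nonneg _) (Real.abs_cos_le_one _)
    · filter_upwards [ae_restrict_mem measurableSet_Ioi] with w hw z _
      have hw : w ≠ 0 := (show 0 < w from hw).ne'
      have := ((((hasDerivAt_id z).const_mul w).sin.div_const w).const_mul (Real.exp (-ε * w)))
      exact this.congr_deriv (by simp only [id]; field_simp)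
  have hd2 : ∀ y, HasDerivAt (fun y => A y - Real.arctan (y / ε)) 0 y := by
    intro y
    have h2 := ((hasDerivAt_id y).div_const ε).arctan
    have h3 := (hd y).sub h2
    exact h3.congr_deriv (by simp only [id]; field_simp; ring)
  have hc := is_const_of_deriv_eq_zero (fun y => (hd2 y).differentiableAt)
    (fun y => (hd2 y).deriv) x 0
  have h0 : A 0 = 0 := by simp [hA]
  simp only [h0, zero_div, Real.arctan_zero, sub_zero] at hc
  linarith

variable {Ω : Type*} [MeasurableSpace Ω] {Pr : Measure Ω} [IsProbabilityMeasure Pr]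

lemma measurable_integral_comp_mul {D : Ω → ℝ} (hD : Measurable D) {g : ℝ → ℝ} (hg : Measurable g) :
    Measurable fun w : ℝ => ∫ ω, g (w * D ω) ∂Pr := by
  have : Measurable fun q : ℝ × Ω => g (q.1 * D q.2) :=
    hg.comp (measurable_fst.mul (hD.comp measurable_snd))
  exact (this.stronglyMeasurable.integral_prod_right).measurable

/-- A random variable whose characteristic function has an integrable real part has no atom at zero:
smooth the integral by `exp (-ε w)`, which tests the law against `ε / (ε ^ 2 + x ^ 2)`, and let
`ε` tend to zero. -/
lemma measure_eq_zero_of_integrableOn_cos {D : Ω → ℝ} (hD : Measurable D)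
    (hcos : IntegrableOn (fun w => ∫ ω, Real.cos (w * D ω) ∂Pr) (Ioi 0)) : Pr {ω | D ω = 0} = 0 := by
  have hset : MeasurableSet {ω | D ω = 0} := hD (measurableSet_singleton 0)
  set I := ∫ w in Ioi (0 : ℝ), ‖∫ ω, Real.cos (w * D ω) ∂Pr‖ with hI
  have key : ∀ ε : ℝ, 0 < ε → Pr.real {ω | D ω = 0} ≤ ε * I := by
    intro ε hε
    have hint : Integrable (fun q : ℝ × Ω => Real.exp (-ε * q.1) * Real.cos (q.1 * D q.2))
        ((volume.restrict (Ioi 0)).prod Pr) := by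
      have h1 : Integrable (fun q : ℝ × Ω => Real.exp (-ε * q.1) * 1)
          ((volume.restrict (Ioi 0)).prod Pr) :=
        (integrableOn_exp_neg_mul hε).mul_prod (integrable_const (1 : ℝ))
      refine h1.mono' (Measurable.aestronglyMeasurable ?_) (ae_of_all _ fun q => ?_)
      · exact Measurable.mul (by fun_prop)
          (Real.measurable_cos.comp (measurable_fst.mul (hD.comp measurable_snd)))
      · rw [norm_mul, Real.norm_eq_abs, Real.norm_eq_abs, Real.abs_exp]
        exact mul_le_mul_of_nonneg_left (Real.abs_cos_le_one _) (Real.exp_nonneg _)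
    have hswap := integral_integral_swap
      (f := fun w ω => Real.exp (-ε * w) * Real.cos (w * D ω)) hint
    have hD2 : Integrable (fun ω => ε / (ε ^ 2 + D ω ^ 2)) Pr := by
      refine Integrable.of_bound (Measurable.aestronglyMeasurable (by fun_prop)) (1 / ε)
        (ae_of_all _ fun ω => ?_)
      rw [Real.norm_of_nonneg (by positivity), div_le_div_iff₀ (by positivity) hε]
      nlinarith [sq_nonneg (D ω)]
    have hle : Pr.real {ω | D ω = 0} * (1 / ε) ≤ ∫ ω, ε / (ε ^ 2 + D ω ^ 2) ∂Pr := by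
      rw [← smul_eq_mul, ← setIntegral_const, ← integral_indicator hset]
      refine integral_mono ((integrable_const _).indicator hset) hD2 fun ω => ?_
      by_cases h : D ω = 0
      · rw [Set.indicator_of_mem (by exact h), h]
        apply le_of_eq; field_simp; ring
      · rw [Set.indicator_of_notMem (by exact h)]; positivity
    have e1 : ∫ ω, ε / (ε ^ 2 + D ω ^ 2) ∂Pr =
        ∫ w in Ioi (0 : ℝ), Real.exp (-ε * w) * ∫ ω, Real.cos (w * D ω) ∂Pr := by
      simp_rw [← integral_exp_neg_mul_cos hε, ← integral_const_mul]
      exact hswap.symm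
    have e2 : ∫ w in Ioi (0 : ℝ), Real.exp (-ε * w) * ∫ ω, Real.cos (w * D ω) ∂Pr ≤ I := by
      refine (le_abs_self _).trans ((abs_integral_le_integral_abs).trans ?_)
      refine setIntegral_mono_on ?_ hcos.norm measurableSet_Ioi fun w hw => ?_
      · refine (hcos.norm.mono' (Measurable.aestronglyMeasurable ?_) ?_)
        · exact (Measurable.mul (by fun_prop)
            (measurable_integral_comp_mul hD Real.measurable_cos)).abs
        · filter_upwards [ae_restrict_mem measurableSet_Ioi] with w hw
          have hw : 0 < w := hw
          rw [norm_abs_eq_norm, norm_mul, Real.norm_eq_abs, Real.abs_exp]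
          exact mul_le_of_le_one_left (norm_nonneg _) (Real.exp_le_one_iff.2 (by nlinarith))
      · have hw : 0 < w := hw
        rw [abs_mul, Real.abs_exp]
        exact mul_le_of_le_one_left (abs_nonneg _) (Real.exp_le_one_iff.2 (by nlinarith))
    have := hle.trans (e1.le.trans e2)
    rw [mul_one_div, div_le_iff₀ hε] at this
    linarith
  have hlim : Tendsto (fun ε : ℝ => ε * I) (𝓝[>] 0) (𝓝 0) := by
    have : Tendsto (fun ε : ℝ => ε * I) (𝓝 0) (𝓝 (0 * I)) := tendsto_id.mul_const I
    rw [zero_mul] at this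
    exact this.mono_left nhdsWithin_le_nhds
  have h0 : Pr.real {ω | D ω = 0} ≤ 0 :=
    ge_of_tendsto hlim (by filter_upwards [self_mem_nhdsWithin] with ε hε using key ε hε)
  have := le_antisymm h0 measureReal_nonneg
  exact (measureReal_eq_zero_iff).1 this

/-- Inversion formula of Gil-Pelaez, in the form of an absolutely convergent integral. -/
lemma integral_integral_sin_div {D : Ω → ℝ} (hD : Measurable D) (hDi : Integrable D Pr)
    (hcos : IntegrableOn (fun w => ∫ ω, Real.cos (w * D ω) ∂Pr) (Ioi 0))
    (hsin : IntegrableOn (fun w => (∫ ω, Real.sin (w * D ω) ∂Pr) / w) (Ioi 0)) :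
    ∫ w in Ioi (0 : ℝ), (∫ ω, Real.sin (w * D ω) ∂Pr) / w =
      Real.pi / 2 * (1 - 2 * Pr.real {ω | D ω ≤ 0}) := by
  have h0 := measure_eq_zero_of_integrableOn_cos hD hcos
  set h : ℝ → ℝ := fun w => (∫ ω, Real.sin (w * D ω) ∂Pr) / w with hh
  have hhm : Measurable h := (measurable_integral_comp_mul hD Real.measurable_sin).div measurable_id
  let ε : ℕ → ℝ := fun n => 1 / ((n : ℝ) + 1)
  have hε : ∀ n, 0 < ε n := fun n => Nat.one_div_pos_of_nat
  have hε0 : Tendsto ε atTop (𝓝 0) := tendsto_one_div_add_atTop_nhds_zero_nat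
  -- the factor `exp (-ε w)` makes the double integral absolutely convergent; for `ε → 0` the arctangent
  -- tends to `π / 2` times the sign of `D`
  have hreg : ∀ n, ∫ w in Ioi (0 : ℝ), Real.exp (-ε n * w) * h w =
      ∫ ω, Real.arctan (D ω / ε n) ∂Pr := by
    intro n
    have hint : Integrable (fun q : ℝ × Ω => Real.exp (-ε n * q.1) * (Real.sin (q.1 * D q.2) / q.1))
        ((volume.restrict (Ioi 0)).prod Pr) := by
      have h1 : Integrable (fun q : ℝ × Ω => Real.exp (-ε n * q.1) * |D q.2|)
          ((volume.restrict (Ioi 0)).prod Pr) :=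
        (integrableOn_exp_neg_mul (hε n)).mul_prod hDi.abs
      refine h1.mono' (Measurable.aestronglyMeasurable ?_) ?_
      · exact Measurable.mul (by fun_prop) ((Real.measurable_sin.comp
          (measurable_fst.mul (hD.comp measurable_snd))).div measurable_fst)
      · have : ∀ᵐ w ∂(volume.restrict (Ioi (0 : ℝ))), 0 < w := ae_restrict_mem measurableSet_Ioi
        filter_upwards [Measure.quasiMeasurePreserving_fst.ae this] with q hq
        rw [norm_mul, Real.norm_eq_abs, Real.norm_eq_abs, Real.abs_exp, abs_div, abs_of_pos hq]
        refine mul_le_mul_of_nonneg_left ?_ (Real.exp_nonneg _)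
        rw [div_le_iff₀ hq]
        calc |Real.sin (q.1 * D q.2)| ≤ |q.1 * D q.2| := Real.abs_sin_le_abs
          _ = |D q.2| * q.1 := by rw [abs_mul, abs_of_pos hq, mul_comm]
    have hswap := integral_integral_swap
      (f := fun w ω => Real.exp (-ε n * w) * (Real.sin (w * D ω) / w)) hint
    simp_rw [← integral_exp_neg_mul_sin_div (hε n), hh, ← integral_div, ← integral_const_mul]
    exact hswap
  have hL : Tendsto (fun n => ∫ w in Ioi (0 : ℝ), Real.exp (-ε n * w) * h w) atTop
      (𝓝 (∫ w in Ioi (0 : ℝ), h w)) := by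
    refine tendsto_integral_of_dominated_convergence (fun w => ‖h w‖) (fun n => ?_) hsin.norm
      (fun n => ?_) (ae_of_all _ fun w => ?_)
    · exact (Measurable.mul (by fun_prop) hhm).aestronglyMeasurable
    · filter_upwards [ae_restrict_mem measurableSet_Ioi] with w hw
      have hw : 0 < w := hw
      rw [norm_mul, Real.norm_eq_abs, Real.abs_exp]
      exact mul_le_of_le_one_left (norm_nonneg _)
        (Real.exp_le_one_iff.2 (by nlinarith [hε n]))
    · have : Tendsto (fun n => Real.exp (-ε n * w) * h w) atTop (𝓝 (Real.exp (-0 * w) * h w)) :=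
        ((Real.continuous_exp.tendsto _).comp ((hε0.neg).mul_const w)).mul_const _
      simpa using this
  have hpos : MeasurableSet {ω | 0 < D ω} := measurableSet_lt measurable_const hD
  have hneg : MeasurableSet {ω | D ω ≤ 0} := measurableSet_le hD measurable_const
  have hR : Tendsto (fun n => ∫ ω, Real.arctan (D ω / ε n) ∂Pr) atTop
      (𝓝 (∫ ω, (Real.pi / 2 - {ω | D ω ≤ 0}.indicator (fun _ => Real.pi) ω) ∂Pr)) := by
    refine tendsto_integral_of_dominated_convergence (fun _ => Real.pi / 2) (fun n => ?_)
      (integrable_const _) (fun n => ae_of_all _ fun ω => ?_) ?_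
    · exact (Real.measurable_arctan.comp (hD.div_const _)).aestronglyMeasurable
    · rw [Real.norm_eq_abs, abs_le]
      exact ⟨(Real.neg_pi_div_two_lt_arctan _).le, (Real.arctan_lt_pi_div_two _).le⟩
    · have hne : ∀ᵐ ω ∂Pr, D ω ≠ 0 := by
        rw [ae_iff]; simpa using h0
      have hinv : Tendsto (fun n => (ε n)⁻¹) atTop atTop :=
        tendsto_inv_nhdsGT_zero.comp (tendsto_nhdsWithin_iff.2 ⟨hε0, Eventually.of_forall hε⟩)
      filter_upwards [hne] with ω hω
      simp_rw [div_eq_mul_inv (D ω)]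
      rcases lt_or_gt_of_ne hω with hlt | hgt
      · rw [Set.indicator_of_mem (by exact hlt.le)]
        have := (Real.tendsto_arctan_atBot.mono_right nhdsWithin_le_nhds).comp
          (hinv.const_mul_atTop_of_neg hlt)
        rw [show Real.pi / 2 - Real.pi = -(Real.pi / 2) by ring]
        exact this
      · rw [Set.indicator_of_notMem (by simpa using hgt)]
        have := (Real.tendsto_arctan_atTop.mono_right nhdsWithin_le_nhds).comp
          (hinv.const_mul_atTop hgt)
        rw [sub_zero]
        exact this
  simp_rw [hreg] at hL
  rw [tendsto_nhds_unique hL hR, integral_sub (integrable_const _)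
    ((integrable_const _).indicator hneg), integral_indicator hneg, setIntegral_const]
  simp
  ring

end Inversion

/-! ### The Mellin transform for complex exponents -/

namespace NetworkParams
variable {P : NetworkParams}

/-- Logarithm of the probability that an interferer does not destroy a transmission of the typical
link. -/
def logKeep (P : NetworkParams) (z : ℝ × ℝ) : ℝ := Real.log (1 - P.loss z)

lemma measurable_logKeep : Measurable P.logKeep :=
  Real.measurable_log.comp (measurable_const.sub measurable_loss)

/-- An upper bound for the absolute value of `logKeep`. -/
def logKeepBound (P : NetworkParams) : ℝ := P.p / (1 - P.p)

lemma logKeepBound_pos (P : NetworkParams) : 0 < P.logKeepBound :=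
  div_pos P.p_pos (by linarith [P.p_lt_one])

lemma ae_logKeep (ν : Measure ℝ) [SFinite ν] : ∀ᵐ z ∂lossMeasure ν,
    P.loss z ≤ |P.logKeep z| ∧ |P.logKeep z| ≤ P.loss z / (1 - P.p) ∧
      |P.logKeep z| ≤ P.logKeepBound := by
  filter_upwards [ae_loss_mem (P := P) ν] with z hz
  have h1 := neg_log_one_sub_le hz
  have hp := P.p_lt_one
  have h2 : Real.log (1 - P.loss z) ≤ (1 - P.loss z) - 1 :=
    Real.log_le_sub_one_of_pos (by linarith [hz.2])
  have h3 : |P.logKeep z| = -Real.log (1 - P.loss z) := by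
    rw [logKeep, abs_of_nonpos (by linarith [hz.1])]
  rw [h3]
  exact ⟨by linarith, h1, h1.trans (div_le_div_of_nonneg_right hz.2 (by linarith))⟩

/-- The exponent in the Mellin transform of the success probability, up to `spatialConst`, for
complex arguments. -/
def lossExponentC (P : NetworkParams) (ν : Measure ℝ) (z : ℂ) : ℂ :=
  ∫ y, (1 - Complex.exp (z * (P.logKeep y : ℂ))) ∂lossMeasure ν

lemma norm_one_sub_exp_le (z : ℂ) : ‖1 - Complex.exp z‖ ≤ ‖z‖ * Real.exp ‖z‖ := by
  have := Complex.norm_exp_sub_sum_le_norm_mul_exp z 1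
  rw [norm_sub_rev]
  simpa using this

lemma integrable_one_sub_exp (ν : Measure ℝ) [IsFiniteMeasure ν] (z : ℂ) :
    Integrable (fun y => 1 - Complex.exp (z * (P.logKeep y : ℂ))) (lossMeasure ν) := by
  have hm := measurable_logKeep (P := P)
  refine (((integrable_loss (P := P) ν).div_const (1 - P.p)).const_mul
    (‖z‖ * Real.exp (‖z‖ * P.logKeepBound))).mono' (Measurable.aestronglyMeasurable (by fun_prop)) ?_
  filter_upwards [ae_logKeep (P := P) ν] with y hy
  refine (norm_one_sub_exp_le _).trans ?_
  rw [norm_mul, Complex.norm_real, Real.norm_eq_abs]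
  calc ‖z‖ * |P.logKeep y| * Real.exp (‖z‖ * |P.logKeep y|)
      ≤ ‖z‖ * (P.loss y / (1 - P.p)) * Real.exp (‖z‖ * P.logKeepBound) := by
        have := (abs_nonneg _).trans hy.2.1
        gcongr
        · exact hy.2.1
        · exact hy.2.2
    _ = _ := by ring

lemma differentiable_lossExponentC (ν : Measure ℝ) [IsFiniteMeasure ν] :
    Differentiable ℂ (P.lossExponentC ν) := by
  intro z
  have hm := measurable_logKeep (P := P)
  refine (hasDerivAt_integral_of_dominated_loc_of_deriv_le (s := Metric.ball z 1)
    (F := fun z y => 1 - Complex.exp (z * (P.logKeep y : ℂ)))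
    (F' := fun z y => -((P.logKeep y : ℂ) * Complex.exp (z * (P.logKeep y : ℂ))))
    (bound := fun y => Real.exp ((‖z‖ + 1) * P.logKeepBound) * (P.loss y / (1 - P.p)))
    (Metric.ball_mem_nhds z one_pos) ?_ (integrable_one_sub_exp ν z) ?_ ?_
    (((integrable_loss (P := P) ν).div_const (1 - P.p)).const_mul _) ?_).2.differentiableAt
  · exact Eventually.of_forall fun w => Measurable.aestronglyMeasurable (by fun_prop)
  · exact Measurable.aestronglyMeasurable (by fun_prop)
  · filter_upwards [ae_logKeep (P := P) ν] with y hy w hw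
    rw [norm_neg, norm_mul, Complex.norm_real, Real.norm_eq_abs, mul_comm]
    have hw' : ‖w‖ ≤ ‖z‖ + 1 := by
      have := norm_sub_norm_le w z
      have h2 : ‖w - z‖ < 1 := by simpa [dist_eq_norm] using hw
      linarith
    refine mul_le_mul ((Complex.norm_exp_le_exp_norm _).trans (Real.exp_le_exp.2 ?_)) hy.2.1
      (abs_nonneg _) (Real.exp_nonneg _)
    rw [norm_mul, Complex.norm_real, Real.norm_eq_abs]
    exact mul_le_mul hw' hy.2.2 (abs_nonneg _) (by positivity)
  · refine ae_of_all _ fun y w _ => ?_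
    have := (((hasDerivAt_id w).mul_const (P.logKeep y : ℂ)).cexp).const_sub 1
    exact this.congr_deriv (by simp only [id]; ring)

lemma lossExponentC_ofReal (ν : Measure ℝ) [IsFiniteMeasure ν] (s : ℝ) :
    P.lossExponentC ν s = (P.lossExponent ν s : ℂ) := by
  rw [lossExponentC, lossExponent, ← integral_complex_ofReal]
  refine integral_congr_ae ?_
  filter_upwards [ae_loss_mem (P := P) ν] with y hy
  have : 0 < 1 - P.loss y := by linarith [hy.2, P.p_lt_one]
  rw [Real.rpow_def_of_pos this, logKeep]
  push_cast
  rw [mul_comm]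

lemma summable_choose_mul_pow (a : ℂ) {x : ℝ} (hx : 0 ≤ x) (hx1 : x < 1) :
    Summable fun k : ℕ => ‖Ring.choose a k‖ * x ^ k := by
  lift x to NNReal using hx
  have h := (binomialSeries ℂ a).summable_norm_mul_pow (r := x)
    (lt_of_lt_of_le (by exact_mod_cast hx1) binomialSeries_radius_ge_one)
  simpa only [binomialSeries, FormalMultilinearSeries.ofScalars_norm] using h

lemma hasSum_choose_mul_pow (a : ℂ) {x : ℂ} (hx1 : ‖x‖ < 1) :
    HasSum (fun k : ℕ => Ring.choose a k * x ^ k) ((1 + x) ^ a) := by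
  have h := (Complex.one_add_cpow_hasFPowerSeriesOnBall_zero (a := a)).hasSum (y := x)
    (by rw [Metric.mem_eball, edist_zero_right, ← ofReal_norm]; exact ENNReal.ofReal_lt_one.2 hx1)
  simpa only [binomialSeries, FormalMultilinearSeries.ofScalars_apply_eq, zero_add, smul_eq_mul]
    using h

/-- The series in the fixed-point equation: expand the binomial `(1 - loss) ^ z` under the
integral. -/
lemma hasSum_choose_mul_eta (ν : Measure ℝ) [IsFiniteMeasure ν] (z : ℂ) :
    HasSum (fun k : ℕ => Ring.choose z (k + 1) * (P.eta ν (k + 1) : ℂ)) (P.lossExponentC ν z) := by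
  set F : ℕ → ℝ × ℝ → ℂ := fun k y => -(Ring.choose z (k + 1) * (-(P.loss y : ℂ)) ^ (k + 1)) with hF
  have hint : ∀ k, Integrable (F k) (lossMeasure ν) := by
    intro k
    refine ((((integrable_loss_pow (P := P) ν k).ofReal (𝕜 := ℂ)).const_mul
      (Ring.choose z (k + 1) * (-1) ^ (k + 1))).neg).congr (ae_of_all _ fun y => ?_)
    simp only [hF, Pi.neg_apply]
    rw [neg_pow (P.loss y : ℂ)]
    push_cast
    simp only [Complex.coe_algebraMap, mul_assoc]
  have hsum : Summable fun k => ∫ y, ‖F k y‖ ∂lossMeasure ν := by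
    have hs := (summable_nat_add_iff 1).2 (summable_choose_mul_pow z P.p_pos.le P.p_lt_one)
    refine Summable.of_nonneg_of_le (fun k => integral_nonneg fun y => norm_nonneg _) (fun k => ?_)
      (hs.mul_right ((∫ y, P.loss y ∂lossMeasure ν) / P.p))
    have hb : ∫ y, ‖F k y‖ ∂lossMeasure ν ≤
        ∫ y, ‖Ring.choose z (k + 1)‖ * P.p ^ k * P.loss y ∂lossMeasure ν := by
      refine integral_mono_ae (hint k).norm ((integrable_loss ν).const_mul _) ?_
      filter_upwards [ae_loss_mem (P := P) ν] with y hy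
      rw [hF]
      simp only
      rw [norm_neg, norm_mul, norm_pow, norm_neg, Complex.norm_real, Real.norm_of_nonneg hy.1.le,
        pow_succ, mul_assoc]
      have := pow_le_pow_left₀ hy.1.le hy.2 k
      have := hy.1.le
      gcongr
    refine hb.trans (le_of_eq ?_)
    rw [integral_const_mul, pow_succ]
    have := P.p_pos.ne'
    field_simp
  have h := hasSum_integral_of_summable_integral_norm hint hsum
  have h2 : ∀ k, ∫ y, F k y ∂lossMeasure ν = Ring.choose z (k + 1) * (P.eta ν (k + 1) : ℂ) := by
    intro k
    rw [eta_eq]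
    have : ∀ y, F k y = (Ring.choose z (k + 1) * (-1) ^ (k + 1 + 1)) * ((P.loss y ^ (k + 1) : ℝ) : ℂ) := by
      intro y
      simp only [hF]
      rw [neg_pow (P.loss y : ℂ), pow_succ (-1 : ℂ) (k + 1)]
      push_cast
      ring
    simp_rw [this]
    rw [integral_const_mul, integral_complex_ofReal]
    push_cast
    ring
  simp_rw [h2] at h
  -- pointwise this is the binomial series of `(1 - loss) ^ z` without its constant term
  suffices key : ∫ y, ∑' k, F k y ∂lossMeasure ν = P.lossExponentC ν z by rwa [key] at h
  refine integral_congr_ae ?_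
  filter_upwards [ae_loss_mem (P := P) ν] with y hy
  have hpos : 0 < 1 - P.loss y := by linarith [hy.2, P.p_lt_one]
  have hs := hasSum_choose_mul_pow z (x := -(P.loss y : ℂ)) (by
    rw [norm_neg, Complex.norm_real, Real.norm_of_nonneg hy.1.le]; linarith [hy.2, P.p_lt_one])
  have hs1 := ((hasSum_nat_add_iff' 1).2 hs).neg
  rw [hF]
  simp only
  rw [hs1.tsum_eq]
  simp only [Finset.sum_range_one, Ring.choose_zero_right, pow_zero, mul_one, neg_sub]
  congr 1
  rw [← sub_eq_add_neg, Complex.cpow_def_of_ne_zero (by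
    rw [← Complex.ofReal_one, ← Complex.ofReal_sub]; exact_mod_cast hpos.ne'), logKeep,
    Complex.ofReal_log hpos.le, mul_comm]
  push_cast
  rfl

end NetworkParams

namespace MeanFieldNetwork
variable {P : NetworkParams} {ν : Measure ℝ} {Ω : Type*} [MeasurableSpace Ω] {Pr : Measure Ω}
variable [IsProbabilityMeasure Pr] [IsProbabilityMeasure ν]

omit [IsProbabilityMeasure ν] in
lemma integrable_exp_mul_logSuccess (N : MeanFieldNetwork P ν Pr) {s : ℝ} (hs : 0 ≤ s) :
    Integrable (fun ω => Real.exp (s * N.logSuccess ω)) Pr := by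
  have := N.measurable_logSuccess
  refine Integrable.of_bound (Measurable.aestronglyMeasurable (by fun_prop)) 1
    (ae_of_all _ fun ω => ?_)
  rw [Real.norm_eq_abs, Real.abs_exp, Real.exp_le_one_iff]
  exact mul_nonpos_of_nonneg_of_nonpos hs (N.logSuccess_neg ω).le

/-- The Mellin transform of the success probability on the open right half-plane, by analytic
continuation from the positive reals. -/
lemma complexMGF_logSuccess_of_re_pos (N : MeanFieldNetwork P ν Pr) (hν : ν (Icc 0 1) = 1) {z : ℂ}
    (hz : 0 < z.re) : complexMGF N.logSuccess Pr z =
      Complex.exp (-(z * P.noise) - P.spatialConst * P.lossExponentC ν z) := by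
  have hU : IsOpen {z : ℂ | 0 < z.re} := isOpen_lt continuous_const Complex.continuous_re
  have hf : AnalyticOnNhd ℂ (complexMGF N.logSuccess Pr) {z | 0 < z.re} := by
    refine (differentiableOn_complexMGF.mono fun w hw => ?_).analyticOnNhd hU
    refine mem_interior.2 ⟨Ioi 0, fun s hs => ?_, isOpen_Ioi, hw⟩
    exact N.integrable_exp_mul_logSuccess (le_of_lt hs)
  have hg : AnalyticOnNhd ℂ (fun z : ℂ =>
      Complex.exp (-(z * P.noise) - P.spatialConst * P.lossExponentC ν z)) {z | 0 < z.re} := by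
    refine DifferentiableOn.analyticOnNhd (Differentiable.differentiableOn ?_) hU
    have := NetworkParams.differentiable_lossExponentC (P := P) ν
    fun_prop
  have hc : IsPreconnected {z : ℂ | 0 < z.re} := (convex_halfSpace_re_gt 0).isPreconnected
  refine hf.eqOn_of_preconnected_of_frequently_eq hg hc (z₀ := 1) (by simp) ?_ hz
  have hreal : ∀ s : ℝ, 0 ≤ s → complexMGF N.logSuccess Pr s =
      Complex.exp (-((s : ℂ) * P.noise) - P.spatialConst * P.lossExponentC ν s) := by
    intro s hs
    rw [complexMGF_ofReal, N.mgf_logSuccess hν hs, NetworkParams.lossExponentC_ofReal]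
    push_cast; rfl
  have ht : Tendsto (fun n : ℕ => ((1 + 1 / ((n : ℝ) + 1) : ℝ) : ℂ)) atTop (𝓝[≠] 1) := by
    refine tendsto_nhdsWithin_iff.2 ⟨?_, Eventually.of_forall fun n => ?_⟩
    · have := (tendsto_one_div_add_atTop_nhds_zero_nat (𝕜 := ℝ)).const_add 1
      rw [add_zero] at this
      exact_mod_cast (Complex.continuous_ofReal.tendsto 1).comp this
    · have : (0 : ℝ) < 1 / ((n : ℝ) + 1) := by positivity
      intro h
      have h2 : (1 + 1 / ((n : ℝ) + 1) : ℝ) = 1 := Complex.ofReal_injective (by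
        rw [Complex.ofReal_one]; exact h)
      linarith
  exact ht.frequently (Frequently.of_forall fun n => hreal _ (by positivity))

/-- The characteristic function of the logarithm of the success probability. -/
lemma integral_exp_I_mul_logSuccess (N : MeanFieldNetwork P ν Pr) (hν : ν (Icc 0 1) = 1) (w : ℝ) :
    ∫ ω, Complex.exp (Complex.I * w * N.logSuccess ω) ∂Pr =
      Complex.exp (-(Complex.I * w * P.noise) -
        P.spatialConst * P.lossExponentC ν (Complex.I * w)) := by
  have hY := N.measurable_logSuccess
  set z : ℕ → ℂ := fun n => ((1 / ((n : ℝ) + 1) : ℝ) : ℂ) + Complex.I * w with hz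
  have hre : ∀ n, (z n).re = 1 / ((n : ℝ) + 1) := fun n => by
    rw [hz]; simp only; rw [Complex.add_re, Complex.ofReal_re]; simp
  have hpos : ∀ n, 0 < (z n).re := fun n => by rw [hre]; positivity
  have hlim : Tendsto z atTop (𝓝 (Complex.I * w)) := by
    have := ((Complex.continuous_ofReal.tendsto 0).comp
      (tendsto_one_div_add_atTop_nhds_zero_nat (𝕜 := ℝ))).add_const (Complex.I * w)
    simpa [hz, Function.comp_def] using this
  have h1 : Tendsto (fun n => complexMGF N.logSuccess Pr (z n)) atTop
      (𝓝 (∫ ω, Complex.exp (Complex.I * w * N.logSuccess ω) ∂Pr)) := by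
    refine tendsto_integral_of_dominated_convergence (fun _ => 1)
      (fun n => Measurable.aestronglyMeasurable (by fun_prop)) (integrable_const _) (fun n => ?_) ?_
    · refine ae_of_all _ fun ω => ?_
      rw [Complex.norm_exp, Real.exp_le_one_iff, Complex.re_mul_ofReal]
      exact mul_nonpos_of_nonneg_of_nonpos (hpos n).le (N.logSuccess_neg ω).le
    · exact ae_of_all _ fun ω => (Complex.continuous_exp.tendsto _).comp (hlim.mul_const _)
  have h2 : Tendsto (fun n => complexMGF N.logSuccess Pr (z n)) atTop
      (𝓝 (Complex.exp (-(Complex.I * w * P.noise) -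
        P.spatialConst * P.lossExponentC ν (Complex.I * w)))) := by
    simp_rw [fun n => N.complexMGF_logSuccess_of_re_pos hν (hpos n)]
    have hc : Continuous (fun z : ℂ =>
        Complex.exp (-(z * P.noise) - P.spatialConst * P.lossExponentC ν z)) := by
      have := (NetworkParams.differentiable_lossExponentC (P := P) ν).continuous
      fun_prop
    exact (hc.tendsto _).comp hlim
  exact tendsto_nhds_unique h1 h2

end MeanFieldNetwork

/-! ### Decay of the characteristic function and the fixed-point equation -/

namespace NetworkParams
variable {P : NetworkParams}

/-- The rate in the stretched exponential decay of the characteristic function of the logarithm of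
the success probability. -/
def decayRate (P : NetworkParams) : ℝ :=
  P.spatialConst * (2 / Real.pi ^ 2 * (P.p * P.xi / (1 + 2 * P.logKeepBound)) ^ 2 *
    (P.logKeepBound ^ P.delta * (2 ^ P.delta - 1)))

lemma delta_pos (P : NetworkParams) : 0 < P.delta := div_pos two_pos (by linarith [P.two_lt_alpha])

lemma decayRate_pos (P : NetworkParams) : 0 < P.decayRate := by
  have h1 := P.logKeepBound_pos
  have h2 := P.p_pos
  have h3 := P.xi_pos
  have h4 : (1 : ℝ) < 2 ^ P.delta := Real.one_lt_rpow (by norm_num) P.delta_pos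
  have h5 := spatialConst_pos (P := P)
  have h6 := Real.pi_pos
  have h7 := Real.rpow_pos_of_pos h1 P.delta
  have h8 : 0 < (2 : ℝ) ^ P.delta - 1 := by linarith
  rw [decayRate]
  positivity

lemma integrable_one_sub_cos (ν : Measure ℝ) [IsFiniteMeasure ν] (w : ℝ) :
    Integrable (fun y => 1 - Real.cos (w * P.logKeep y)) (lossMeasure ν) := by
  refine (integrable_one_sub_exp (P := P) ν (Complex.I * w)).re.congr (ae_of_all _ fun y => ?_)
  simp [Complex.exp_re]

lemma re_lossExponentC (ν : Measure ℝ) [IsFiniteMeasure ν] (w : ℝ) :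
    (P.lossExponentC ν (Complex.I * w)).re =
      ∫ y, (1 - Real.cos (w * P.logKeep y)) ∂lossMeasure ν := by
  rw [lossExponentC]
  have := integral_re (integrable_one_sub_exp (P := P) ν (Complex.I * w))
  simp only [RCLike.re_eq_complex_re] at this
  rw [← this]
  refine integral_congr_ae (ae_of_all _ fun y => ?_)
  simp [Complex.exp_re]

/-- In the integral of `1 - cos (w * logKeep)`, only a strip of normalised areas of order `w ^ δ` is
kept. There, the absolute value of `w * logKeep` is at most one and bounded away from zero. -/
lemma decayRate_mul_le (ν : Measure ℝ) [IsProbabilityMeasure ν] (hν : ν (Icc 0 1) = 1) {w : ℝ}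
    (hw : 1 ≤ w) :
    P.decayRate * w ^ P.delta ≤ P.spatialConst * (P.lossExponentC ν (Complex.I * w)).re := by
  have hw0 : 0 < w := by linarith
  have hK := P.logKeepBound_pos
  set K := P.logKeepBound with hKdef
  have hp := P.p_pos
  have hp1 : 0 < 1 - P.p := by linarith [P.p_lt_one]
  have hxi := P.xi_pos
  have hα : 0 < P.alpha := by linarith [P.two_lt_alpha]
  have hδ := P.delta_pos
  -- a lower bound for `1 - cos (w * logKeep)` on the strip `a ≤ v ≤ b`, in which `K w ≤ v ^ (α / 2) ≤ 2 K w`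
  set c := 2 / Real.pi ^ 2 * (P.p * P.xi / (1 + 2 * K)) ^ 2 with hc
  have hc0 : 0 ≤ c := by positivity
  set a := (K * w) ^ P.delta with ha
  set b := (2 * (K * w)) ^ P.delta with hb
  have ha0 : 0 < a := Real.rpow_pos_of_pos (by positivity) _
  have hab : a ≤ b := Real.rpow_le_rpow (by positivity) (by nlinarith) hδ.le
  have hba : b - a = K ^ P.delta * (2 ^ P.delta - 1) * w ^ P.delta := by
    rw [ha, hb, Real.mul_rpow (by norm_num) (by positivity), Real.mul_rpow hK.le hw0.le]; ring
  set S : Set (ℝ × ℝ) := Prod.fst ⁻¹' Icc a b with hS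
  have hSm : MeasurableSet S := measurable_fst measurableSet_Icc
  have hSv : lossMeasure ν S = ENNReal.ofReal (b - a) := by
    have hres : ν.restrict (Icc 0 1) univ = 1 := by rw [Measure.restrict_apply_univ, hν]
    rw [hS, show (Prod.fst ⁻¹' Icc a b : Set (ℝ × ℝ)) = Icc a b ×ˢ univ by ext; simp, lossMeasure,
      Measure.prod_prod, hres, mul_one, Measure.restrict_apply measurableSet_Icc,
      show Icc a b ∩ Ioi 0 = Icc a b from
        inter_eq_left.2 fun x hx => ha0.trans_le hx.1, Real.volume_Icc]
  have hcos := integrable_one_sub_cos (P := P) ν w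
  have hnn : ∀ y, 0 ≤ 1 - Real.cos (w * P.logKeep y) := fun y => by
    linarith [Real.cos_le_one (w * P.logKeep y)]
  have hlow : ∀ᵐ y ∂lossMeasure ν, y ∈ S → c ≤ 1 - Real.cos (w * P.logKeep y) := by
    filter_upwards [ae_logKeep (P := P) ν, ae_lossMeasure ν] with y hy hy2 hyS
    have hv : y.1 ∈ Icc a b := hyS
    have e1 : K * w ≤ y.1 ^ (P.alpha / 2) := by
      have := Real.rpow_le_rpow ha0.le hv.1 (by positivity : 0 ≤ P.alpha / 2)
      rwa [ha, ← Real.rpow_mul (by positivity), show P.delta * (P.alpha / 2) = 1 by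
        rw [delta]; field_simp, Real.rpow_one] at this
    have e2 : y.1 ^ (P.alpha / 2) ≤ 2 * (K * w) := by
      have := Real.rpow_le_rpow hy2.1.le hv.2 (by positivity : 0 ≤ P.alpha / 2)
      rwa [hb, ← Real.rpow_mul (by positivity), show P.delta * (P.alpha / 2) = 1 by
        rw [delta]; field_simp, Real.rpow_one] at this
    have hKw : 0 < K * w := by positivity
    have hvpos := Real.rpow_pos_of_pos hy2.1 (P.alpha / 2)
    have l1 : P.loss y ≤ P.p * (1 / (1 + K * w)) := by
      rw [loss, lossKernel]
      refine mul_le_mul (txProb_le hy2.2) (one_div_le_one_div_of_le (by linarith) (by linarith))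
        (by positivity) hp.le
    have l2 : P.p * P.xi * (1 / (1 + 2 * (K * w))) ≤ P.loss y := by
      rw [loss, lossKernel]
      exact mul_le_mul (le_txProb hy2.2) (one_div_le_one_div_of_le (by linarith) (by linarith))
        (by positivity) (txProb_pos hy2.2).le
    have u1 : |w * P.logKeep y| ≤ 1 := by
      rw [abs_mul, abs_of_pos hw0]
      calc w * |P.logKeep y| ≤ w * (P.p * (1 / (1 + K * w)) / (1 - P.p)) := by
            refine mul_le_mul_of_nonneg_left (hy.2.1.trans ?_) hw0.le
            exact div_le_div_of_nonneg_right l1 hp1.le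
        _ = K * w / (1 + K * w) := by rw [hKdef, logKeepBound]; field_simp
        _ ≤ 1 := by rw [div_le_one (by positivity)]; linarith
    have u2 : P.p * P.xi / (1 + 2 * K) ≤ |w * P.logKeep y| := by
      rw [abs_mul, abs_of_pos hw0]
      calc P.p * P.xi / (1 + 2 * K) ≤ w * (P.p * P.xi * (1 / (1 + 2 * (K * w)))) := by
            rw [mul_one_div, ← mul_div_assoc, div_le_div_iff₀ (by positivity) (by positivity)]
            have : 0 ≤ P.p * P.xi := by positivity
            nlinarith
        _ ≤ w * |P.logKeep y| := mul_le_mul_of_nonneg_left (l2.trans hy.1) hw0.le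
    have h1 := Real.cos_le_one_sub_mul_cos_sq (x := w * P.logKeep y)
      (u1.trans (by linarith [Real.pi_gt_three]))
    have h2 : (P.p * P.xi / (1 + 2 * K)) ^ 2 ≤ (w * P.logKeep y) ^ 2 := by
      rw [← sq_abs (w * P.logKeep y)]
      exact pow_le_pow_left₀ (by positivity) u2 2
    have h3 := mul_le_mul_of_nonneg_left h2 (by positivity : 0 ≤ 2 / Real.pi ^ 2)
    rw [hc]; linarith
  have hmain : (b - a) * c ≤ (P.lossExponentC ν (Complex.I * w)).re := by
    rw [re_lossExponentC]
    calc (b - a) * c = ∫ y in S, c ∂lossMeasure ν := by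
          rw [setIntegral_const, Measure.real, hSv, ENNReal.toReal_ofReal (by linarith), smul_eq_mul]
      _ ≤ ∫ y in S, (1 - Real.cos (w * P.logKeep y)) ∂lossMeasure ν := by
          refine setIntegral_mono_on_ae ?_ hcos.integrableOn hSm hlow
          exact integrableOn_const (by rw [hSv]; exact ENNReal.ofReal_ne_top)
      _ ≤ _ := setIntegral_le_integral hcos (ae_of_all _ hnn)
  have h5 := mul_le_mul_of_nonneg_left hmain (spatialConst_pos (P := P)).le
  refine le_trans (le_of_eq ?_) h5
  rw [hba, decayRate]; ring

end NetworkParams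

namespace MeanFieldNetwork
variable {P : NetworkParams} {ν : Measure ℝ} {Ω : Type*} [MeasurableSpace Ω] {Pr : Measure Ω}
variable [IsProbabilityMeasure Pr] [IsProbabilityMeasure ν]

/-- The integrand of the fixed-point equation in terms of the logarithm of the success
probability. -/
lemma metaIntegrand_eq (N : MeanFieldNetwork P ν Pr) (hν : ν (Icc 0 1) = 1) {u : ℝ} (hu : 0 < u)
    (w : ℝ) : P.metaIntegrand ν u w =
      (1 / Real.pi) * ((∫ ω, Real.sin (w * (N.logSuccess ω - Real.log u)) ∂Pr) / w) ∧
    ‖∫ ω, Complex.exp (Complex.I * w * N.logSuccess ω) ∂Pr‖ =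
      ‖∫ ω, Complex.exp (Complex.I * w * (N.logSuccess ω - Real.log u : ℝ)) ∂Pr‖ := by
  have hY := N.measurable_logSuccess
  have hmul : ∫ ω, Complex.exp (Complex.I * w * (N.logSuccess ω - Real.log u : ℝ)) ∂Pr =
      (u : ℂ) ^ (-(Complex.I * (w : ℂ))) * ∫ ω, Complex.exp (Complex.I * w * N.logSuccess ω) ∂Pr := by
    rw [← integral_const_mul]
    refine integral_congr_ae (ae_of_all _ fun ω => ?_)
    simp only
    rw [Complex.cpow_def_of_ne_zero (by exact_mod_cast hu.ne'), ← Complex.exp_add,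
      ← Complex.ofReal_log hu.le]
    congr 1
    push_cast
    ring
  constructor
  · have hint : Integrable (fun ω =>
        Complex.exp (Complex.I * w * (N.logSuccess ω - Real.log u : ℝ))) Pr := by
      refine Integrable.of_bound (Measurable.aestronglyMeasurable (by fun_prop)) 1
        (ae_of_all _ fun ω => ?_)
      rw [mul_assoc, ← Complex.ofReal_mul, mul_comm, Complex.norm_exp_ofReal_mul_I]
    have him := integral_im hint
    simp only [RCLike.im_eq_complex_im] at him
    rw [NetworkParams.metaIntegrand]
    have hsum := (NetworkParams.hasSum_choose_mul_eta (P := P) ν (Complex.I * w)).tsum_eq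
    rw [show (∑' k, P.metaTerm ν w k) = P.lossExponentC ν (Complex.I * w) from hsum,
      show P.theta * P.r ^ P.alpha / P.rho = P.noise from rfl,
      ← N.integral_exp_I_mul_logSuccess hν w, ← hmul, ← him]
    have : ∀ ω, (Complex.exp (Complex.I * w * (N.logSuccess ω - Real.log u : ℝ))).im =
        Real.sin (w * (N.logSuccess ω - Real.log u)) := fun ω => by
      rw [mul_assoc, ← Complex.ofReal_mul, mul_comm, Complex.exp_ofReal_mul_I_im]
    simp_rw [this]
    rw [one_div_mul_eq_div, div_div, mul_comm w]
  · rw [hmul, norm_mul, Complex.norm_cpow_eq_rpow_re_of_pos hu]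
    simp

/-- Stretched exponential decay of the characteristic function. -/
lemma norm_charFun_le (N : MeanFieldNetwork P ν Pr) (hν : ν (Icc 0 1) = 1) {w : ℝ} (hw : 0 < w) :
    ‖∫ ω, Complex.exp (Complex.I * w * N.logSuccess ω) ∂Pr‖ ≤
      Real.exp P.decayRate * Real.exp (-P.decayRate * w ^ P.delta) := by
  rcases le_total w 1 with h | h
  · refine (norm_integral_le_of_norm_le_const (C := 1) (ae_of_all _ fun ω => ?_)).trans ?_
    · rw [mul_assoc, ← Complex.ofReal_mul, mul_comm, Complex.norm_exp_ofReal_mul_I]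
    · rw [probReal_univ, mul_one, ← Real.exp_add, Real.one_le_exp_iff]
      have := Real.rpow_le_one hw.le h P.delta_pos.le
      nlinarith [P.decayRate_pos]
  · rw [N.integral_exp_I_mul_logSuccess hν w, Complex.norm_exp]
    have h1 := NetworkParams.decayRate_mul_le (P := P) ν hν h
    have h2 : (-(Complex.I * w * P.noise) - P.spatialConst * P.lossExponentC ν (Complex.I * w)).re =
        -(P.spatialConst * (P.lossExponentC ν (Complex.I * w)).re) := by
      rw [Complex.sub_re, Complex.re_ofReal_mul]; simp
    rw [h2, ← Real.exp_add, Real.exp_le_exp]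
    nlinarith [P.decayRate_pos]

/-- Gil-Pelaez inversion for the success probability. -/
lemma cdf_successProb (N : MeanFieldNetwork P ν Pr) (hν : ν (Icc 0 1) = 1) {u : ℝ} (hu : 0 < u) :
    IntegrableOn (P.metaIntegrand ν u) (Ioi 0) ∧
      Pr.real {ω | Real.exp (N.logSuccess ω) ≤ u} =
        1 / 2 - ∫ w in Ioi (0 : ℝ), P.metaIntegrand ν u w := by
  have hY := N.measurable_logSuccess
  set D : Ω → ℝ := fun ω => N.logSuccess ω - Real.log u with hD
  have hDm : Measurable D := hY.sub_const _
  have hDi : Integrable D Pr := (N.integrable_logSuccess hν).sub (integrable_const _)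
  set B : ℝ → ℝ := fun w => Real.exp P.decayRate * Real.exp (-P.decayRate * w ^ P.delta) with hB
  have hBi : IntegrableOn B (Ioi 0) := by
    have := integrableOn_rpow_mul_exp_neg_mul_rpow (s := 0) (by norm_num) P.delta_pos P.decayRate_pos
    simp only [Real.rpow_zero, one_mul] at this
    exact this.const_mul _
  have hint : ∀ w : ℝ, Integrable (fun ω => Complex.exp (Complex.I * w * (D ω : ℝ))) Pr := fun w => by
    refine Integrable.of_bound (Measurable.aestronglyMeasurable (by fun_prop)) 1
      (ae_of_all _ fun ω => ?_)
    rw [mul_assoc, ← Complex.ofReal_mul, mul_comm, Complex.norm_exp_ofReal_mul_I]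
  have hnorm : ∀ w : ℝ, 0 < w → ‖∫ ω, Complex.exp (Complex.I * w * (D ω : ℝ)) ∂Pr‖ ≤ B w :=
    fun w hw => by
      rw [← (N.metaIntegrand_eq hν hu w).2]
      exact N.norm_charFun_le hν hw
  have hre : ∀ w : ℝ, ∫ ω, Real.cos (w * D ω) ∂Pr =
      (∫ ω, Complex.exp (Complex.I * w * (D ω : ℝ)) ∂Pr).re := fun w => by
    have := integral_re (hint w)
    simp only [RCLike.re_eq_complex_re] at this
    rw [← this]
    refine integral_congr_ae (ae_of_all _ fun ω => ?_)
    simp only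
    rw [mul_assoc, ← Complex.ofReal_mul, mul_comm Complex.I, Complex.exp_ofReal_mul_I_re]
  have him : ∀ w : ℝ, ∫ ω, Real.sin (w * D ω) ∂Pr =
      (∫ ω, Complex.exp (Complex.I * w * (D ω : ℝ)) ∂Pr).im := fun w => by
    have := integral_im (hint w)
    simp only [RCLike.im_eq_complex_im] at this
    rw [← this]
    refine integral_congr_ae (ae_of_all _ fun ω => ?_)
    simp only
    rw [mul_assoc, ← Complex.ofReal_mul, mul_comm Complex.I, Complex.exp_ofReal_mul_I_im]
  have hcos : IntegrableOn (fun w => ∫ ω, Real.cos (w * D ω) ∂Pr) (Ioi 0) := by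
    refine hBi.mono' (measurable_integral_comp_mul hDm Real.measurable_cos).aestronglyMeasurable ?_
    filter_upwards [ae_restrict_mem measurableSet_Ioi] with w hw
    rw [hre, Real.norm_eq_abs]
    exact (Complex.abs_re_le_norm _).trans (hnorm w hw)
  have hsin : IntegrableOn (fun w => (∫ ω, Real.sin (w * D ω) ∂Pr) / w) (Ioi 0) := by
    have hm := (measurable_integral_comp_mul (Pr := Pr) hDm Real.measurable_sin).div measurable_id
    -- near zero the division by `w` is harmless since `D` is integrable, and beyond one the decay of the
    -- characteristic function applies
    rw [← Ioc_union_Ioi_eq_Ioi (zero_le_one (α := ℝ))]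
    refine IntegrableOn.union ?_ ?_
    · refine Measure.integrableOn_of_bounded (M := ∫ ω, |D ω| ∂Pr) (by simp)
        hm.aestronglyMeasurable ?_
      filter_upwards [ae_restrict_mem measurableSet_Ioc] with w hw
      rw [norm_div, Real.norm_of_nonneg hw.1.le, div_le_iff₀ hw.1, ← integral_mul_const]
      refine norm_integral_le_of_norm_le (hDi.abs.mul_const w) (ae_of_all _ fun ω => ?_)
      refine Real.abs_sin_le_abs.trans ?_
      rw [abs_mul, abs_of_pos hw.1, mul_comm]
    · refine (hBi.mono_set (Ioi_subset_Ioi zero_le_one)).mono' hm.aestronglyMeasurable ?_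
      filter_upwards [ae_restrict_mem measurableSet_Ioi] with w hw
      have hw0 : 0 < w := one_pos.trans hw
      rw [norm_div, Real.norm_of_nonneg hw0.le, him, Real.norm_eq_abs]
      exact (div_le_self (abs_nonneg _) (le_of_lt hw)).trans
        ((Complex.abs_im_le_norm _).trans (hnorm w hw0))
  have hmeta : P.metaIntegrand ν u = fun w => (1 / Real.pi) * ((∫ ω, Real.sin (w * D ω) ∂Pr) / w) :=
    funext fun w => (N.metaIntegrand_eq hν hu w).1
  have hset : {ω | Real.exp (N.logSuccess ω) ≤ u} = {ω | D ω ≤ 0} := by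
    ext ω
    change Real.exp (N.logSuccess ω) ≤ u ↔ D ω ≤ 0
    rw [hD, sub_nonpos, Real.le_log_iff_exp_le hu]
  refine ⟨by rw [hmeta]; exact hsin.const_mul _, ?_⟩
  rw [hmeta, integral_const_mul, integral_integral_sin_div hDm hDi hcos hsin, hset]
  have := Real.pi_ne_zero
  field_simp
  ring

/-- A law on `[0, 1]` is determined by its distribution function on `(0, 1]`, by right continuity
at zero. -/
lemma _root_.measure_eq_iff_cdf {μ ν : Measure ℝ} [IsProbabilityMeasure μ] [IsProbabilityMeasure ν]
    (hμ : μ (Icc 0 1) = 1) (hν : ν (Icc 0 1) = 1) :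
    μ = ν ↔ ∀ u : ℝ, 0 < u → u ≤ 1 → cdf ν u = cdf μ u := by
  refine ⟨fun h u _ _ => by rw [h], fun h => Measure.eq_of_cdf μ ν ?_⟩
  have hneg : ∀ (ρ : Measure ℝ) [IsProbabilityMeasure ρ], ρ (Icc 0 1) = 1 →
      ∀ u < 0, cdf ρ u = 0 := by
    intro ρ _ hρ u hu
    rw [cdf_eq_real, measureReal_eq_zero_iff]
    refine measure_mono_null (t := (Icc 0 1)ᶜ) ?_ ((prob_compl_eq_zero_iff measurableSet_Icc).2 hρ)
    intro x hx h
    exact absurd (h.1.trans (mem_Iic.1 hx)) (not_le.2 hu)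
  have hone : ∀ (ρ : Measure ℝ) [IsProbabilityMeasure ρ], ρ (Icc 0 1) = 1 →
      ∀ u, 1 ≤ u → cdf ρ u = 1 := by
    intro ρ _ hρ u hu
    rw [cdf_eq_real]
    refine le_antisymm measureReal_le_one ?_
    have : ρ.real (Icc 0 1) = 1 := by rw [Measure.real, hρ]; rfl
    rw [← this]
    exact measureReal_mono (fun x hx => hx.2.trans hu)
  have hpos : ∀ u, 0 < u → cdf μ u = cdf ν u := by
    intro u hu
    rcases le_total u 1 with h1 | h1
    · exact (h u hu h1).symm
    · rw [hone μ hμ u h1, hone ν hν u h1]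
  ext u
  rcases lt_trichotomy u 0 with hu | rfl | hu
  · rw [hneg μ hμ u hu, hneg ν hν u hu]
  · have h1 := ((cdf μ).right_continuous 0).mono_left (nhdsWithin_mono _ Ioi_subset_Ici_self)
    have h2 := ((cdf ν).right_continuous 0).mono_left (nhdsWithin_mono _ Ioi_subset_Ici_self)
    refine tendsto_nhds_unique h1 (h2.congr' ?_)
    filter_upwards [self_mem_nhdsWithin] with u hu using (hpos u hu).symm
  · exact hpos u hu

/-- Both sides say that `ν` and the law of the success probability have the same distribution
function on `(0, 1]`; convergence of the series and of the integral is automatic. -/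
theorem selfConsistent_iff (N : MeanFieldNetwork P ν Pr) (hν : ν (Icc 0 1) = 1) :
    N.SelfConsistent ↔ P.SolvesFixedPoint ν := by
  have hY := N.measurable_logSuccess
  set μ := Pr.map (fun ω => Real.exp (N.logSuccess ω)) with hμ
  have hem : Measurable fun ω => Real.exp (N.logSuccess ω) := hY.exp
  have : IsProbabilityMeasure μ := Measure.isProbabilityMeasure_map hem.aemeasurable
  have hmap : ∀ t, Pr.map (N.successProb t) = μ := fun t =>
    Measure.map_congr (N.successProb_ae_eq_exp hν t)
  have hμ1 : μ (Icc 0 1) = 1 := by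
    rw [hμ, Measure.map_apply hem measurableSet_Icc]
    convert measure_univ (μ := Pr)
    refine eq_univ_of_forall fun ω => ⟨Real.exp_nonneg _, ?_⟩
    exact Real.exp_le_one_iff.2 (N.logSuccess_neg ω).le
  have hcdf : ∀ u, cdf μ u = Pr.real {ω | Real.exp (N.logSuccess ω) ≤ u} := by
    intro u
    rw [cdf_eq_real, hμ, map_measureReal_apply hem measurableSet_Iic]
    rfl
  have h1 : N.SelfConsistent ↔ μ = ν := by
    simp only [SelfConsistent, hmap, forall_const]
  rw [h1, measure_eq_iff_cdf hμ1 hν]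
  constructor
  · intro h
    refine ⟨fun w _ => (NetworkParams.hasSum_choose_mul_eta (P := P) ν _).summable, fun u hu hu1 => ?_⟩
    have h2 := N.cdf_successProb hν hu
    exact ⟨h2.1, by rw [h u hu hu1, hcdf, h2.2]⟩
  · intro h u hu hu1
    rw [(h.2 u hu hu1).2, hcdf, (N.cdf_successProb hν hu).2]

end MeanFieldNetwork

/-! ### Age processes and a law of large numbers -/

section AgeProcess

open Classical in
/-- Time that has elapsed at the start of slot `t` since the generation of the freshest packet that
arrived in an earlier slot, when packets arrive in the slots `i` with `x ∈ A i`; the value at time `0`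
is `c`. -/
def waitAge {α : Type*} (c : ℕ) (A : ℕ → Set α) : ℕ → α → ℕ
  | 0, _ => c
  | t + 1, x => if x ∈ A t then 1 else waitAge c A t x + 1

open Classical in
/-- Age of information at the start of slot `t` when packets arrive in the slots `i` with `x ∈ A i`
and the link serves in the slots `i` with `x ∈ D i`. Serving without a fresh packet changes nothing, since the age then
already equals `waitAge`. -/
def linkAge {α : Type*} (c : ℕ) (A D : ℕ → Set α) : ℕ → α → ℕ
  | 0, _ => c
  | t + 1, x => if x ∈ D t then waitAge c A (t + 1) x else linkAge c A D t x + 1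

variable {α β : Type*} {c : ℕ} {A D : ℕ → Set α}

lemma waitAge_comp (f : β → α) (t : ℕ) (x : β) :
    waitAge c (fun t => f ⁻¹' A t) t x = waitAge c A t (f x) := by
  induction t with
  | zero => rfl
  | succ t ih => simp only [waitAge, ih]; rfl

lemma linkAge_comp (f : β → α) (t : ℕ) (x : β) :
    linkAge c (fun t => f ⁻¹' A t) (fun t => f ⁻¹' D t) t x = linkAge c A D t (f x) := by
  induction t with
  | zero => rfl
  | succ t ih => simp only [linkAge, ih, waitAge_comp]; rfl

lemma waitAge_le (t : ℕ) (x : α) : waitAge c A t x ≤ c + t := by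
  induction t with
  | zero => exact le_rfl
  | succ t ih => simp only [waitAge]; split_ifs <;> omega

lemma linkAge_le (t : ℕ) (x : α) : linkAge c A D t x ≤ c + t := by
  induction t with
  | zero => exact le_rfl
  | succ t ih =>
    have := waitAge_le (c := c) (A := A) (t + 1) x
    simp only [linkAge]; split_ifs <;> omega

lemma measurable_waitAge [MeasurableSpace α] {t : ℕ} (hA : ∀ i < t, MeasurableSet (A i)) :
    Measurable (waitAge c A t) := by
  induction t with
  | zero => exact measurable_const
  | succ t ih =>
    exact Measurable.ite (hA t (Nat.lt_succ_self t)) measurable_const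
      ((ih fun i hi => hA i (hi.trans (Nat.lt_succ_self t))).add_const 1)

lemma measurable_linkAge [MeasurableSpace α] {t : ℕ} (hA : ∀ i < t, MeasurableSet (A i))
    (hD : ∀ i < t, MeasurableSet (D i)) : Measurable (linkAge c A D t) := by
  induction t with
  | zero => exact measurable_const
  | succ t ih =>
    have h := Nat.lt_succ_self t
    exact Measurable.ite (hD t h) (measurable_waitAge hA)
      ((ih (fun i hi => hA i (hi.trans h)) fun i hi => hD i (hi.trans h)).add_const 1)

lemma waitAge_step (t : ℕ) (x : α) : (waitAge c A (t + 1) x : ℝ) =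
    waitAge c A t x + 1 - (A t).indicator 1 x * waitAge c A t x := by
  by_cases h : x ∈ A t <;> simp [waitAge, h]

lemma linkAge_step (t : ℕ) (x : α) : (linkAge c A D (t + 1) x : ℝ) =
    linkAge c A D t x + 1 +
      (D t).indicator 1 x * (waitAge c A (t + 1) x - linkAge c A D t x - 1) := by
  by_cases h : x ∈ D t
  · simp only [linkAge, h, if_true, indicator_of_mem, Pi.one_apply]; ring
  · simp [linkAge, h]

end AgeProcess

section LawOfLargeNumbers
variable {Ω : Type*} {m : MeasurableSpace Ω} {Pr : Measure Ω}

lemma tendsto_ae_of_integral_le {f : ℕ → Ω → ℝ} (hf : ∀ n, Measurable (f n))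
    (hf0 : ∀ n ω, 0 ≤ f n ω) (hfi : ∀ n, Integrable (f n) Pr) {b : ℕ → ℝ} (hb : Summable b)
    (hle : ∀ n, ∫ ω, f n ω ∂Pr ≤ b n) : ∀ᵐ ω ∂Pr, Tendsto (fun n => f n ω) atTop (𝓝 0) := by
  have hb0 : ∀ n, 0 ≤ b n := fun n => (integral_nonneg (hf0 n)).trans (hle n)
  have hsum : ∫⁻ ω, ∑' n, ENNReal.ofReal (f n ω) ∂Pr ≠ ⊤ := by
    rw [lintegral_tsum fun n => (hf n).ennreal_ofReal.aemeasurable]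
    refine ne_top_of_le_ne_top hb.tsum_ofReal_ne_top (ENNReal.tsum_le_tsum fun n => ?_)
    rw [← ofReal_integral_eq_lintegral_ofReal (hfi n) (ae_of_all _ (hf0 n))]
    exact ENNReal.ofReal_le_ofReal (hle n)
  filter_upwards [ae_lt_top (Measurable.tsum fun n => (hf n).ennreal_ofReal) hsum] with ω hω
  have h1 := ENNReal.tendsto_atTop_zero_of_tsum_ne_top hω.ne
  have h2 := (ENNReal.tendsto_toReal ENNReal.zero_ne_top).comp h1
  simpa [Function.comp_def, ENNReal.toReal_ofReal (hf0 _ ω)] using h2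

/-- A sequence of events `E t` of probability `s`, each independent of the past `G t`, to which the
earlier events belong. In `indep`, a sub-σ-algebra `H` containing `E t` serves to express the
independence. -/
structure IsTrialSequence (Pr : Measure Ω) (G : ℕ → MeasurableSpace Ω) (E : ℕ → Set Ω) (s : ℝ) :
    Prop where
  mono : Monotone G
  le : ∀ t, G t ≤ m
  meas : ∀ t, MeasurableSet[G (t + 1)] (E t)
  indep : ∀ t, ∃ H : MeasurableSpace Ω, MeasurableSet[H] (E t) ∧ Indep H (G t) Pr
  prob : ∀ t, Pr.real (E t) = s

lemma measurable_indicator_sub [MeasurableSpace Ω] {S : Set Ω} (hS : MeasurableSet S) (s : ℝ) :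
    Measurable fun ω => S.indicator (1 : Ω → ℝ) ω - s :=
  (measurable_one.indicator hS).sub_const s

lemma integrable_of_bounded [IsFiniteMeasure Pr] {y : Ω → ℝ} (hy : Measurable y) (hb : ∃ B, ∀ ω, |y ω| ≤ B) :
    Integrable y Pr :=
  Integrable.of_bound hy.aestronglyMeasurable hb.choose (ae_of_all _ hb.choose_spec)

/-- Along the squares, a sequence whose mean square grows at most linearly obeys the law of large
numbers. -/
lemma tendsto_div_sq_of_integral_sq_le [IsFiniteMeasure Pr] {S : ℕ → Ω → ℝ}
    (hm : ∀ T, Measurable (S T)) (hb : ∀ T, ∃ B, ∀ ω, |S T ω| ≤ B) {C : ℝ}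
    (hC : ∀ n : ℕ, ∫ ω, S ((n + 1) ^ 2) ω ^ 2 ∂Pr ≤ C * ((n : ℝ) + 1) ^ 2) :
    ∀ᵐ ω ∂Pr, Tendsto (fun n : ℕ => S ((n + 1) ^ 2) ω / ((n : ℝ) + 1) ^ 2) atTop (𝓝 0) := by
  have hsum : Summable fun n : ℕ => C / ((n : ℝ) + 1) ^ 2 := by
    have := ((summable_nat_add_iff 1).2 (Real.summable_one_div_nat_pow.2 one_lt_two)).mul_left C
    refine this.congr fun n => ?_
    push_cast; ring
  have hi : ∀ n : ℕ, Integrable (fun ω => (S ((n + 1) ^ 2) ω / ((n : ℝ) + 1) ^ 2) ^ 2) Pr := by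
    intro n
    obtain ⟨B, hB⟩ := hb ((n + 1) ^ 2)
    refine integrable_of_bounded (((hm _).div_const _).pow_const _)
      ⟨(B / ((n : ℝ) + 1) ^ 2) ^ 2, fun ω => ?_⟩
    rw [abs_pow, abs_div, abs_of_pos (by positivity : (0 : ℝ) < ((n : ℝ) + 1) ^ 2)]
    have := hB ω
    gcongr
  have := tendsto_ae_of_integral_le (fun n => ((hm ((n + 1) ^ 2)).div_const
    (((n : ℝ) + 1) ^ 2)).pow_const 2) (fun n ω => sq_nonneg _) hi hsum (fun n => by
      simp_rw [div_pow]
      rw [integral_div, div_le_div_iff₀ (by positivity) (by positivity)]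
      have h2 := mul_le_mul_of_nonneg_right (hC n) (by positivity : (0 : ℝ) ≤ ((n : ℝ) + 1) ^ 2)
      calc _ ≤ _ := h2
        _ = _ := by ring)
  filter_upwards [this] with ω hω
  have h1 := hω.sqrt
  simp only [Real.sqrt_sq_eq_abs, Real.sqrt_zero] at h1
  exact (tendsto_zero_iff_abs_tendsto_zero _).2 h1

namespace IsTrialSequence
variable {G : ℕ → MeasurableSpace Ω} {E : ℕ → Set Ω} {s : ℝ}

lemma measurableSet (h : IsTrialSequence Pr G E s) (t : ℕ) : MeasurableSet (E t) :=
  h.le _ _ (h.meas t)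

lemma integral_indicator_mul (h : IsTrialSequence Pr G E s) (t : ℕ) {y : Ω → ℝ}
    (hy : Measurable[G t] y) : ∫ ω, (E t).indicator 1 ω * y ω ∂Pr = s * ∫ ω, y ω ∂Pr := by
  have hE := h.measurableSet t
  have hind : IndepFun ((E t).indicator fun _ => (1 : ℝ)) y Pr := by
    obtain ⟨H, hEH, hH⟩ := h.indep t
    exact Indep.indicator_indepFun 1 hEH (indep_of_indep_of_le_right hH hy.comap_le)
  rw [← h.prob t, ← integral_indicator_one hE]
  exact hind.integral_fun_mul_eq_mul_integral
    (measurable_one.indicator hE).aestronglyMeasurable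
    ((hy.mono (h.le t) le_rfl).aestronglyMeasurable)

variable [IsProbabilityMeasure Pr]

omit [IsProbabilityMeasure Pr] in
lemma nonneg (h : IsTrialSequence Pr G E s) : 0 ≤ s := h.prob 0 ▸ measureReal_nonneg
lemma le_one (h : IsTrialSequence Pr G E s) : s ≤ 1 := h.prob 0 ▸ measureReal_le_one

/-- The centred trials multiplied by a predictable sequence. -/
def transform (E : ℕ → Set Ω) (s : ℝ) (y : ℕ → Ω → ℝ) (T : ℕ) (ω : Ω) : ℝ :=
  ∑ t ∈ Finset.range T, ((E t).indicator 1 ω - s) * y t ω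

omit [IsProbabilityMeasure Pr] in
lemma measurable_transform (h : IsTrialSequence Pr G E s) {y : ℕ → Ω → ℝ}
    (hy : ∀ t, Measurable[G t] (y t)) (T : ℕ) : Measurable[G T] (transform E s y T) := by
  refine @Finset.measurable_fun_sum _ _ _ _ _ _ (G T) _ _ fun t ht => ?_
  have ht := Finset.mem_range.1 ht
  refine Measurable.mul (@measurable_indicator_sub _ (G T) _ (h.mono ht _ (h.meas t)) s)
    ((hy t).mono (h.mono ht.le) le_rfl)

lemma abs_indicator_sub_le (h : IsTrialSequence Pr G E s) (t : ℕ) (ω : Ω) :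
    |(E t).indicator 1 ω - s| ≤ 1 := by
  have := h.nonneg; have := h.le_one
  by_cases hω : ω ∈ E t <;> simp [hω, abs_le] <;> constructor <;> linarith

lemma bounded_transform (h : IsTrialSequence Pr G E s) {y : ℕ → Ω → ℝ}
    (hb : ∀ t, ∃ B, ∀ ω, |y t ω| ≤ B) (T : ℕ) : ∃ B, ∀ ω, |transform E s y T ω| ≤ B := by
  choose B hB using hb
  refine ⟨∑ t ∈ Finset.range T, B t, fun ω => ?_⟩
  refine (Finset.abs_sum_le_sum_abs _ _).trans (Finset.sum_le_sum fun t _ => ?_)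
  rw [abs_mul]
  exact (mul_le_of_le_one_left (abs_nonneg _) (h.abs_indicator_sub_le t ω)).trans (hB t ω)

/-- The increments of the transform are orthogonal, so its mean square grows at most linearly. -/
lemma integral_transform_sq_le (h : IsTrialSequence Pr G E s) {y : ℕ → Ω → ℝ}
    (hy : ∀ t, Measurable[G t] (y t)) (hb : ∀ t, ∃ B, ∀ ω, |y t ω| ≤ B) {C : ℝ}
    (hC : ∀ t, ∫ ω, y t ω ^ 2 ∂Pr ≤ C) (T : ℕ) :
    ∫ ω, transform E s y T ω ^ 2 ∂Pr ≤ C * T := by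
  induction T with
  | zero => simp [transform]
  | succ T ih =>
    set M := transform E s y T with hM
    have hMm := h.measurable_transform hy T
    have hMb := h.bounded_transform hb T
    have hym := (hy T).mono (h.le T) le_rfl
    have hMm' := hMm.mono (h.le T) le_rfl
    have hEm : Measurable ((E T).indicator (1 : Ω → ℝ)) :=
      measurable_one.indicator (h.measurableSet T)
    obtain ⟨B, hB⟩ := hb T
    obtain ⟨B', hB'⟩ := hMb
    have hstep : ∀ ω, transform E s y (T + 1) ω ^ 2 = M ω ^ 2 +
        (2 * ((E T).indicator 1 ω * (M ω * y T ω)) - 2 * s * (M ω * y T ω)) +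
          (((E T).indicator 1 ω - s) * y T ω) ^ 2 := by
      intro ω
      rw [transform, Finset.sum_range_succ, hM, transform]; ring
    have i1 : Integrable (fun ω => M ω ^ 2) Pr := integrable_of_bounded (hMm'.pow_const _)
      ⟨B' ^ 2, fun ω => by rw [abs_pow]; exact pow_le_pow_left₀ (abs_nonneg _) (hB' ω) 2⟩
    have hMy : ∀ ω, |M ω * y T ω| ≤ B' * B := fun ω => by
      rw [abs_mul]
      exact mul_le_mul (hB' ω) (hB ω) (abs_nonneg _) ((abs_nonneg _).trans (hB' ω))
    have i2 : Integrable (fun ω => M ω * y T ω) Pr := integrable_of_bounded (hMm'.mul hym) ⟨_, hMy⟩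
    have i3 : Integrable (fun ω => (E T).indicator 1 ω * (M ω * y T ω)) Pr := by
      refine integrable_of_bounded (hEm.mul (hMm'.mul hym)) ⟨B' * B, fun ω => ?_⟩
      rw [abs_mul]
      refine (mul_le_of_le_one_left (abs_nonneg _) ?_).trans (hMy ω)
      by_cases hω : ω ∈ E T <;> simp [hω]
    have hle4 : ∀ ω, (((E T).indicator 1 ω - s) * y T ω) ^ 2 ≤ y T ω ^ 2 := fun ω => by
      rw [mul_pow]
      refine mul_le_of_le_one_left (sq_nonneg _) ?_
      rw [← sq_abs]
      exact pow_le_one₀ (abs_nonneg _) (h.abs_indicator_sub_le T ω)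
    have i5 : Integrable (fun ω => y T ω ^ 2) Pr := integrable_of_bounded (hym.pow_const _)
      ⟨B ^ 2, fun ω => by rw [abs_pow]; exact pow_le_pow_left₀ (abs_nonneg _) (hB ω) 2⟩
    have i4 : Integrable (fun ω => (((E T).indicator 1 ω - s) * y T ω) ^ 2) Pr :=
      i5.mono' (((hEm.sub_const _).mul hym).pow_const _).aestronglyMeasurable
        (ae_of_all _ fun ω => by rw [Real.norm_of_nonneg (sq_nonneg _)]; exact hle4 ω)
    have i6 : Integrable (fun ω => 2 * ((E T).indicator 1 ω * (M ω * y T ω)) -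
        2 * s * (M ω * y T ω)) Pr := (i3.const_mul 2).sub (i2.const_mul (2 * s))
    have i7 : Integrable (fun ω => M ω ^ 2 + (2 * ((E T).indicator 1 ω * (M ω * y T ω)) -
        2 * s * (M ω * y T ω))) Pr := i1.add i6
    simp_rw [hstep]
    rw [integral_add i7 i4, integral_add i1 i6,
      integral_sub (i3.const_mul 2) (i2.const_mul (2 * s)), integral_const_mul, integral_const_mul,
      h.integral_indicator_mul T (y := fun ω => M ω * y T ω) (Measurable.mul hMm (hy T))]
    have := (integral_mono i4 i5 hle4).trans (hC T)
    push_cast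
    linarith

/-- Foster-type bound: a sequence that is reset with probability `s` in each step, and otherwise
grows by bounded amounts, is bounded in mean square. -/
lemma integral_sq_le_of_step (h : IsTrialSequence Pr G E s) (hs : 0 < s) {y : ℕ → Ω → ℝ}
    (hy : ∀ t, Measurable[G t] (y t)) (hb : ∀ t, ∃ B, ∀ ω, |y t ω| ≤ B) {c K : ℝ} (hK : 0 ≤ K)
    (h0 : ∀ ω, y 0 ω = c) {R : ℕ → Ω → ℝ} (hRi : ∀ t, Integrable (R t) Pr)
    (hR : ∀ t, ∫ ω, R t ω ∂Pr ≤ K)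
    (hstep : ∀ t ω, y (t + 1) ω ^ 2 ≤
      R t ω + (1 + s) * (y t ω ^ 2 - (E t).indicator 1 ω * y t ω ^ 2)) (t : ℕ) :
    ∫ ω, y t ω ^ 2 ∂Pr ≤ c ^ 2 + K / s ^ 2 := by
  have hi : ∀ t, Integrable (fun ω => y t ω ^ 2) Pr := fun t => by
    obtain ⟨B, hB⟩ := hb t
    exact integrable_of_bounded (((hy t).mono (h.le t) le_rfl).pow_const _)
      ⟨B ^ 2, fun ω => by rw [abs_pow]; exact pow_le_pow_left₀ (abs_nonneg _) (hB ω) 2⟩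
  induction t with
  | zero =>
    have : 0 ≤ K / s ^ 2 := by positivity
    simp [h0, this]
  | succ t ih =>
    have hEm : Measurable ((E t).indicator (1 : Ω → ℝ)) :=
      measurable_one.indicator (h.measurableSet t)
    have i2 : Integrable (fun ω => (E t).indicator 1 ω * y t ω ^ 2) Pr := by
      refine (hi t).mono' (hEm.mul (((hy t).mono (h.le t) le_rfl).pow_const _)).aestronglyMeasurable
        (ae_of_all _ fun ω => ?_)
      by_cases hω : ω ∈ E t <;> simp [hω, sq_nonneg]
    have i3 : Integrable (fun ω => y t ω ^ 2 - (E t).indicator 1 ω * y t ω ^ 2) Pr := (hi t).sub i2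
    have h1 : ∫ ω, y (t + 1) ω ^ 2 ∂Pr ≤ ∫ ω, (R t ω +
        (1 + s) * (y t ω ^ 2 - (E t).indicator 1 ω * y t ω ^ 2)) ∂Pr :=
      integral_mono (hi _) ((hRi t).add (i3.const_mul _)) (hstep t)
    rw [integral_add (hRi t) (i3.const_mul _), integral_const_mul,
      integral_sub (hi t) i2,
      h.integral_indicator_mul t (y := fun ω => y t ω ^ 2) (Measurable.pow_const (hy t) 2)] at h1
    have h2 := h.le_one
    have h3 : (1 + s) * (∫ ω, y t ω ^ 2 ∂Pr - s * ∫ ω, y t ω ^ 2 ∂Pr) ≤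
        (1 - s ^ 2) * (c ^ 2 + K / s ^ 2) := by
      have : 0 ≤ 1 - s ^ 2 := by nlinarith
      calc _ = (1 - s ^ 2) * ∫ ω, y t ω ^ 2 ∂Pr := by ring
        _ ≤ _ := mul_le_mul_of_nonneg_left ih this
    have h4 : (1 - s ^ 2) * (c ^ 2 + K / s ^ 2) = c ^ 2 + K / s ^ 2 - s ^ 2 * c ^ 2 - K := by
      field_simp; ring
    have := hR t
    nlinarith [mul_nonneg (sq_nonneg s) (sq_nonneg c)]

end IsTrialSequence
end LawOfLargeNumbers

/-! ### The average of the age -/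

namespace IsTrialSequence
variable {Ω : Type*} {m : MeasurableSpace Ω} {Pr : Measure Ω} [IsProbabilityMeasure Pr]
  {G G' : ℕ → MeasurableSpace Ω} {A D : ℕ → Set Ω} {x s : ℝ}

/-- Summing the recursions for `waitAge` and `linkAge` expresses the total age through centred
terms and boundary terms. -/
lemma sum_linkAge (hx : x ≠ 0) (hs : s ≠ 0) (c : ℕ) (ω : Ω) (T : ℕ) :
    ∑ t ∈ Finset.Icc 1 T, (linkAge c A D t ω : ℝ) = (1 / x + 1 / s - 1) * T +
      ((c - linkAge c A D T ω + transform D s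
        (fun t ω => waitAge c A (t + 1) ω - linkAge c A D t ω - 1) T ω) / s +
      (c - waitAge c A T ω - transform A x (fun t ω => waitAge c A t ω) T ω) / x +
      waitAge c A T ω + linkAge c A D T ω - 2 * c) := by
  induction T with
  | zero => simp [waitAge, linkAge, transform]; ring
  | succ T ih =>
    rw [Finset.sum_Icc_succ_top (by omega), ih, linkAge_step]
    simp only [transform, Finset.sum_range_succ]
    rw [waitAge_step]
    push_cast
    field_simp
    ring

lemma integral_waitAge_sq_le (hA : IsTrialSequence Pr G A x) (hx : 0 < x) (c t : ℕ) :
    ∫ ω, (waitAge c A t ω : ℝ) ^ 2 ∂Pr ≤ (c : ℝ) ^ 2 + (1 + 1 / x) / x ^ 2 := by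
  refine hA.integral_sq_le_of_step hx (y := fun t ω => (waitAge c A t ω : ℝ))
    (R := fun _ _ => 1 + 1 / x) (fun t => ?_) (fun t => ⟨c + t, fun ω => ?_⟩) (by positivity)
    (fun ω => rfl) (fun _ => integrable_const _) (fun _ => by simp) (fun t ω => ?_) t
  · exact measurable_from_top.comp (@measurable_waitAge _ _ _ (G t) t fun i hi =>
      hA.mono hi _ (hA.meas i))
  · rw [Nat.abs_cast]; exact_mod_cast waitAge_le t ω
  · rw [waitAge_step]
    set w := (waitAge c A t ω : ℝ)
    have h : 2 * w ≤ x * w ^ 2 + 1 / x := by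
      have : x * w ^ 2 + 1 / x - 2 * w = (x * w - 1) ^ 2 / x := by field_simp; ring
      have : 0 ≤ (x * w - 1) ^ 2 / x := by positivity
      linarith
    have hx' : 0 < 1 / x := by positivity
    by_cases hω : ω ∈ A t
    · simp only [hω, indicator_of_mem, Pi.one_apply]; nlinarith
    · simp only [hω, not_false_eq_true, indicator_of_notMem]; nlinarith

lemma integral_linkAge_sq_le (hA : IsTrialSequence Pr G A x) (hD : IsTrialSequence Pr G' D s)
    (hAG : ∀ t, MeasurableSet[G' t] (A t)) (hx : 0 < x) (hs : 0 < s) (c : ℕ) : ∃ C, 0 ≤ C ∧ ∀ t,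
    (∫ ω, (waitAge c A t ω : ℝ) ^ 2 ∂Pr ≤ C) ∧ ∫ ω, (linkAge c A D t ω : ℝ) ^ 2 ∂Pr ≤ C := by
  set K := (c : ℝ) ^ 2 + (1 + 1 / x) / x ^ 2 with hK
  have hK0 : 0 ≤ K := by positivity
  have hwm : ∀ t, Measurable (fun ω => (waitAge c A t ω : ℝ)) := fun t =>
    measurable_from_top.comp (measurable_waitAge fun i _ => hA.measurableSet i)
  have hwi : ∀ t, Integrable (fun ω => (waitAge c A t ω : ℝ) ^ 2) Pr := fun t =>
    integrable_of_bounded ((hwm t).pow_const 2) ⟨((c + t : ℕ) : ℝ) ^ 2, fun ω => by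
      rw [abs_pow, Nat.abs_cast]
      exact pow_le_pow_left₀ (by positivity) (by exact_mod_cast waitAge_le t ω) 2⟩
  have ha := hD.integral_sq_le_of_step hs (y := fun t ω => (linkAge c A D t ω : ℝ)) (c := c)
    (R := fun t ω => (waitAge c A (t + 1) ω : ℝ) ^ 2 + (1 + 1 / s)) (K := K + (1 + 1 / s))
    (fun t => ?_) (fun t => ⟨c + t, fun ω => ?_⟩) (by positivity)
    (fun ω => rfl) (fun t => (hwi _).add (integrable_const _)) (fun t => ?_) (fun t ω => ?_)
  · refine ⟨K + ((c : ℝ) ^ 2 + (K + (1 + 1 / s)) / s ^ 2), by positivity, fun t => ⟨?_, ?_⟩⟩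
    · have h1 : 0 ≤ (c : ℝ) ^ 2 + (K + (1 + 1 / s)) / s ^ 2 := by positivity
      linarith [hA.integral_waitAge_sq_le hx c t]
    · linarith [ha t]
  · exact measurable_from_top.comp (@measurable_linkAge _ _ _ _ (G' t) t
      (fun i hi => hD.mono hi.le _ (hAG i)) fun i hi => hD.mono hi _ (hD.meas i))
  · rw [Nat.abs_cast]; exact_mod_cast linkAge_le t ω
  · rw [integral_add (hwi _) (integrable_const _), integral_const, probReal_univ, one_smul]
    linarith [hA.integral_waitAge_sq_le hx c (t + 1)]
  · rw [linkAge_step]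
    set w := (waitAge c A (t + 1) ω : ℝ)
    set a := (linkAge c A D t ω : ℝ)
    have h : 2 * a ≤ s * a ^ 2 + 1 / s := by
      have : s * a ^ 2 + 1 / s - 2 * a = (s * a - 1) ^ 2 / s := by field_simp; ring
      have : 0 ≤ (s * a - 1) ^ 2 / s := by positivity
      linarith
    have hs' : 0 < 1 / s := by positivity
    by_cases hω : ω ∈ D t
    · simp only [hω, indicator_of_mem, Pi.one_apply]; nlinarith
    · simp only [hω, not_false_eq_true, indicator_of_notMem]; nlinarith [sq_nonneg w]

/-- The long-term average age for arrivals with probability `x` and services with probability `s`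
per slot. -/
theorem tendsto_average_linkAge (hA : IsTrialSequence Pr G A x) (hD : IsTrialSequence Pr G' D s)
    (hAG : ∀ t, MeasurableSet[G' t] (A t)) (hx : 0 < x) (hs : 0 < s) (c : ℕ) :
    ∀ᵐ ω ∂Pr, Tendsto (fun T : ℕ => (∑ t ∈ Finset.Icc 1 T, (linkAge c A D t ω : ℝ)) / T) atTop
      (𝓝 (1 / x + 1 / s - 1)) := by
  obtain ⟨C, hC0, hC⟩ := integral_linkAge_sq_le hA hD hAG hx hs c
  have hwG : ∀ t, Measurable[G t] (fun ω => (waitAge c A t ω : ℝ)) := fun t =>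
    measurable_from_top.comp (@measurable_waitAge _ _ _ (G t) t fun i hi =>
      hA.mono hi _ (hA.meas i))
  have hwG' : ∀ t, Measurable[G' t] (fun ω => (waitAge c A (t + 1) ω : ℝ)) := fun t =>
    measurable_from_top.comp (@measurable_waitAge _ _ _ (G' t) (t + 1) fun i hi =>
      hD.mono (Nat.lt_succ_iff.1 hi) _ (hAG i))
  have haG : ∀ t, Measurable[G' t] (fun ω => (linkAge c A D t ω : ℝ)) := fun t =>
    measurable_from_top.comp (@measurable_linkAge _ _ _ _ (G' t) t
      (fun i hi => hD.mono hi.le _ (hAG i)) fun i hi => hD.mono hi _ (hD.meas i))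
  have hwm : ∀ t, Measurable (fun ω => (waitAge c A t ω : ℝ)) := fun t =>
    (hwG t).mono (hA.le t) le_rfl
  have ham : ∀ t, Measurable (fun ω => (linkAge c A D t ω : ℝ)) := fun t =>
    (haG t).mono (hD.le t) le_rfl
  have hwb : ∀ t ω, |(waitAge c A t ω : ℝ)| ≤ c + t := fun t ω => by
    rw [Nat.abs_cast]; exact_mod_cast waitAge_le t ω
  have hab : ∀ t ω, |(linkAge c A D t ω : ℝ)| ≤ c + t := fun t ω => by
    rw [Nat.abs_cast]; exact_mod_cast linkAge_le t ω
  -- the jump of the age at a service in slot `t`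
  set y : ℕ → Ω → ℝ := fun t ω => waitAge c A (t + 1) ω - linkAge c A D t ω - 1 with hy
  have hyG : ∀ t, Measurable[G' t] (y t) := fun t =>
    Measurable.sub_const (Measurable.sub (hwG' t) (haG t)) 1
  have hyb : ∀ t ω, |y t ω| ≤ (c + (t + 1 : ℕ)) + (c + t) + 1 := fun t ω => by
    have h1 := hwb (t + 1) ω
    have h2 := hab t ω
    rw [abs_le] at *
    constructor <;> simp only [hy] <;> linarith
  have hsqi : ∀ {f : Ω → ℝ} {B : ℝ}, Measurable f → (∀ ω, |f ω| ≤ B) →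
      Integrable (fun ω => f ω ^ 2) Pr := fun {f B} hf hB =>
    integrable_of_bounded (hf.pow_const 2) ⟨B ^ 2, fun ω => by
      rw [abs_pow]; exact pow_le_pow_left₀ (abs_nonneg _) (hB ω) 2⟩
  have hyC : ∀ t, ∫ ω, y t ω ^ 2 ∂Pr ≤ 3 * (C + C + 1) := by
    intro t
    have iw := hsqi (hwm (t + 1)) (hwb (t + 1))
    have ia := hsqi (ham t) (hab t)
    have i2 : Integrable (fun ω => (waitAge c A (t + 1) ω : ℝ) ^ 2 + (linkAge c A D t ω : ℝ) ^ 2) Pr :=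
      iw.add ia
    have i1 : Integrable (fun ω => (waitAge c A (t + 1) ω : ℝ) ^ 2 + (linkAge c A D t ω : ℝ) ^ 2 + 1)
        Pr := i2.add (integrable_const 1)
    have h := integral_mono (hsqi ((hyG t).mono (hD.le t) le_rfl) (hyb t)) (i1.const_mul 3)
      (fun ω => by
        simp only [hy]
        nlinarith [sq_nonneg ((waitAge c A (t + 1) ω : ℝ) + linkAge c A D t ω),
          sq_nonneg ((waitAge c A (t + 1) ω : ℝ) + 1), sq_nonneg ((linkAge c A D t ω : ℝ) - 1)])
    rw [integral_const_mul, integral_add i2 (integrable_const _), integral_add iw ia,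
      integral_const, probReal_univ, one_smul] at h
    linarith [(hC (t + 1)).1, (hC t).2]
  have hge : ∀ n : ℕ, C ≤ C * ((n : ℝ) + 1) ^ 2 := fun n => by
    refine le_mul_of_one_le_right hC0 (one_le_pow₀ (by linarith [n.cast_nonneg (α := ℝ)]))
  -- the four terms in the summation formula that are negligible after division by `T`
  have e1 := tendsto_div_sq_of_integral_sq_le hwm (fun t => ⟨_, hwb t⟩) (C := C)
    fun n => (hC _).1.trans (hge n)
  have e2 := tendsto_div_sq_of_integral_sq_le ham (fun t => ⟨_, hab t⟩) (C := C)
    fun n => (hC _).2.trans (hge n)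
  have e3 := tendsto_div_sq_of_integral_sq_le (Pr := Pr)
    (fun T => (hA.measurable_transform hwG T).mono (hA.le T) le_rfl)
    (hA.bounded_transform fun t => ⟨_, hwb t⟩) (C := C) fun n => by
      have := hA.integral_transform_sq_le hwG (fun t => ⟨_, hwb t⟩) (fun t => (hC t).1) ((n + 1) ^ 2)
      exact_mod_cast this
  have e4 := tendsto_div_sq_of_integral_sq_le (Pr := Pr)
    (fun T => (hD.measurable_transform hyG T).mono (hD.le T) le_rfl)
    (hD.bounded_transform fun t => ⟨_, hyb t⟩) (C := 3 * (C + C + 1)) fun n => by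
      have := hD.integral_transform_sq_le hyG (fun t => ⟨_, hyb t⟩) hyC ((n + 1) ^ 2)
      exact_mod_cast this
  filter_upwards [e1, e2, e3, e4] with ω h1 h2 h3 h4
  set U : ℕ → ℝ := fun T => ∑ t ∈ Finset.Icc 1 T, (linkAge c A D t ω : ℝ) with hU
  have hmono : Monotone U := fun T T' h => Finset.sum_le_sum_of_subset_of_nonneg
    (Finset.Icc_subset_Icc_right h) fun _ _ _ => by positivity
  have hsq : Tendsto (fun n : ℕ => ((n : ℝ) + 1) ^ 2) atTop atTop :=
    (tendsto_pow_atTop two_ne_zero).comp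
      (tendsto_atTop_add_const_right _ 1 tendsto_natCast_atTop_atTop)
  have hlim : Tendsto (fun n : ℕ => U ((n + 1) ^ 2) / (((n + 1) ^ 2 : ℕ) : ℝ)) atTop
      (𝓝 (1 / x + 1 / s - 1)) := by
    have hc : ∀ r : ℝ, Tendsto (fun n : ℕ => r / ((n : ℝ) + 1) ^ 2) atTop (𝓝 0) := fun r =>
      hsq.const_div_atTop r
    have := (((((hc c).sub h2).add h4).div_const s).add ((((hc c).sub h1).sub h3).div_const x)
      |>.add h1 |>.add h2 |>.sub (hc (2 * c))).const_add (1 / x + 1 / s - 1)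
    simp only [sub_zero, add_zero, zero_div] at this
    refine this.congr fun n => ?_
    have hn : ((n : ℝ) + 1) ^ 2 ≠ 0 := by positivity
    simp only [hU]
    rw [sum_linkAge hx.ne' hs.ne']
    push_cast
    field_simp
    ring
  -- the partial sums are monotone, so the limit along the squares is the limit
  refine tendsto_div_of_monotone_of_exists_subseq_tendsto_div U _ hmono fun a ha => ?_
  refine ⟨fun n => (n + 1) ^ 2, ?_, ?_, hlim⟩
  · have h5 : Tendsto (fun n : ℕ => (1 + 1 / ((n : ℝ) + 1)) ^ 2) atTop (𝓝 1) := by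
      have := ((tendsto_one_div_add_atTop_nhds_zero_nat (𝕜 := ℝ)).const_add 1).pow 2
      simpa using this
    filter_upwards [h5.eventually (gt_mem_nhds ha)] with n hn
    have hn1 : (0 : ℝ) < (n : ℝ) + 1 := by positivity
    have h6 : (1 + 1 / ((n : ℝ) + 1)) ^ 2 * ((n : ℝ) + 1) ^ 2 = ((n : ℝ) + 1 + 1) ^ 2 := by
      field_simp
    push_cast
    rw [← h6]
    exact mul_le_mul_of_nonneg_right hn.le (by positivity)
  · exact tendsto_atTop_mono (fun n => (Nat.le_succ n).trans (Nat.le_self_pow two_ne_zero _))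
      tendsto_id

end IsTrialSequence

/-! ### The network average age of information -/

/-- Position of a driving variable in the temporal order: the arrival coin of slot `t` comes before
the other variables of that slot. -/
def noiseRank : Noise → ℕ
  | .mark _ => 0
  | .arrival t => 2 * t
  | .access t => 2 * t + 1
  | .fading t => 2 * t + 1
  | .bufferI _ t => 2 * t + 1
  | .accessI _ t => 2 * t + 1
  | .fadingI _ t => 2 * t + 1

/-- The driving variables before position `n` in the temporal order. -/
def noisePast (n : ℕ) : Set Noise := {i | noiseRank i < n}

/-- The driving variables at position `n` in the temporal order. -/
def noiseAt (n : ℕ) : Set Noise := {i | noiseRank i = n}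

lemma mem_noisePast {n : ℕ} {i : Noise} : i ∈ noisePast n ↔ noiseRank i < n := Iff.rfl

lemma mem_noiseAt {n : ℕ} {i : Noise} : i ∈ noiseAt n ↔ noiseRank i = n := Iff.rfl

lemma arrival_mem_noiseAt (t : ℕ) : Noise.arrival t ∈ noiseAt (2 * t) := mem_noiseAt.2 rfl

lemma access_mem_noiseAt (t : ℕ) : Noise.access t ∈ noiseAt (2 * t + 1) := mem_noiseAt.2 rfl

lemma noisePast_mono {n m : ℕ} (h : n ≤ m) : noisePast n ⊆ noisePast m :=
  fun _ hi => mem_noisePast.2 ((mem_noisePast.1 hi).trans_le h)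

lemma noiseAt_subset_noisePast {n m : ℕ} (h : n < m) : noiseAt n ⊆ noisePast m :=
  fun _ hi => mem_noisePast.2 ((mem_noiseAt.1 hi).trans_lt h)

lemma disjoint_noiseAt_noisePast (n : ℕ) : Disjoint (noiseAt n) (noisePast n) :=
  Set.disjoint_left.2 fun _ hi hi' => (mem_noisePast.1 hi').ne (mem_noiseAt.1 hi)

namespace MeanFieldNetwork
variable {P : NetworkParams} {ν : Measure ℝ} {Ω : Type*} [MeasurableSpace Ω] {Pr : Measure Ω}

/-- The events decided by the driving variables with indices in `S`. -/
@[reducible] def noiseAlgebra (N : MeanFieldNetwork P ν Pr) (S : Set Noise) : MeasurableSpace Ω :=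
  ⨆ i ∈ S, MeasurableSpace.comap (N.Z i) inferInstance

lemma noiseAlgebra_mono (N : MeanFieldNetwork P ν Pr) {S T : Set Noise} (h : S ⊆ T) :
    N.noiseAlgebra S ≤ N.noiseAlgebra T := biSup_mono h

lemma noiseAlgebra_le (N : MeanFieldNetwork P ν Pr) (S : Set Noise) :
    N.noiseAlgebra S ≤ ‹MeasurableSpace Ω› := iSup₂_le fun i _ => (N.measurable_Z i).comap_le

lemma measurable_Z_noiseAlgebra (N : MeanFieldNetwork P ν Pr) {S : Set Noise} {i : Noise}
    (hi : i ∈ S) : Measurable[N.noiseAlgebra S] (N.Z i) :=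
  (comap_measurable (N.Z i)).mono (le_iSup₂_of_le i hi le_rfl) le_rfl

lemma measurableSet_noiseAlgebra_le (N : MeanFieldNetwork P ν Pr) {S : Set Noise} {i : Noise}
    (hi : i ∈ S) (a : ℝ) : MeasurableSet[N.noiseAlgebra S] {ω | N.Z i ω ≤ a} :=
  N.measurable_Z_noiseAlgebra hi measurableSet_Iic

lemma indep_noiseAlgebra (N : MeanFieldNetwork P ν Pr) {S T : Set Noise} (h : Disjoint S T) :
    Indep (N.noiseAlgebra S) (N.noiseAlgebra T) Pr :=
  indep_iSup_of_disjoint (fun i => (N.measurable_Z i).comap_le) N.indep_Z.iIndep h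

/-- Arrivals, as a function of the driving variables of all slots. -/
def arrivalSet (P : NetworkParams) (t : ℕ) : Set ((ℕ → Plane × ℝ) × (ℕ → SlotNoise)) :=
  {z | z.2 t none 0 ≤ P.xi}

/-- Access to the channel together with successful decoding, as a function of the topology and of
the driving variables of all slots. -/
def serviceSet (P : NetworkParams) (t : ℕ) : Set ((ℕ → Plane × ℝ) × (ℕ → SlotNoise)) :=
  {z | z.2 t none 1 ≤ P.p ∧ (z.1, z.2 t) ∈ P.decodeSet}

lemma measurableSet_arrivalSet (t : ℕ) : MeasurableSet (arrivalSet P t) :=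
  measurableSet_le (by fun_prop) measurable_const

lemma measurableSet_serviceSet (t : ℕ) : MeasurableSet (serviceSet P t) := by
  have h1 : MeasurableSet {z : (ℕ → Plane × ℝ) × (ℕ → SlotNoise) | z.2 t none 1 ≤ P.p} :=
    measurableSet_le (by fun_prop) measurable_const
  have h2 : Measurable fun z : (ℕ → Plane × ℝ) × (ℕ → SlotNoise) => (z.1, z.2 t) := by fun_prop
  exact h1.inter (h2 P.measurableSet_decodeSet)

/-- The buffered packet, if there is one, is the freshest packet that has arrived; otherwise that
packet has been delivered. -/
lemma linkState_spec (N : MeanFieldNetwork P ν Pr) (ω : Ω) (t : ℕ) :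
    (N.linkState ω t).age =
      linkAge N.initialAge (arrivalSet P) (serviceSet P) t (N.config ω, fun t => N.slot t ω) ∧
    ∃ w, w = waitAge N.initialAge (arrivalSet P) t (N.config ω, fun t => N.slot t ω) ∧
    ((N.linkState ω t).buffer = none → w = (N.linkState ω t).age) ∧
    ∀ g, (N.linkState ω t).buffer = some g → g < t ∧ w = t - g := by
  classical
  induction t with
  | zero => exact ⟨rfl, _, rfl, fun _ => rfl, fun g hg => by simp [linkState] at hg⟩
  | succ t ih =>
    set z : (ℕ → Plane × ℝ) × (ℕ → SlotNoise) := (N.config ω, fun t => N.slot t ω) with hz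
    obtain ⟨h1, w, hw, h2, h3⟩ := ih
    have hA : z ∈ arrivalSet P t ↔ N.Arrives t ω := Iff.rfl
    have hD : z ∈ serviceSet P t ↔ N.Accesses t ω ∧ N.Decodes t ω := Iff.rfl
    have e1 : waitAge N.initialAge (arrivalSet P) (t + 1) z =
        if N.Arrives t ω then 1 else w + 1 := by
      rw [waitAge, ← hw]; simp only [hA]
    have e2 : linkAge N.initialAge (arrivalSet P) (serviceSet P) (t + 1) z =
        if N.Accesses t ω ∧ N.Decodes t ω then (if N.Arrives t ω then 1 else w + 1)
          else (N.linkState ω t).age + 1 := by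
      rw [linkAge, e1, ← h1]; simp only [hD]
    rw [e1, e2]
    refine ⟨?_, _, rfl, ?_⟩
    all_goals
      rw [linkState]
      generalize N.linkState ω t = st at *
      obtain ⟨a, b⟩ := st
      rcases b with _ | g
      · have h4 : w = a := h2 rfl
        by_cases ha : N.Arrives t ω <;> by_cases hd : N.Accesses t ω ∧ N.Decodes t ω <;>
          simp only [ha, hd, if_true, if_false] <;> simp [h4]
      · have h4 : g < t ∧ w = t - g := h3 g rfl
        by_cases ha : N.Arrives t ω <;> by_cases hd : N.Accesses t ω ∧ N.Decodes t ω <;>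
          simp only [ha, hd, if_true, if_false] <;> simp <;> omega

/-- Arrivals form a sequence of independent trials. -/
lemma isTrialSequence_arrival (N : MeanFieldNetwork P ν Pr) :
    IsTrialSequence Pr (fun t => N.noiseAlgebra (noisePast (2 * t)))
      (fun t => {ω | N.Arrives t ω}) P.xi where
  mono _ _ h := N.noiseAlgebra_mono (noisePast_mono (by omega))
  le _ := N.noiseAlgebra_le _
  meas t := N.measurableSet_noiseAlgebra_le
    (noiseAt_subset_noisePast (by omega) (arrival_mem_noiseAt t)) _
  indep t := ⟨N.noiseAlgebra (noiseAt (2 * t)), N.measurableSet_noiseAlgebra_le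
    (arrival_mem_noiseAt t) _, N.indep_noiseAlgebra (disjoint_noiseAt_noisePast _)⟩
  prob t := by
    have h := N.measure_coin_le (i := .arrival t) rfl ⟨P.xi_pos.le, P.xi_le_one⟩
    rw [Measure.real, ← ENNReal.toReal_ofReal P.xi_pos.le, ← h]
    rfl

/-- The interferers and the fading of the typical link in slot `t`, without the arrival and access
coins of the typical link. -/
def channelSlot (N : MeanFieldNetwork P ν Pr) (t : ℕ) (ω : Ω) : SlotNoise
  | none => ![0, 0, N.Z (.fading t) ω]
  | some j => N.slot t ω (some j)

lemma measurable_channelSlot (N : MeanFieldNetwork P ν Pr) (t : ℕ) :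
    Measurable[N.noiseAlgebra (noiseAt (2 * t + 1) \ {.access t})] (N.channelSlot t) := by
  refine @measurable_pi_lambda _ _ _ (_) _ _ fun o => @measurable_pi_lambda _ _ _ (_) _ _ fun k => ?_
  rcases o with _ | j
  · fin_cases k
    · exact @measurable_const _ _ _ (_) _
    · exact @measurable_const _ _ _ (_) _
    · exact N.measurable_Z_noiseAlgebra ⟨rfl, by simp⟩
  · refine N.measurable_Z_noiseAlgebra (i := noiseIdx t (some j) k) ?_
    fin_cases k <;> exact ⟨rfl, by simp [noiseIdx]⟩

lemma decodeSet_channelSlot (N : MeanFieldNetwork P ν Pr) (φ : ℕ → Plane × ℝ) (t : ℕ) (ω : Ω) :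
    (φ, N.slot t ω) ∈ P.decodeSet ↔ (φ, N.channelSlot t ω) ∈ P.decodeSet := Iff.rfl

lemma measurableSet_decode (N : MeanFieldNetwork P ν Pr) (φ : ℕ → Plane × ℝ) (t : ℕ) :
    MeasurableSet[N.noiseAlgebra (noiseAt (2 * t + 1) \ {.access t})]
      {ω | (φ, N.slot t ω) ∈ P.decodeSet} := by
  have h : {ω | (φ, N.slot t ω) ∈ P.decodeSet} = N.channelSlot t ⁻¹' (Prod.mk φ ⁻¹' P.decodeSet) :=
    Set.ext fun ω => N.decodeSet_channelSlot φ t ω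
  rw [h]
  exact N.measurable_channelSlot t (measurable_prodMk_left P.measurableSet_decodeSet)

lemma measureReal_service (N : MeanFieldNetwork P ν Pr) (φ : ℕ → Plane × ℝ) (t : ℕ) :
    Pr.real {ω | N.Accesses t ω ∧ (φ, N.slot t ω) ∈ P.decodeSet} =
      P.p * Pr.real {ω | (φ, N.slot t ω) ∈ P.decodeSet} := by
  have hacc : MeasurableSet[N.noiseAlgebra {.access t}] {ω | N.Accesses t ω} :=
    N.measurableSet_noiseAlgebra_le (i := .access t) (mem_singleton _) P.p
  have hind : Indep (N.noiseAlgebra {.access t})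
      (N.noiseAlgebra (noiseAt (2 * t + 1) \ {.access t})) Pr :=
    N.indep_noiseAlgebra disjoint_sdiff_right
  have hi := (Indep_iff _ _ _).1 hind _ _ hacc (N.measurableSet_decode φ t)
  have h : Pr {ω | N.Accesses t ω} = ENNReal.ofReal P.p :=
    N.measure_coin_le (i := .access t) rfl ⟨P.p_pos.le, P.p_lt_one.le⟩
  rw [Measure.real, ofPred_and, hi, ENNReal.toReal_mul, h, ENNReal.toReal_ofReal P.p_pos.le,
    Measure.real]

/-- For a fixed topology, services form a sequence of independent trials. -/
lemma isTrialSequence_service (N : MeanFieldNetwork P ν Pr) {φ : ℕ → Plane × ℝ} {μ : ℝ}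
    (hμ : ∀ t, Pr.real {ω | (φ, N.slot t ω) ∈ P.decodeSet} = μ) :
    IsTrialSequence Pr (fun t => N.noiseAlgebra (noisePast (2 * t + 1)))
      (fun t => {ω | N.Accesses t ω ∧ (φ, N.slot t ω) ∈ P.decodeSet}) (P.p * μ) := by
  have hmeas : ∀ t, MeasurableSet[N.noiseAlgebra (noiseAt (2 * t + 1))]
      {ω | N.Accesses t ω ∧ (φ, N.slot t ω) ∈ P.decodeSet} := fun t => by
    rw [ofPred_and]
    exact MeasurableSet.inter (m := N.noiseAlgebra (noiseAt (2 * t + 1)))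
      (N.measurableSet_noiseAlgebra_le (access_mem_noiseAt t) _)
      (N.noiseAlgebra_mono sdiff_subset _ (N.measurableSet_decode φ t))
  exact
    { mono := fun _ _ h => N.noiseAlgebra_mono (noisePast_mono (by omega))
      le := fun _ => N.noiseAlgebra_le _
      meas := fun t => N.noiseAlgebra_mono (noiseAt_subset_noisePast (by omega)) _ (hmeas t)
      indep := fun t => ⟨N.noiseAlgebra (noiseAt (2 * t + 1)), hmeas t,
        N.indep_noiseAlgebra (disjoint_noiseAt_noisePast _)⟩
      prob := fun t => by rw [N.measureReal_service φ t, hμ] }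

variable [IsProbabilityMeasure Pr]

/-- The time average of the age of information, given the topology. -/
lemma ae_tendsto_average_aoi [IsProbabilityMeasure ν] (N : MeanFieldNetwork P ν Pr)
    (hν : ν (Icc 0 1) = 1) (t : ℕ) : ∀ᵐ ω ∂Pr,
      limsup (fun T : ℕ => (∑ t ∈ Finset.Icc 1 T, (N.aoi t ω : ℝ≥0∞)) / (T : ℝ≥0∞)) atTop =
        ENNReal.ofReal (1 / P.xi - 1) + (ENNReal.ofReal (P.p * N.successProb t ω))⁻¹ := by
  set U : ((ℕ → Plane × ℝ) × (ℕ → SlotNoise)) → ℕ → ℝ≥0∞ := fun z T =>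
    (∑ t ∈ Finset.Icc 1 T, (linkAge N.initialAge (arrivalSet P) (serviceSet P) t z : ℝ≥0∞)) /
      (T : ℝ≥0∞) with hU
  set μ : (ℕ → Plane × ℝ) → ℝ≥0∞ := fun φ => Pr {ω | (φ, N.slot t ω) ∈ P.decodeSet} with hμ
  have hUm : ∀ T, Measurable fun z => U z T := fun T =>
    (Finset.measurable_fun_sum _ fun t _ => measurable_from_top.comp
      (measurable_linkAge (fun i _ => measurableSet_arrivalSet i)
        fun i _ => measurableSet_serviceSet i)).div_const _
  have hμm : Measurable μ := by
    have h : μ = fun φ => (Pr.map (N.slot t)) (Prod.mk φ ⁻¹' P.decodeSet) := by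
      funext φ
      rw [hμ, Measure.map_apply (N.measurable_slot t)
        (measurable_prodMk_left P.measurableSet_decodeSet)]
      rfl
    rw [h]
    have := Measure.isProbabilityMeasure_map (μ := Pr) (N.measurable_slot t).aemeasurable
    exact measurable_measure_prodMk_left P.measurableSet_decodeSet
  set S : Set ((ℕ → Plane × ℝ) × (ℕ → SlotNoise)) := {z | limsup (U z) atTop =
    ENNReal.ofReal (1 / P.xi - 1) + (ENNReal.ofReal P.p * μ z.1)⁻¹} with hS
  have hSm : MeasurableSet S := measurableSet_eq_fun (Measurable.limsup hUm)
    (((hμm.comp measurable_fst).const_mul _).inv.const_add _)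
  -- the topology is independent of the slots, so that it may be fixed
  have key := ae_of_indepFun N.measurable_config (measurable_pi_lambda _ N.measurable_slot)
    N.indepFun_config_slots hSm ?_
  · filter_upwards [key, N.successProb_ae_eq t] with ω h1 h2
    have h3 : ∀ T : ℕ, (∑ t ∈ Finset.Icc 1 T, (N.aoi t ω : ℝ≥0∞)) / (T : ℝ≥0∞) =
        U (N.config ω, fun t => N.slot t ω) T := fun T => by
      simp only [hU, aoi, (N.linkState_spec ω _).1]
    simp_rw [h3]
    rw [h2, ENNReal.ofReal_mul P.p_pos.le, Measure.real, ENNReal.ofReal_toReal (measure_ne_top _ _)]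
    exact h1
  · filter_upwards [N.ae_marks_mem hν, N.ae_totalLoss_ne_top hν] with ω h1 h2
    set φ := N.config ω with hφ
    have hdec := fun t => N.measure_decodes t (φ := φ) h1
    have hμt : μ φ = expNeg (ENNReal.ofReal P.noise + ∑' j, ENNReal.ofReal (P.logLoss (φ j))) := hdec t
    have hreal : ∀ t', Pr.real {ω' | (φ, N.slot t' ω') ∈ P.decodeSet} = (μ φ).toReal := fun t' => by
      rw [Measure.real, hdec t', hμt]
    have hpos : 0 < (μ φ).toReal := by
      have : μ φ = expNeg (ENNReal.ofReal (P.noise + (N.totalLoss ω).toReal)) := by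
        rw [hμt, ENNReal.ofReal_add P.noise_pos.le ENNReal.toReal_nonneg,
          ENNReal.ofReal_toReal h2]
        rfl
      rw [this, expNeg_ofReal (add_nonneg P.noise_pos.le ENNReal.toReal_nonneg),
        ENNReal.toReal_ofReal (Real.exp_nonneg _)]
      exact Real.exp_pos _
    have hs : 0 < P.p * (μ φ).toReal := mul_pos P.p_pos hpos
    have hmain := IsTrialSequence.tendsto_average_linkAge N.isTrialSequence_arrival
      (N.isTrialSequence_service hreal) (fun t => N.measurableSet_noiseAlgebra_le
        (noiseAt_subset_noisePast (Nat.lt_succ_self _) (arrival_mem_noiseAt t)) _)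
      P.xi_pos hs N.initialAge
    filter_upwards [hmain] with ω' h'
    set z : (ℕ → Plane × ℝ) × (ℕ → SlotNoise) := (φ, fun t => N.slot t ω') with hz
    have hcomp : ∀ t, linkAge N.initialAge (fun t => {ω | N.Arrives t ω})
        (fun t => {ω | N.Accesses t ω ∧ (φ, N.slot t ω) ∈ P.decodeSet}) t ω' =
        linkAge N.initialAge (arrivalSet P) (serviceSet P) t z := fun t =>
      linkAge_comp (A := arrivalSet P) (D := serviceSet P) (fun ω => (φ, fun t => N.slot t ω)) t ω'
    have hlim : Tendsto (U z) atTop (𝓝 (ENNReal.ofReal (1 / P.xi + 1 / (P.p * (μ φ).toReal) - 1))) := by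
      refine ((ENNReal.continuous_ofReal.tendsto _).comp h').congr' ?_
      filter_upwards [eventually_gt_atTop 0] with T hT
      have hT' : (0 : ℝ) < T := by exact_mod_cast hT
      simp only [Function.comp_apply, hU, hcomp]
      rw [ENNReal.ofReal_div_of_pos hT', ENNReal.ofReal_natCast, ENNReal.ofReal_sum_of_nonneg
        fun _ _ => by positivity]
      simp only [ENNReal.ofReal_natCast]
    change limsup (U z) atTop = _
    rw [hlim.limsup_eq, show 1 / P.xi + 1 / (P.p * (μ φ).toReal) - 1 =
      (1 / P.xi - 1) + (P.p * (μ φ).toReal)⁻¹ by rw [one_div (P.p * _)]; ring,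
      ENNReal.ofReal_add (by
        have := one_le_one_div P.xi_pos P.xi_le_one
        linarith) (by positivity), ENNReal.ofReal_inv_of_pos hs,
      ENNReal.ofReal_mul P.p_pos.le, ENNReal.ofReal_toReal (measure_ne_top _ _)]

theorem averageAoI_eq [IsProbabilityMeasure ν] (N : MeanFieldNetwork P ν Pr)
    (hν : ν (Icc 0 1) = 1) (t : ℕ) :
    N.averageAoI = ENNReal.ofReal (1 / P.xi - 1) +
      ∫⁻ ω, (ENNReal.ofReal (P.p * N.successProb t ω))⁻¹ ∂Pr := by
  rw [averageAoI, lintegral_congr_ae (N.ae_tendsto_average_aoi hν t),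
    lintegral_add_left measurable_const, lintegral_const, measure_univ, mul_one]

theorem averageAoI_of_selfConsistent [IsProbabilityMeasure ν] (N : MeanFieldNetwork P ν Pr)
    (hν : ν (Icc 0 1) = 1) (h : N.SelfConsistent) :
    N.averageAoI = ENNReal.ofReal (1 / P.xi - 1) +
      ∫⁻ t in Icc (0 : ℝ) 1, (ENNReal.ofReal (P.p * t))⁻¹ ∂ν := by
  have hm : AEMeasurable (N.successProb 0) Pr :=
    N.measurable_logSuccess.exp.aemeasurable.congr (N.successProb_ae_eq_exp hν 0).symm
  have hres : ν.restrict (Icc 0 1) = ν :=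
    Measure.restrict_eq_self_of_ae_mem ((prob_compl_eq_zero_iff measurableSet_Icc).2 hν)
  have hf : Measurable fun t : ℝ => (ENNReal.ofReal (P.p * t))⁻¹ := by fun_prop
  have hmap := lintegral_map' (μ := Pr) hf.aemeasurable hm
  rw [h 0] at hmap
  rw [hres, N.averageAoI_eq hν 0, hmap]

end MeanFieldNetwork

/-! ### Beta densities with prescribed mean -/

section BetaDensity

lemma lintegral_beta_kernel {a b : ℝ} (ha : 0 < a) (hb : 0 < b) :
    ∫⁻ t in Ioo (0 : ℝ) 1, ENNReal.ofReal (t ^ (a - 1) * (1 - t) ^ (b - 1)) =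
      ENNReal.ofReal (beta a b) := by
  have hB := beta_pos ha hb
  have h := lintegral_betaPDF_eq_one ha hb
  rw [lintegral_betaPDF] at h
  have h2 : ∀ t : ℝ, ENNReal.ofReal (1 / beta a b * t ^ (a - 1) * (1 - t) ^ (b - 1)) =
      ENNReal.ofReal (1 / beta a b) * ENNReal.ofReal (t ^ (a - 1) * (1 - t) ^ (b - 1)) := fun t => by
    rw [mul_assoc, ENNReal.ofReal_mul (by positivity)]
  simp_rw [h2] at h
  rw [lintegral_const_mul _ (by fun_prop)] at h
  calc _ = ENNReal.ofReal (beta a b) * (ENNReal.ofReal (1 / beta a b) *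
        ∫⁻ t in Ioo (0 : ℝ) 1, ENNReal.ofReal (t ^ (a - 1) * (1 - t) ^ (b - 1))) := by
        rw [← mul_assoc, ← ENNReal.ofReal_mul hB.le, mul_one_div_cancel hB.ne', ENNReal.ofReal_one,
          one_mul]
    _ = _ := by rw [h, mul_one]

lemma beta_kernel_nonneg {a b t : ℝ} (ht : t ∈ Ioo (0 : ℝ) 1) :
    0 ≤ t ^ (a - 1) * (1 - t) ^ (b - 1) :=
  mul_nonneg (Real.rpow_nonneg ht.1.le _) (Real.rpow_nonneg (by linarith [ht.2]) _)

lemma integrableOn_beta_kernel {a b : ℝ} (ha : 0 < a) (hb : 0 < b) :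
    IntegrableOn (fun t : ℝ => t ^ (a - 1) * (1 - t) ^ (b - 1)) (Ioo 0 1) := by
  refine (lintegral_ofReal_ne_top_iff_integrable (Measurable.aestronglyMeasurable (by fun_prop)) ?_).1 ?_
  · filter_upwards [ae_restrict_mem measurableSet_Ioo] with t ht using beta_kernel_nonneg ht
  · rw [lintegral_beta_kernel ha hb]; exact ENNReal.ofReal_ne_top

lemma integral_beta_kernel {a b : ℝ} (ha : 0 < a) (hb : 0 < b) :
    ∫ t in Ioo (0 : ℝ) 1, t ^ (a - 1) * (1 - t) ^ (b - 1) = beta a b := by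
  rw [integral_eq_lintegral_of_nonneg_ae _ (Measurable.aestronglyMeasurable (by fun_prop)),
    lintegral_beta_kernel ha hb, ENNReal.toReal_ofReal (beta_pos ha hb).le]
  filter_upwards [ae_restrict_mem measurableSet_Ioo] with t ht using beta_kernel_nonneg ht

lemma beta_add_one {a b : ℝ} (ha : 0 < a) (hb : 0 < b) :
    beta (a + 1) b = a / (a + b) * beta a b := by
  have h1 := Real.Gamma_add_one ha.ne'
  have h2 := Real.Gamma_add_one (add_pos ha hb).ne'
  have h3 := (Real.Gamma_pos_of_pos (add_pos ha hb)).ne'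
  have h4 : a + b ≠ 0 := (add_pos ha hb).ne'
  rw [beta, beta, show a + 1 + b = a + b + 1 by ring, h1, h2]
  field_simp

/-- The first parameter of the Beta distribution with density `betaTypeDensity κ β`. -/
def betaShape (κ β : ℝ) : ℝ := κ * β / (1 - κ)

lemma betaShape_pos {κ β : ℝ} (hκ : 0 < κ) (hκ1 : κ < 1) (hβ : 0 < β) : 0 < betaShape κ β :=
  div_pos (mul_pos hκ hβ) (by linarith)

lemma betaTypeDensity_eq {κ : ℝ} (hκ1 : κ < 1) (β u : ℝ) : betaTypeDensity κ β u =
    u ^ (betaShape κ β - 1) * (1 - u) ^ (β - 1) / beta (betaShape κ β) β := by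
  have : 1 - κ ≠ 0 := by linarith
  rw [betaTypeDensity, betaShape, show (κ * (β + 1) - 1) / (1 - κ) = κ * β / (1 - κ) - 1 by
    field_simp; ring]

@[fun_prop]
lemma measurable_betaTypeDensity (κ β : ℝ) : Measurable (betaTypeDensity κ β) := by
  unfold betaTypeDensity; fun_prop

lemma betaTypeDensity_nonneg {κ β t : ℝ} (hκ : 0 < κ) (hκ1 : κ < 1) (hβ : 0 < β)
    (ht : t ∈ Ioo (0 : ℝ) 1) : 0 ≤ betaTypeDensity κ β t := by
  rw [betaTypeDensity_eq hκ1]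
  exact div_nonneg (beta_kernel_nonneg ht) (beta_pos (betaShape_pos hκ hκ1 hβ) hβ).le

lemma densityMeasure_congr {f g : ℝ → ℝ} (h : ∀ t ∈ Ioo (0 : ℝ) 1, f t = g t) :
    densityMeasure f = densityMeasure g := by
  refine withDensity_congr_ae ?_
  filter_upwards [ae_restrict_mem measurableSet_Ioo] with t ht
  rw [h t ht]

lemma isProbabilityMeasure_betaTypeDensity {κ β : ℝ} (hκ : 0 < κ) (hκ1 : κ < 1) (hβ : 0 < β) :
    IsProbabilityMeasure (densityMeasure (betaTypeDensity κ β)) := by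
  have ha := betaShape_pos hκ hκ1 hβ
  have hB := beta_pos ha hβ
  refine ⟨?_⟩
  rw [densityMeasure, withDensity_apply _ MeasurableSet.univ, Measure.restrict_univ]
  simp_rw [betaTypeDensity_eq hκ1, ENNReal.ofReal_div_of_pos hB, div_eq_mul_inv]
  rw [lintegral_mul_const _ (by fun_prop), lintegral_beta_kernel ha hβ]
  exact ENNReal.mul_inv_cancel (by simpa using hB) ENNReal.ofReal_ne_top

lemma ae_densityMeasure (f : ℝ → ℝ) : ∀ᵐ t ∂densityMeasure f, t ∈ Ioo (0 : ℝ) 1 :=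
  (withDensity_absolutelyContinuous _ _).ae_le (ae_restrict_mem measurableSet_Ioo)

lemma densityMeasure_restrict (f : ℝ → ℝ) :
    (densityMeasure f).restrict (Icc 0 1) = densityMeasure f :=
  Measure.restrict_eq_self_of_ae_mem
    ((ae_densityMeasure f).mono fun _ ht => Ioo_subset_Icc_self ht)

lemma integral_densityMeasure {f : ℝ → ℝ} (hf : Measurable f)
    (hf0 : ∀ t ∈ Ioo (0 : ℝ) 1, 0 ≤ f t) (g : ℝ → ℝ) :
    ∫ t, g t ∂densityMeasure f = ∫ t in Ioo (0 : ℝ) 1, f t * g t := by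
  rw [densityMeasure, integral_withDensity_eq_integral_toReal_smul hf.ennreal_ofReal
    (ae_of_all _ fun t => ENNReal.ofReal_lt_top)]
  refine setIntegral_congr_fun measurableSet_Ioo fun t ht => ?_
  simp only [ENNReal.toReal_ofReal (hf0 t ht), smul_eq_mul]

variable {κ β : ℝ} (hκ : 0 < κ) (hκ1 : κ < 1) (hβ : 0 < β)

include hκ hκ1 hβ in
lemma integral_pow_betaTypeDensity (m : ℕ) : ∫ t, t ^ m ∂densityMeasure (betaTypeDensity κ β) =
    beta (betaShape κ β + m) β / beta (betaShape κ β) β := by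
  have ha := betaShape_pos hκ hκ1 hβ
  rw [integral_densityMeasure (by fun_prop) fun t ht => betaTypeDensity_nonneg hκ hκ1 hβ ht,
    ← integral_beta_kernel (add_pos_of_pos_of_nonneg ha m.cast_nonneg) hβ, ← integral_div]
  refine setIntegral_congr_fun measurableSet_Ioo fun t ht => ?_
  rw [betaTypeDensity_eq hκ1, show betaShape κ β + m - 1 = betaShape κ β - 1 + m by ring,
    Real.rpow_add_natCast ht.1.ne']
  ring

include hκ hκ1 hβ in
lemma integral_id_betaTypeDensity : ∫ t, t ^ 1 ∂densityMeasure (betaTypeDensity κ β) = κ := by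
  have ha := betaShape_pos hκ hκ1 hβ
  have hB := (beta_pos ha hβ).ne'
  rw [integral_pow_betaTypeDensity hκ hκ1 hβ, Nat.cast_one, beta_add_one ha hβ,
    mul_div_cancel_right₀ _ hB, betaShape]
  have h1 : 1 - κ ≠ 0 := by linarith
  have h2 : κ * β / (1 - κ) + β = β / (1 - κ) := by field_simp; ring
  rw [h2]
  field_simp

/-- The second moment of the Beta distribution with density `betaTypeDensity κ β`. -/
def betaSecondMoment (κ β : ℝ) : ℝ := κ * (κ * β + (1 - κ)) / (β + (1 - κ))

include hκ hκ1 hβ in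
lemma integral_sq_betaTypeDensity :
    ∫ t, t ^ 2 ∂densityMeasure (betaTypeDensity κ β) = betaSecondMoment κ β := by
  have ha := betaShape_pos hκ hκ1 hβ
  have hB := (beta_pos ha hβ).ne'
  rw [integral_pow_betaTypeDensity hκ hκ1 hβ, Nat.cast_two,
    show betaShape κ β + 2 = betaShape κ β + 1 + 1 by ring, beta_add_one (by linarith) hβ,
    beta_add_one ha hβ, ← mul_assoc, mul_div_cancel_right₀ _ hB]
  have h1 : 1 - κ ≠ 0 := by linarith
  have h2 : betaShape κ β + β = β / (1 - κ) := by rw [betaShape]; field_simp; ring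
  have h3 : betaShape κ β + 1 + β = (β + (1 - κ)) / (1 - κ) := by rw [betaShape]; field_simp; ring
  have h4 : β + (1 - κ) ≠ 0 := by linarith
  rw [h2, h3, betaSecondMoment, betaShape]
  field_simp

/-- The first two moments determine the parameters. -/
lemma betaSecondMoment_injective {β' : ℝ} (hκ : 0 < κ) (hκ1 : κ < 1) (hβ : 0 < β) (hβ' : 0 < β')
    (h : betaSecondMoment κ β = betaSecondMoment κ β') : β = β' := by
  have h4 : β + (1 - κ) ≠ 0 := by linarith
  have h5 : β' + (1 - κ) ≠ 0 := by linarith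
  rw [betaSecondMoment, betaSecondMoment, div_eq_div_iff h4 h5] at h
  have h6 : κ * (1 - κ) ^ 2 * (β - β') = 0 := by linear_combination -h
  have h7 : κ * (1 - κ) ^ 2 ≠ 0 := by
    have : 0 < 1 - κ := by linarith
    positivity
  linarith [(mul_eq_zero.1 h6).resolve_left h7]

lemma betaTypeDensity_injective {κ' β' : ℝ} (hκ : 0 < κ) (hκ1 : κ < 1) (hβ : 0 < β)
    (hκ' : 0 < κ') (hκ1' : κ' < 1) (hβ' : 0 < β')
    (h : ∀ t ∈ Ioo (0 : ℝ) 1, betaTypeDensity κ β t = betaTypeDensity κ' β' t) :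
    κ = κ' ∧ β = β' := by
  have hm := densityMeasure_congr h
  have h1 : κ = κ' := by
    rw [← integral_id_betaTypeDensity hκ hκ1 hβ, hm, integral_id_betaTypeDensity hκ' hκ1' hβ']
  subst h1
  refine ⟨rfl, betaSecondMoment_injective hκ hκ1 hβ hβ' ?_⟩
  rw [← integral_sq_betaTypeDensity hκ hκ1 hβ, hm, integral_sq_betaTypeDensity hκ' hκ1' hβ']

section Limits
variable {κs βs : ℕ → ℝ} (hκs : Tendsto κs atTop (𝓝 κ)) (hβs : Tendsto βs atTop (𝓝 β))

include hκs hβs hκ1 in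
lemma tendsto_betaShape : Tendsto (fun n => betaShape (κs n) (βs n)) atTop (𝓝 (betaShape κ β)) :=
  (hκs.mul hβs).div (hκs.const_sub 1) (by linarith)

lemma tendsto_Gamma {a : ℝ} (ha : 0 < a) {as : ℕ → ℝ} (h : Tendsto as atTop (𝓝 a)) :
    Tendsto (fun n => Real.Gamma (as n)) atTop (𝓝 (Real.Gamma a)) :=
  (Real.differentiableAt_Gamma fun m => by
    have := m.cast_nonneg (α := ℝ); linarith).continuousAt.tendsto.comp h

lemma tendsto_beta {a b : ℝ} (ha : 0 < a) (hb : 0 < b) {as bs : ℕ → ℝ}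
    (h1 : Tendsto as atTop (𝓝 a)) (h2 : Tendsto bs atTop (𝓝 b)) :
    Tendsto (fun n => beta (as n) (bs n)) atTop (𝓝 (beta a b)) :=
  ((tendsto_Gamma ha h1).mul (tendsto_Gamma hb h2)).div (tendsto_Gamma (add_pos ha hb) (h1.add h2))
    (Real.Gamma_pos_of_pos (add_pos ha hb)).ne'

include hκ hκ1 hβ hκs hβs

lemma tendsto_betaTypeDensity {t : ℝ} (ht : t ∈ Ioo (0 : ℝ) 1) :
    Tendsto (fun n => betaTypeDensity (κs n) (βs n) t) atTop (𝓝 (betaTypeDensity κ β t)) := by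
  have ha := betaShape_pos hκ hκ1 hβ
  have hsh := tendsto_betaShape hκ1 hκs hβs
  rw [betaTypeDensity_eq hκ1]
  have h1 : Tendsto (fun n => t ^ (betaShape (κs n) (βs n) - 1)) atTop
      (𝓝 (t ^ (betaShape κ β - 1))) := (Real.continuousAt_const_rpow ht.1.ne').tendsto.comp
    (hsh.sub_const 1)
  have h2 : Tendsto (fun n => (1 - t) ^ (βs n - 1)) atTop (𝓝 ((1 - t) ^ (β - 1))) :=
    (Real.continuousAt_const_rpow (by linarith [ht.2])).tendsto.comp (hβs.sub_const 1)
  refine ((h1.mul h2).div (tendsto_beta ha hβ hsh hβs) (beta_pos ha hβ).ne').congr' ?_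
  filter_upwards [hκs.eventually (gt_mem_nhds hκ1)] with n hn
  rw [betaTypeDensity_eq hn]; rfl

/-- Beta densities with convergent parameters are eventually dominated by a multiple of a Beta
density with slightly smaller shape parameters. -/
lemma betaTypeDensity_eventually_le {a₀ : ℝ} (ha₀ : a₀ < betaShape κ β) :
    ∀ᶠ n in atTop, ∀ t ∈ Ioo (0 : ℝ) 1, 0 ≤ betaTypeDensity (κs n) (βs n) t ∧
      betaTypeDensity (κs n) (βs n) t ≤
        2 / beta (betaShape κ β) β * (t ^ (a₀ - 1) * (1 - t) ^ (β / 2 - 1)) := by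
  have ha := betaShape_pos hκ hκ1 hβ
  have hB := beta_pos ha hβ
  have hsh := tendsto_betaShape hκ1 hκs hβs
  filter_upwards [hκs.eventually (gt_mem_nhds hκ1), hκs.eventually (lt_mem_nhds hκ),
    hβs.eventually (lt_mem_nhds (half_lt_self hβ)), hsh.eventually (lt_mem_nhds ha₀),
    (tendsto_beta ha hβ hsh hβs).eventually (lt_mem_nhds (half_lt_self hB))] with n h1 h2 h3 h4 h5 t ht
  have h6 : 0 < βs n := by linarith
  refine ⟨betaTypeDensity_nonneg h2 h1 h6 ht, ?_⟩
  have ht1 : 0 < 1 - t := by linarith [ht.2]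
  have k1 : t ^ (betaShape (κs n) (βs n) - 1) ≤ t ^ (a₀ - 1) :=
    Real.rpow_le_rpow_of_exponent_ge ht.1 ht.2.le (by linarith)
  have k2 : (1 - t) ^ (βs n - 1) ≤ (1 - t) ^ (β / 2 - 1) :=
    Real.rpow_le_rpow_of_exponent_ge ht1 (by linarith [ht.1]) (by linarith)
  have k3 : 0 ≤ t ^ (a₀ - 1) := Real.rpow_nonneg ht.1.le _
  have k4 : 0 ≤ (1 - t) ^ (βs n - 1) := Real.rpow_nonneg ht1.le _
  rw [betaTypeDensity_eq h1, div_le_iff₀ (by linarith)]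
  have k5 : 0 ≤ t ^ (a₀ - 1) * (1 - t) ^ (β / 2 - 1) := beta_kernel_nonneg ht
  calc _ ≤ t ^ (a₀ - 1) * (1 - t) ^ (β / 2 - 1) := mul_le_mul k1 k2 k4 k3
    _ = 2 / beta (betaShape κ β) β * (t ^ (a₀ - 1) * (1 - t) ^ (β / 2 - 1)) *
        (beta (betaShape κ β) β / 2) := by field_simp
    _ ≤ _ := mul_le_mul_of_nonneg_left h5.le (by positivity)

lemma tendsto_integral_betaTypeDensity {g : ℝ → ℝ} (hg : Measurable g) {M : ℝ}
    (hgM : ∀ t ∈ Ioo (0 : ℝ) 1, |g t| ≤ M) :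
    Tendsto (fun n => ∫ t, g t ∂densityMeasure (betaTypeDensity (κs n) (βs n))) atTop
      (𝓝 (∫ t, g t ∂densityMeasure (betaTypeDensity κ β))) := by
  have ha := betaShape_pos hκ hκ1 hβ
  have hdom := betaTypeDensity_eventually_le hκ hκ1 hβ hκs hβs (half_lt_self ha)
  rw [integral_densityMeasure (by fun_prop) fun t ht => betaTypeDensity_nonneg hκ hκ1 hβ ht]
  have : Tendsto (fun n => ∫ t in Ioo (0 : ℝ) 1, betaTypeDensity (κs n) (βs n) t * g t) atTop
      (𝓝 (∫ t in Ioo (0 : ℝ) 1, betaTypeDensity κ β t * g t)) := by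
    refine tendsto_integral_filter_of_dominated_convergence (fun t =>
      2 / beta (betaShape κ β) β * (t ^ (betaShape κ β / 2 - 1) * (1 - t) ^ (β / 2 - 1)) * M)
      (Eventually.of_forall fun n => Measurable.aestronglyMeasurable (by fun_prop)) ?_ ?_ ?_
    · filter_upwards [hdom] with n hn
      filter_upwards [ae_restrict_mem measurableSet_Ioo] with t ht
      rw [norm_mul, Real.norm_of_nonneg (hn t ht).1, Real.norm_eq_abs]
      exact mul_le_mul (hn t ht).2 (hgM t ht) (abs_nonneg _) ((hn t ht).1.trans (hn t ht).2)
    · exact ((integrableOn_beta_kernel (half_pos ha) (half_pos hβ)).const_mul _).mul_const _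
    · filter_upwards [ae_restrict_mem measurableSet_Ioo] with t ht
      exact (tendsto_betaTypeDensity hκ hκ1 hβ hκs hβs ht).mul_const _
  refine this.congr' ?_
  filter_upwards [hdom] with n hn
  rw [integral_densityMeasure (by fun_prop) fun t ht => (hn t ht).1]

/-- Convergence of the inverse moment, which may be infinite. -/
lemma tendsto_lintegral_betaTypeDensity_div {p : ℝ} (hp : 0 < p) :
    Tendsto (fun n => ∫⁻ t in Ioo (0 : ℝ) 1,
        ENNReal.ofReal (betaTypeDensity (κs n) (βs n) t / (p * t))) atTop
      (𝓝 (∫⁻ t in Ioo (0 : ℝ) 1, ENNReal.ofReal (betaTypeDensity κ β t / (p * t)))) := by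
  have ha := betaShape_pos hκ hκ1 hβ
  have hB := beta_pos ha hβ
  have hpt : ∀ᵐ t ∂volume.restrict (Ioo (0 : ℝ) 1),
      Tendsto (fun n => ENNReal.ofReal (betaTypeDensity (κs n) (βs n) t / (p * t))) atTop
        (𝓝 (ENNReal.ofReal (betaTypeDensity κ β t / (p * t)))) := by
    filter_upwards [ae_restrict_mem measurableSet_Ioo] with t ht
    exact (ENNReal.continuous_ofReal.tendsto _).comp
      ((tendsto_betaTypeDensity hκ hκ1 hβ hκs hβs ht).div_const _)
  rcases le_or_gt (betaShape κ β) 1 with h1 | h1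
  -- first shape parameter at most one: the limit is infinite, as the integrand is at least of order
  -- `1 / t` near zero, and Fatou's lemma applies
  · have htop : ∫⁻ t in Ioo (0 : ℝ) 1, ENNReal.ofReal (betaTypeDensity κ β t / (p * t)) = ⊤ := by
      by_contra hne
      have hint : IntegrableOn (fun t => betaTypeDensity κ β t / (p * t)) (Ioo 0 1) := by
        refine (lintegral_ofReal_ne_top_iff_integrable
          (Measurable.aestronglyMeasurable (by fun_prop)) ?_).1 hne
        filter_upwards [ae_restrict_mem measurableSet_Ioo] with t ht
        exact div_nonneg (betaTypeDensity_nonneg hκ hκ1 hβ ht) (mul_pos hp ht.1).le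
      set m : ℝ := min 1 ((1 / 2 : ℝ) ^ (β - 1)) with hm
      have hm0 : 0 < m := lt_min one_pos (Real.rpow_pos_of_pos (by norm_num) _)
      have h2 : IntegrableOn (fun t : ℝ => t ^ (-1 : ℝ)) (Ioo 0 (1 / 2)) := by
        refine ((hint.mono_set (Ioo_subset_Ioo_right (by norm_num))).const_mul
          (beta (betaShape κ β) β * p / m)).mono' (Measurable.aestronglyMeasurable (by fun_prop)) ?_
        filter_upwards [ae_restrict_mem measurableSet_Ioo] with t ht
        have ht1 : t < 1 := by linarith [ht.2]
        have hk : m ≤ (1 - t) ^ (β - 1) := by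
          rcases le_total (β - 1) 0 with hb | hb
          · exact (min_le_left _ _).trans (Real.one_le_rpow_of_pos_of_le_one_of_nonpos
              (by linarith) (by linarith [ht.1]) hb)
          · exact (min_le_right _ _).trans (Real.rpow_le_rpow (by norm_num) (by linarith [ht.2]) hb)
        have hk2 : (1 : ℝ) ≤ t ^ (betaShape κ β - 1) :=
          Real.one_le_rpow_of_pos_of_le_one_of_nonpos ht.1 ht1.le (by linarith)
        rw [Real.norm_of_nonneg (Real.rpow_nonneg ht.1.le _), Real.rpow_neg_one,
          betaTypeDensity_eq hκ1]
        have hk3 : m ≤ t ^ (betaShape κ β - 1) * (1 - t) ^ (β - 1) := by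
          calc m = 1 * m := (one_mul _).symm
            _ ≤ _ := mul_le_mul hk2 hk hm0.le (by linarith)
        have ht0 := ht.1
        calc t⁻¹ = m / m * t⁻¹ := by rw [div_self hm0.ne', one_mul]
          _ ≤ t ^ (betaShape κ β - 1) * (1 - t) ^ (β - 1) / m * t⁻¹ := by gcongr
          _ = _ := by field_simp
      have h3 := (intervalIntegral.integrableOn_Ioo_rpow_iff (s := -1) (t := 1 / 2) (by norm_num)).1 h2
      exact lt_irrefl _ h3
    rw [htop]
    have hfatou := lintegral_liminf_le (u := atTop) (μ := volume.restrict (Ioo (0 : ℝ) 1))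
      (f := fun n t => ENNReal.ofReal (betaTypeDensity (κs n) (βs n) t / (p * t)))
      (fun n => by fun_prop)
    rw [lintegral_congr_ae (hpt.mono fun t ht => ht.liminf_eq), htop, top_le_iff] at hfatou
    refine tendsto_of_le_liminf_of_limsup_le (by rw [hfatou]) le_top
  -- otherwise the densities are dominated with a shape parameter `a₀ > 1`, for which `t ^ (a₀ - 2)` is
  -- integrable at zero
  · have hdom := betaTypeDensity_eventually_le hκ hκ1 hβ hκs hβs
      (a₀ := (1 + betaShape κ β) / 2) (by linarith)
    refine tendsto_lintegral_filter_of_dominated_convergence (fun t => ENNReal.ofReal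
      (2 / beta (betaShape κ β) β / p *
        (t ^ ((1 + betaShape κ β) / 2 - 1 - 1) * (1 - t) ^ (β / 2 - 1))))
      (l := atTop) (Eventually.of_forall fun n => by fun_prop) ?_ ?_ hpt
    · filter_upwards [hdom] with n hn
      filter_upwards [ae_restrict_mem measurableSet_Ioo] with t ht
      refine ENNReal.ofReal_le_ofReal ?_
      rw [div_le_iff₀ (mul_pos hp ht.1)]
      refine (hn t ht).2.trans (le_of_eq ?_)
      rw [Real.rpow_sub_one ht.1.ne' ((1 + betaShape κ β) / 2 - 1)]
      have := ht.1.ne'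
      field_simp
    · have := (integrableOn_beta_kernel (a := (1 + betaShape κ β) / 2 - 1) (b := β / 2)
        (by linarith) (half_pos hβ)).const_mul (2 / beta (betaShape κ β) β / p)
      exact (this.lintegral_lt_top).ne

end Limits
end BetaDensity

/-! ### The Beta approximation -/

namespace NetworkParams
variable {P : NetworkParams}

/-- The inequalities satisfied by `η⁽¹⁾` and `η⁽²⁾` that make `κ` and `c⁽²⁾` the first two moments of
a nondegenerate law on `[0, 1]`. -/
structure IsAdmissible (η : ℕ → ℝ) : Prop where
  one_nonneg : 0 ≤ η 1
  add_nonneg : 0 ≤ η 1 + η 2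
  two_neg : η 2 < 0

lemma kappa_eq (η : ℕ → ℝ) : P.kappa η = Real.exp (-P.noise - P.spatialConst * η 1) := by
  rw [kappa, moment, noise]; simp

lemma moment_two_eq (η : ℕ → ℝ) :
    P.moment η 2 = Real.exp (-(2 * P.noise) - P.spatialConst * (2 * η 1 + η 2)) := by
  have h : Finset.Icc 1 2 = ({1, 2} : Finset ℕ) := rfl
  rw [moment, noise, h, Finset.sum_pair (by norm_num)]
  norm_num
  ring_nf

lemma moment_two_eq_kappa_mul (η : ℕ → ℝ) : P.moment η 2 =
    P.kappa η * Real.exp (-P.noise - P.spatialConst * (η 1 + η 2)) := by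
  rw [moment_two_eq, kappa_eq, ← Real.exp_add]; congr 1; ring

lemma moment_two_eq_kappa_sq_mul (η : ℕ → ℝ) : P.moment η 2 =
    P.kappa η ^ 2 * Real.exp (P.spatialConst * -η 2) := by
  rw [moment_two_eq, kappa_eq, ← Real.exp_nat_mul, ← Real.exp_add]; congr 1; push_cast; ring

lemma exp_neg_noise_lt_one (P : NetworkParams) : Real.exp (-P.noise) < 1 :=
  Real.exp_lt_one_iff.2 (by linarith [P.noise_pos])

lemma kappa_pos (η : ℕ → ℝ) : 0 < P.kappa η := Real.exp_pos _

namespace IsAdmissible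
variable {η : ℕ → ℝ}

lemma kappa_le (h : IsAdmissible η) : P.kappa η ≤ Real.exp (-P.noise) := by
  rw [kappa_eq, Real.exp_le_exp]
  linarith [mul_nonneg (spatialConst_pos (P := P)).le h.one_nonneg]

lemma kappa_lt_one (h : IsAdmissible η) : P.kappa η < 1 := h.kappa_le.trans_lt P.exp_neg_noise_lt_one

lemma moment_two_le (h : IsAdmissible η) :
    P.moment η 2 ≤ P.kappa η * Real.exp (-P.noise) := by
  rw [moment_two_eq_kappa_mul]
  refine mul_le_mul_of_nonneg_left (Real.exp_le_exp.2 ?_) (kappa_pos η).le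
  linarith [mul_nonneg (spatialConst_pos (P := P)).le h.add_nonneg]

lemma le_moment_two_sub (η : ℕ → ℝ) :
    P.kappa η ^ 2 * (P.spatialConst * -η 2) ≤ P.moment η 2 - P.kappa η ^ 2 := by
  rw [moment_two_eq_kappa_sq_mul]
  have := Real.add_one_le_exp (P.spatialConst * -η 2)
  nlinarith [sq_nonneg (P.kappa η)]

lemma moment_two_sub_pos (h : IsAdmissible η) : 0 < P.moment η 2 - P.kappa η ^ 2 := by
  refine lt_of_lt_of_le ?_ (le_moment_two_sub η)
  have := kappa_pos (P := P) η
  have := spatialConst_pos (P := P)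
  have := h.two_neg
  have : 0 < -η 2 := by linarith
  positivity

lemma kappa_sub_pos (h : IsAdmissible η) : 0 < P.kappa η - P.moment η 2 := by
  have h1 := h.moment_two_le (P := P)
  nlinarith [P.exp_neg_noise_lt_one, kappa_pos (P := P) η]

lemma betaParam_pos (h : IsAdmissible η) : 0 < P.betaParam η :=
  div_pos (mul_pos (by linarith [h.kappa_lt_one (P := P)]) h.kappa_sub_pos) h.moment_two_sub_pos

lemma betaSecondMoment_eq (h : IsAdmissible η) :
    betaSecondMoment (P.kappa η) (P.betaParam η) = P.moment η 2 := by
  have h1 := (h.moment_two_sub_pos (P := P)).ne'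
  have h2 : 0 < 1 - P.kappa η := by linarith [h.kappa_lt_one (P := P)]
  have h3 := (kappa_pos (P := P) η).ne'
  have h5 : P.betaParam η + (1 - P.kappa η) ≠ 0 := by linarith [h.betaParam_pos (P := P)]
  rw [betaSecondMoment, div_eq_iff h5, betaParam]
  field_simp
  ring

end IsAdmissible

/-- The integral of a power of `lossKernel`. -/
def kernelMoment (P : NetworkParams) (k : ℕ) : ℝ := ∫ v in Ioi (0 : ℝ), P.lossKernel v ^ k

lemma eta_eq_kernelMoment (ν : Measure ℝ) (k : ℕ) : P.eta ν k =
    (-1) ^ (k + 1) * P.kernelMoment k * ∫ t in Icc (0 : ℝ) 1, P.txProb t ^ k ∂ν := by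
  have h1 : ∀ v, (-1 : ℝ) ^ (k + 1) / (1 + v ^ (P.alpha / 2)) ^ k =
      (-1) ^ (k + 1) * P.lossKernel v ^ k := fun v => by
    rw [lossKernel, div_pow, one_pow, mul_one_div]
  have h2 : ∀ t, (P.p * P.xi) ^ k / (P.xi + (1 - P.xi) * P.p * t) ^ k = P.txProb t ^ k := fun t => by
    rw [txProb, div_pow]
  rw [eta, kernelMoment]
  simp_rw [h1, h2]
  rw [integral_const_mul]

lemma integrableOn_lossKernel_sq : IntegrableOn (fun v => P.lossKernel v ^ 2) (Ioi 0) := by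
  refine (integrableOn_lossKernel (P := P)).mono' (measurable_lossKernel.pow_const _).aestronglyMeasurable ?_
  filter_upwards [ae_restrict_mem measurableSet_Ioi] with v hv
  have h1 := (lossKernel_pos (P := P) (le_of_lt hv)).le
  rw [Real.norm_of_nonneg (by positivity), sq]
  exact mul_le_of_le_one_left h1 (lossKernel_le_one (le_of_lt hv))

lemma kernelMoment_two_pos (P : NetworkParams) : 0 < P.kernelMoment 2 := by
  rw [kernelMoment, setIntegral_pos_iff_support_of_nonneg_ae]
  · have : Function.support (fun v => P.lossKernel v ^ 2) ∩ Ioi 0 = Ioi 0 := by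
      refine inter_eq_right.2 fun v hv => ?_
      exact pow_ne_zero _ (lossKernel_pos (P := P) (le_of_lt hv)).ne'
    rw [this]; simp
  · exact ae_of_all _ fun v => sq_nonneg _
  · exact integrableOn_lossKernel_sq

lemma kernelMoment_two_le (P : NetworkParams) : P.kernelMoment 2 ≤ P.kernelMoment 1 := by
  refine setIntegral_mono_on integrableOn_lossKernel_sq
    (by simpa using integrableOn_lossKernel (P := P)) measurableSet_Ioi fun v hv => ?_
  have h1 := (lossKernel_pos (P := P) (le_of_lt hv)).le
  rw [pow_one, sq]
  exact mul_le_of_le_one_left h1 (lossKernel_le_one (le_of_lt hv))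

lemma integrable_txProb_pow (ν : Measure ℝ) [IsFiniteMeasure ν] (k : ℕ) :
    Integrable (fun t => P.txProb t ^ k) (ν.restrict (Icc 0 1)) := by
  refine Integrable.of_bound (measurable_txProb.pow_const k).aestronglyMeasurable (P.p ^ k) ?_
  filter_upwards [ae_restrict_mem measurableSet_Icc] with t ht
  rw [norm_pow, Real.norm_of_nonneg (txProb_pos ht).le]
  exact pow_le_pow_left₀ (txProb_pos ht).le (txProb_le ht) k

variable (ν : Measure ℝ) [IsProbabilityMeasure ν] (hν : ν.restrict (Icc 0 1) = ν)

include hν in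
lemma integral_txProb_bounds : (∫ t, P.txProb t ^ 1 ∂ν ≤ P.p) ∧
    ((P.p * P.xi) ^ 2 ≤ ∫ t, P.txProb t ^ 2 ∂ν) ∧
    (∫ t, P.txProb t ^ 2 ∂ν ≤ ∫ t, P.txProb t ^ 1 ∂ν) := by
  have hae : ∀ᵐ t ∂ν, t ∈ Icc (0 : ℝ) 1 := by
    rw [← hν]; exact ae_restrict_mem measurableSet_Icc
  have hi : ∀ k, Integrable (fun t => P.txProb t ^ k) ν := fun k => by
    have := integrable_txProb_pow (P := P) ν k
    rwa [hν] at this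
  have hconst : ∀ c : ℝ, ∫ _, c ∂ν = c := fun c => by simp
  refine ⟨?_, ?_, ?_⟩
  · rw [← hconst P.p]
    refine integral_mono_ae (hi 1) (integrable_const _) ?_
    filter_upwards [hae] with t ht
    rw [pow_one]; exact txProb_le ht
  · rw [← hconst ((P.p * P.xi) ^ 2)]
    refine integral_mono_ae (integrable_const _) (hi 2) ?_
    filter_upwards [hae] with t ht
    exact pow_le_pow_left₀ (mul_pos P.p_pos P.xi_pos).le (le_txProb ht) 2
  · refine integral_mono_ae (hi 2) (hi 1) ?_
    filter_upwards [hae] with t ht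
    have h1 := (txProb_pos (P := P) ht).le
    simp only [pow_one, sq]
    exact mul_le_of_le_one_left h1 ((txProb_le ht).trans P.p_lt_one.le)

include hν in
lemma eta_bounds : IsAdmissible (P.eta ν) ∧ P.eta ν 1 ≤ P.kernelMoment 1 * P.p ∧
    P.kernelMoment 2 * (P.p * P.xi) ^ 2 ≤ -P.eta ν 2 := by
  obtain ⟨h1, h2, h3⟩ := integral_txProb_bounds (P := P) ν hν
  have e1 : P.eta ν 1 = P.kernelMoment 1 * ∫ t, P.txProb t ^ 1 ∂ν := by
    rw [eta_eq_kernelMoment, hν]; ring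
  have e2 : P.eta ν 2 = -(P.kernelMoment 2 * ∫ t, P.txProb t ^ 2 ∂ν) := by
    rw [eta_eq_kernelMoment, hν]; ring
  have k2 := P.kernelMoment_two_pos
  have k1 := P.kernelMoment_two_le
  have hpx : 0 < (P.p * P.xi) ^ 2 := pow_pos (mul_pos P.p_pos P.xi_pos) 2
  refine ⟨⟨?_, ?_, ?_⟩, ?_, ?_⟩
  · rw [e1]; exact mul_nonneg (by linarith) (by linarith)
  · rw [e1, e2]
    have := mul_le_mul k1 h3 (by linarith) (by linarith)
    linarith
  · rw [e2]
    have := mul_pos k2 (by linarith : 0 < ∫ t, P.txProb t ^ 2 ∂ν)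
    linarith
  · rw [e1]; exact mul_le_mul_of_nonneg_left h1 (by linarith)
  · rw [e2, neg_neg]; exact mul_le_mul_of_nonneg_left h2 k2.le

/-- A compact set that contains the parameters `(κ, β)` belonging to any law on `[0, 1]`. -/
lemma exists_param_bounds (P : NetworkParams) : ∃ k₀ k₁ b₀ b₁ : ℝ, 0 < k₀ ∧ k₁ < 1 ∧ 0 < b₀ ∧
    ∀ (ν : Measure ℝ) [IsProbabilityMeasure ν], ν.restrict (Icc 0 1) = ν →
      P.kappa (P.eta ν) ∈ Icc k₀ k₁ ∧ P.betaParam (P.eta ν) ∈ Icc b₀ b₁ := by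
  have hC := spatialConst_pos (P := P)
  set k₀ := Real.exp (-P.noise - P.spatialConst * (P.kernelMoment 1 * P.p)) with hk₀
  set k₁ := Real.exp (-P.noise) with hk₁
  set d := k₀ ^ 2 * (P.spatialConst * (P.kernelMoment 2 * (P.p * P.xi) ^ 2)) with hd
  have hk₀p : 0 < k₀ := Real.exp_pos _
  have hk₁1 : k₁ < 1 := P.exp_neg_noise_lt_one
  have hpx : 0 < P.p * P.xi := mul_pos P.p_pos P.xi_pos
  have hd0 : 0 < d := by
    have := P.kernelMoment_two_pos
    positivity
  refine ⟨k₀, k₁, (1 - k₁) * (k₀ * (1 - k₁)), 1 / d, hk₀p, hk₁1,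
    mul_pos (by linarith) (mul_pos hk₀p (by linarith)), fun ν _ hν => ?_⟩
  obtain ⟨had, h1, h2⟩ := eta_bounds (P := P) ν hν
  have hκ : k₀ ≤ P.kappa (P.eta ν) := by
    rw [kappa_eq, hk₀, Real.exp_le_exp]
    linarith [mul_le_mul_of_nonneg_left h1 hC.le]
  have hκ1 := had.kappa_le (P := P)
  have hv := had.moment_two_sub_pos (P := P)
  have hvd : d ≤ P.moment (P.eta ν) 2 - P.kappa (P.eta ν) ^ 2 := by
    refine le_trans ?_ (IsAdmissible.le_moment_two_sub _)
    rw [hd]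
    have := P.kernelMoment_two_pos
    gcongr
  have hm := had.moment_two_le (P := P)
  have hm0 : 0 < P.moment (P.eta ν) 2 := Real.exp_pos _
  have hκp := kappa_pos (P := P) (P.eta ν)
  have hsub : k₀ * (1 - k₁) ≤ P.kappa (P.eta ν) - P.moment (P.eta ν) 2 := by
    nlinarith
  have hnum : (1 - P.kappa (P.eta ν)) * (P.kappa (P.eta ν) - P.moment (P.eta ν) 2) ≤ 1 :=
    mul_le_one₀ (by linarith) had.kappa_sub_pos.le (by linarith)
  refine ⟨⟨hκ, hκ1⟩, ?_, ?_⟩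
  · rw [betaParam, le_div_iff₀ hv]
    have hv1 : P.moment (P.eta ν) 2 - P.kappa (P.eta ν) ^ 2 ≤ 1 := by
      nlinarith [sq_nonneg (P.kappa (P.eta ν))]
    have h3 : (1 - k₁) * (k₀ * (1 - k₁)) ≤
        (1 - P.kappa (P.eta ν)) * (P.kappa (P.eta ν) - P.moment (P.eta ν) 2) :=
      mul_le_mul (by linarith) hsub (mul_nonneg hk₀p.le (by linarith)) (by linarith)
    refine le_trans ?_ h3
    exact mul_le_of_le_one_right (mul_nonneg (by linarith) (mul_nonneg hk₀p.le (by linarith))) hv1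
  · rw [betaParam, div_le_div_iff₀ hv hd0]
    calc _ ≤ 1 * d := mul_le_mul_of_nonneg_right hnum hd0.le
      _ ≤ _ := mul_le_mul_of_nonneg_left hvd zero_le_one

lemma delta_lt_one (P : NetworkParams) : P.delta < 1 := by
  rw [delta, div_lt_one (by linarith [P.two_lt_alpha])]; exact P.two_lt_alpha

lemma isAdmissible_etaIter_zero (P : NetworkParams) : IsAdmissible (P.etaIter 0) := by
  set M := 2 * Real.pi ^ 2 * P.theta ^ P.delta * (P.xi * P.p) /
    (P.alpha * Real.sin (Real.pi * P.delta)) with hM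
  have hδ := P.delta_pos
  have hδ1 := P.delta_lt_one
  have hx : 0 < P.xi * P.p := mul_pos P.xi_pos P.p_pos
  have hx1 : P.xi * P.p < 1 := by nlinarith [P.xi_pos, P.xi_le_one, P.p_pos, P.p_lt_one]
  have hsin : 0 < Real.sin (Real.pi * P.delta) := Real.sin_pos_of_pos_of_lt_pi
    (mul_pos Real.pi_pos hδ) (by nlinarith [Real.pi_pos])
  have hα : 0 < P.alpha := by linarith [P.two_lt_alpha]
  have hM0 : 0 < M := by
    have := Real.rpow_pos_of_pos P.theta_pos P.delta
    have := Real.pi_pos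
    positivity
  have e1 : P.etaIter 0 1 = M := by
    rw [hM]; simp only [etaIter, Nat.sub_self, Ring.choose_zero_right, pow_one]; ring
  have e2 : P.etaIter 0 2 = -((1 - P.delta) * (P.xi * P.p)) * M := by
    rw [hM]; simp only [etaIter, Nat.add_one_sub_one, Ring.choose_one_right]; ring
  refine ⟨?_, ?_, ?_⟩
  · rw [e1]; exact hM0.le
  · rw [e1, e2]
    have : (1 - P.delta) * (P.xi * P.p) ≤ 1 := mul_le_one₀ (by linarith) hx.le hx1.le
    nlinarith
  · rw [e2]
    have : 0 < (1 - P.delta) * (P.xi * P.p) := mul_pos (by linarith) hx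
    nlinarith

lemma isProbabilityMeasure_of_isAdmissible {η : ℕ → ℝ} (h : IsAdmissible η) :
    IsProbabilityMeasure (densityMeasure (betaTypeDensity (P.kappa η) (P.betaParam η))) :=
  isProbabilityMeasure_betaTypeDensity (kappa_pos η) h.kappa_lt_one h.betaParam_pos

lemma isAdmissible_etaIter (P : NetworkParams) (n : ℕ) : IsAdmissible (P.etaIter n) := by
  induction n with
  | zero => exact P.isAdmissible_etaIter_zero
  | succ n ih =>
    have := isProbabilityMeasure_of_isAdmissible (P := P) ih
    exact (eta_bounds _ (densityMeasure_restrict _)).1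

/-- The parameters `κ_n` and `β_n` are chosen so that the first two moments are `c_n⁽¹⁾` and
`c_n⁽²⁾`. The statement includes `n = 0`, where truncated subtraction makes it the one for
`n = 1`. -/
theorem densityIter_spec (P : NetworkParams) (n : ℕ) :
    0 < P.kappaIter n ∧ P.kappaIter n < 1 ∧ 0 < P.betaIter n ∧
      IsProbabilityMeasure (densityMeasure (P.densityIter n)) ∧
      ∀ m ∈ ({1, 2} : Set ℕ),
        ∫ t, t ^ m ∂(densityMeasure (P.densityIter n)) = P.momentIter n m := by
  have h := P.isAdmissible_etaIter (n - 1)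
  have h1 : 0 < P.kappaIter n := kappa_pos _
  have h2 : P.kappaIter n < 1 := h.kappa_lt_one
  have h3 : 0 < P.betaIter n := h.betaParam_pos
  refine ⟨h1, h2, h3, isProbabilityMeasure_betaTypeDensity h1 h2 h3, ?_⟩
  rintro m (rfl | rfl)
  · exact integral_id_betaTypeDensity h1 h2 h3
  · exact (integral_sq_betaTypeDensity h1 h2 h3).trans h.betaSecondMoment_eq

/-- If the densities converge pointwise, then so do their parameters: these stay in a compact set,
and each limit point is determined by the limit of the densities. -/
lemma tendsto_params {f : ℝ → ℝ}
    (hf : ∀ u ∈ Ioo (0 : ℝ) 1, Tendsto (fun n => P.densityIter n u) atTop (𝓝 (f u))) :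
    ∃ κ β : ℝ, 0 < κ ∧ κ < 1 ∧ 0 < β ∧
      Tendsto P.kappaIter atTop (𝓝 κ) ∧ Tendsto P.betaIter atTop (𝓝 β) ∧
      ∀ u ∈ Ioo (0 : ℝ) 1, f u = betaTypeDensity κ β u := by
  obtain ⟨k₀, k₁, b₀, b₁, hk₀, hk₁, hb₀, hbd⟩ := P.exists_param_bounds
  set q : ℕ → ℝ × ℝ := fun n => (P.kappaIter n, P.betaIter n) with hq
  set K : Set (ℝ × ℝ) := Icc k₀ k₁ ×ˢ Icc b₀ b₁ with hK
  have hKc : IsCompact K := isCompact_Icc.prod isCompact_Icc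
  -- from `n = 2` on, the parameters come from a probability density
  have hqK : ∀ᶠ n in atTop, q n ∈ K := by
    filter_upwards [eventually_ge_atTop 2] with n hn
    obtain ⟨n, rfl⟩ := Nat.exists_eq_add_of_le' hn
    have := (P.densityIter_spec (n + 1)).2.2.2.1
    exact hbd (densityMeasure (P.densityIter (n + 1))) (densityMeasure_restrict _)
  have hlim : ∀ z ∈ K, MapClusterPt z atTop q →
      ∀ u ∈ Ioo (0 : ℝ) 1, f u = betaTypeDensity z.1 z.2 u := by
    intro z hz hcl u hu
    obtain ⟨ψ, hψ, hψz⟩ := hcl.tendsto_subseq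
    have h1 : Tendsto (fun n => P.kappaIter (ψ n)) atTop (𝓝 z.1) :=
      (continuous_fst.tendsto z).comp hψz
    have h2 : Tendsto (fun n => P.betaIter (ψ n)) atTop (𝓝 z.2) :=
      (continuous_snd.tendsto z).comp hψz
    exact tendsto_nhds_unique ((hf u hu).comp hψ.tendsto_atTop)
      (tendsto_betaTypeDensity (hk₀.trans_le hz.1.1) (hz.1.2.trans_lt hk₁) (hb₀.trans_le hz.2.1)
        h1 h2 hu)
  obtain ⟨z, hz, hcl⟩ := hKc.exists_mapClusterPt_of_frequently hqK.frequently
  have hconv : Tendsto q atTop (𝓝 z) := by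
    refine hKc.tendsto_nhds_of_unique_mapClusterPt hqK fun y hy hycl => ?_
    have := betaTypeDensity_injective (hk₀.trans_le hy.1.1) (hy.1.2.trans_lt hk₁)
      (hb₀.trans_le hy.2.1) (hk₀.trans_le hz.1.1) (hz.1.2.trans_lt hk₁) (hb₀.trans_le hz.2.1)
      fun t ht => (hlim y hy hycl t ht).symm.trans (hlim z hz hcl t ht)
    exact Prod.ext this.1 this.2
  exact ⟨z.1, z.2, hk₀.trans_le hz.1.1, hz.1.2.trans_lt hk₁, hb₀.trans_le hz.2.1,
    (continuous_fst.tendsto z).comp hconv, (continuous_snd.tendsto z).comp hconv, hlim z hz hcl⟩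

lemma tendsto_eta_betaTypeDensity {κ β : ℝ} (hκ : 0 < κ) (hκ1 : κ < 1) (hβ : 0 < β) {κs βs : ℕ → ℝ}
    (hκs : Tendsto κs atTop (𝓝 κ)) (hβs : Tendsto βs atTop (𝓝 β)) (k : ℕ) :
    Tendsto (fun n => P.eta (densityMeasure (betaTypeDensity (κs n) (βs n))) k) atTop
      (𝓝 (P.eta (densityMeasure (betaTypeDensity κ β)) k)) := by
  simp_rw [eta_eq_kernelMoment, densityMeasure_restrict]
  refine (tendsto_integral_betaTypeDensity hκ hκ1 hβ hκs hβs (measurable_txProb.pow_const k)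
    (M := P.p ^ k) fun t ht => ?_).const_mul _
  have ht' := Ioo_subset_Icc_self ht
  rw [abs_pow, abs_of_pos (txProb_pos ht')]
  exact pow_le_pow_left₀ (txProb_pos ht').le (txProb_le ht') k

lemma tendsto_moment {ηs : ℕ → ℕ → ℝ} {η : ℕ → ℝ} (h : ∀ k, Tendsto (fun n => ηs n k) atTop (𝓝 (η k)))
    (m : ℕ) : Tendsto (fun n => P.moment (ηs n) m) atTop (𝓝 (P.moment η m)) :=
  (Real.continuous_exp.tendsto _).comp
    (((tendsto_finsetSum _ fun k _ => (h k).const_mul _).const_mul _).const_sub _)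

/-- Once the parameters converge, the moments and `η` pass to the limit, since `η` and the moments are
integrals of bounded functions. -/
theorem densityIter_limit {f : ℝ → ℝ}
    (hf : ∀ u ∈ Ioo (0 : ℝ) 1, Tendsto (fun n => P.densityIter n u) atTop (𝓝 (f u))) :
    (∃ κ β : ℝ, 0 < κ ∧ κ < 1 ∧ 0 < β ∧
        Tendsto P.kappaIter atTop (𝓝 κ) ∧ Tendsto P.betaIter atTop (𝓝 β) ∧
        ∀ u ∈ Ioo (0 : ℝ) 1, f u = betaTypeDensity κ β u) ∧
      IsProbabilityMeasure (densityMeasure f) ∧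
      (∀ m ∈ ({1, 2} : Set ℕ),
        ∫ t, t ^ m ∂(densityMeasure f) = P.moment (P.eta (densityMeasure f)) m) ∧
      Tendsto (fun n => ENNReal.ofReal (1 / P.xi - 1) +
          ∫⁻ t in Ioo (0 : ℝ) 1, ENNReal.ofReal (P.densityIter n t / (P.p * t))) atTop
        (𝓝 (ENNReal.ofReal (1 / P.xi - 1) +
          ∫⁻ t in Ioo (0 : ℝ) 1, ENNReal.ofReal (f t / (P.p * t)))) := by
  obtain ⟨κ, β, hκ, hκ1, hβ, hκs, hβs, hfu⟩ := tendsto_params hf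
  have hmeas := densityMeasure_congr hfu
  refine ⟨⟨κ, β, hκ, hκ1, hβ, hκs, hβs, hfu⟩, ?_, ?_, ?_⟩
  · rw [hmeas]; exact isProbabilityMeasure_betaTypeDensity hκ hκ1 hβ
  · rw [hmeas]
    intro m hm
    have hη : ∀ k, Tendsto (fun n => P.etaIter (n + 1) k) atTop
        (𝓝 (P.eta (densityMeasure (betaTypeDensity κ β)) k)) := fun k =>
      tendsto_eta_betaTypeDensity hκ hκ1 hβ (hκs.comp (tendsto_add_atTop_nat 1))
        (hβs.comp (tendsto_add_atTop_nat 1)) k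
    have h1 : Tendsto (fun n => P.momentIter (n + 2) m) atTop
        (𝓝 (P.moment (P.eta (densityMeasure (betaTypeDensity κ β))) m)) := tendsto_moment hη m
    have h2 : Tendsto (fun n => ∫ t, t ^ m ∂(densityMeasure (P.densityIter (n + 2)))) atTop
        (𝓝 (∫ t, t ^ m ∂(densityMeasure (betaTypeDensity κ β)))) :=
      tendsto_integral_betaTypeDensity hκ hκ1 hβ (hκs.comp (tendsto_add_atTop_nat 2))
        (hβs.comp (tendsto_add_atTop_nat 2)) (measurable_id.pow_const m) (M := 1) fun t ht => by
          rw [abs_pow, abs_of_pos ht.1]; exact pow_le_one₀ ht.1.le ht.2.le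
    exact tendsto_nhds_unique h2 (h1.congr fun n => ((P.densityIter_spec (n + 2)).2.2.2.2 m hm).symm)
  · refine Tendsto.const_add _ ?_
    have h1 : ∫⁻ t in Ioo (0 : ℝ) 1, ENNReal.ofReal (f t / (P.p * t)) =
        ∫⁻ t in Ioo (0 : ℝ) 1, ENNReal.ofReal (betaTypeDensity κ β t / (P.p * t)) :=
      setLIntegral_congr_fun measurableSet_Ioo fun t ht => by simp only [hfu t ht]
    rw [h1]
    exact tendsto_lintegral_betaTypeDensity_div hκ hκ1 hβ hκs hβs P.p_pos

end NetworkParams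

end

theorem theorem2 (P : NetworkParams) :
    -- the exact expression, with the CDF `F` of `ν`
    (∀ (ν : Measure ℝ) [IsProbabilityMeasure ν], ν (Icc 0 1) = 1 →
      ∀ (Ω : Type*) [MeasurableSpace Ω] (Pr : Measure Ω) [IsProbabilityMeasure Pr]
        (N : MeanFieldNetwork P ν Pr),
        -- deconditioning on the topology, for any law `ν` of the interferers' success probabilities
        (∀ t, N.averageAoI = ENNReal.ofReal (1 / P.xi - 1) +
          ∫⁻ ω, (ENNReal.ofReal (P.p * N.successProb t ω))⁻¹ ∂Pr) ∧
        -- moments of the typical link's success probability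
        (∀ t m : ℕ, ∫ ω, N.successProb t ω ^ m ∂Pr = P.moment (P.eta ν) m) ∧
        -- the law of the success probabilities is given by the fixed-point equation
        (N.SelfConsistent ↔ P.SolvesFixedPoint ν) ∧
        -- the network average AoI
        (N.SelfConsistent → N.averageAoI = ENNReal.ofReal (1 / P.xi - 1) +
          ∫⁻ t in Icc (0 : ℝ) 1, (ENNReal.ofReal (P.p * t))⁻¹ ∂ν)) ∧
    -- the Beta-type densities `f_n` are probability densities with first moments `c_n`
    (∀ n : ℕ, 1 ≤ n →
      0 < P.kappaIter n ∧ P.kappaIter n < 1 ∧ 0 < P.betaIter n ∧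
      IsProbabilityMeasure (densityMeasure (P.densityIter n)) ∧
      ∀ m ∈ ({1, 2} : Set ℕ),
        ∫ t, t ^ m ∂(densityMeasure (P.densityIter n)) = P.momentIter n m) ∧
    -- the approximation with their limit `f`
    (∀ f : ℝ → ℝ,
      (∀ u ∈ Ioo (0 : ℝ) 1, Tendsto (fun n => P.densityIter n u) atTop (𝓝 (f u))) →
      (∃ κ β : ℝ, 0 < κ ∧ κ < 1 ∧ 0 < β ∧
        Tendsto P.kappaIter atTop (𝓝 κ) ∧ Tendsto P.betaIter atTop (𝓝 β) ∧
        ∀ u ∈ Ioo (0 : ℝ) 1, f u = betaTypeDensity κ β u) ∧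
      IsProbabilityMeasure (densityMeasure f) ∧
      -- `f` is self-consistent up to the second moment
      (∀ m ∈ ({1, 2} : Set ℕ),
        ∫ t, t ^ m ∂(densityMeasure f) = P.moment (P.eta (densityMeasure f)) m) ∧
      -- the approximate network average AoI is the limit of those computed from the `f_n`
      Tendsto (fun n => ENNReal.ofReal (1 / P.xi - 1) +
          ∫⁻ t in Ioo (0 : ℝ) 1, ENNReal.ofReal (P.densityIter n t / (P.p * t))) atTop
        (𝓝 (ENNReal.ofReal (1 / P.xi - 1) +
          ∫⁻ t in Ioo (0 : ℝ) 1, ENNReal.ofReal (f t / (P.p * t))))) := by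
  refine ⟨fun ν _ hν Ω _ Pr _ N => ⟨N.averageAoI_eq hν, N.integral_successProb_pow hν,
    N.selfConsistent_iff hν, N.averageAoI_of_selfConsistent hν⟩, fun n _ => P.densityIter_spec n,
    fun f hf => NetworkParams.densityIter_limit hf⟩
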